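/- Let $\mathsf{RCA}_0^\omega$ be Kohlenbach's base theory of higher-order reverse mathematics: classical many-sorted predicate logic over all finite types with equality of type $0$ as primitive, the axioms for $0,S,+,\times$, the combinators $\Pi,\Sigma$ and the recursor $R_0$, extensionality at all types, quantifier-free induction, and $\mathsf{QF\text{-}AC}^{1,0}$. Let $\mathsf{ACA}_0^\omega$ be $\mathsf{RCA}_0^\omega$ plus $$(\exists^2)\qquad (\exists \varphi^{2}\leq_2 1)(\forall f^{1})\big[(\exists n)(f(n)=0)\leftrightarrow \varphi(f)=0\big].$$ Real numbers are represented by fast-converging Cauchy sequences of rationals, with equality $=_{\mathbb R}$ defined as usual. For $\mathsf X$ one of $[0,1]$, $\mathbb R$ and Cantor space $C=2^{\mathbb N}$, functions on $\mathsf X$ respect equality on $\mathsf X$, and a set $A\subset \mathsf X$ is given by a function $A:\mathsf X\to\{0,1\}$, where $x\in A$ means $A(x)=1$. The set $A$ is countable if there is $Y:\mathsf X\to\mathbb N$ that is injective on $A$, and strongly countable if there is $Y:\mathsf X\to\mathbb N$ that is injective on $A$ and satisfies $(\forall n\in\mathbb N)(\exists x\in A)(Y(x)=n)$. It is enumerable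 if there is a sequence $(x_n)_{n\in\mathbb N}$ in $\mathsf X$ such that $(\forall x\in \mathsf X)\big(x\in A\leftrightarrow(\exists n\in\mathbb N)(x=_{\mathsf X} x_n)\big)$. Let $\mathsf{cocode}_0^{\mathsf X}$ be the statement that every non-empty countable subset of $\mathsf X$ is enumerable, let $\mathsf{cocode}_1^{\mathsf X}$ be the statement that every strongly countable subset of $\mathsf X$ is enumerable, and let $\mathsf{cocode}_i$ be $\mathsf{cocode}_i^{[0,1]}$. **Theorem.** For $i=0,1$, the theory $\mathsf{ACA}_0^\omega$ proves $$\mathsf{cocode}_i\leftrightarrow \mathsf{cocode}_i^{\mathbb R}\leftrightarrow \mathsf{cocode}_i^{C}.$$ -/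

import Mathlib

/-!
Classical many-sorted predicate logic over all finite types, the base theory `ACA₀^ω` of
higher-order reverse mathematics as a set of axioms, derivability from such a set, and the
enumeration principles `cocode₀`, `cocode₁` as sentences of that language.
-/

namespace HOA

/-- The finite types: `0` (natural numbers), and `σ → τ`. -/
inductive Ty : Type
  | nat : Ty
  | arr : Ty → Ty → Ty
  deriving DecidableEq

/-- Type `1 = 0 → 0`: number-theoretic functions. -/
abbrev Ty.one : Ty := Ty.arr Ty.nat Ty.nat

/-- Type `2 = 1 → 0`: functionals. -/
abbrev Ty.two : Ty := Ty.arr Ty.one Ty.nat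

/-- Type `0 → 1`: sequences of number-theoretic functions. -/
abbrev Ty.seq : Ty := Ty.arr Ty.nat Ty.one

/-- The constants: zero, successor, addition, multiplication, the combinators `Π` and `Σ` at all
types, and the recursor `R₀` of type `0`. -/
inductive Con : Ty → Type
  | zero : Con Ty.nat
  | succ : Con (Ty.arr Ty.nat Ty.nat)
  | add : Con (Ty.arr Ty.nat (Ty.arr Ty.nat Ty.nat))
  | mul : Con (Ty.arr Ty.nat (Ty.arr Ty.nat Ty.nat))
  | pi (ρ σ : Ty) : Con (Ty.arr ρ (Ty.arr σ ρ))
  | sigma (ρ σ τ : Ty) :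
      Con (Ty.arr (Ty.arr ρ (Ty.arr σ τ)) (Ty.arr (Ty.arr ρ σ) (Ty.arr ρ τ)))
  | recursor :
      Con (Ty.arr (Ty.arr Ty.nat (Ty.arr Ty.nat Ty.nat)) (Ty.arr Ty.nat (Ty.arr Ty.nat Ty.nat)))

/-- Terms. Every type `τ` has its own variables `var τ 0, var τ 1, …`; bound variables are
de Bruijn indices, counted separately for each type, so `Fm.all τ φ` binds `var τ 0` in `φ` and the
free variable `var τ n` of `Fm.all τ φ` is written `var τ (n + 1)` inside `φ`. -/
inductive Tm : Ty → Type
  | var (τ : Ty) (n : ℕ) : Tm τ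
  | con {τ : Ty} (c : Con τ) : Tm τ
  | app {σ τ : Ty} (s : Tm (Ty.arr σ τ)) (t : Tm σ) : Tm τ

/-- Formulas. The only prime formulas are equations of type `0` and falsum. -/
inductive Fm : Type
  | eq (s t : Tm Ty.nat) : Fm
  | bot : Fm
  | imp (φ ψ : Fm) : Fm
  | all (τ : Ty) (φ : Fm) : Fm

/-! ### Substitution -/

/-- A simultaneous substitution. -/
abbrev Sub : Type := (τ : Ty) → ℕ → Tm τ

/-- The identity substitution. -/
def Sub.id : Sub := fun τ n => Tm.var τ n

/-- Weakening: make room for a new variable `var τ 0`. -/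
def Sub.wk (τ : Ty) : Sub := fun ρ n => Tm.var ρ (if ρ = τ then n + 1 else n)

/-- `var τ 0 ↦ t`, `var τ (n + 1) ↦ s τ n`, and `s` on the variables of other types. -/
def Sub.cons (τ : Ty) (t : Tm τ) (s : Sub) : Sub := fun ρ n =>
  if h : ρ = τ then
    match n with
    | 0 => h ▸ t
    | k + 1 => s ρ k
  else s ρ n

def Tm.subst (s : Sub) : {τ : Ty} → Tm τ → Tm τ
  | _, Tm.var τ n => s τ n
  | _, Tm.con c => Tm.con c
  | _, Tm.app t u => Tm.app (t.subst s) (u.subst s)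

/-- `t` inside the scope of one more quantifier of type `τ`. -/
def Tm.wk (τ : Ty) {ρ : Ty} (t : Tm ρ) : Tm ρ := t.subst (Sub.wk τ)

/-- The substitution to be used below a quantifier of type `τ`. -/
def Sub.lift (τ : Ty) (s : Sub) : Sub := Sub.cons τ (Tm.var τ 0) (fun ρ n => (s ρ n).wk τ)

def Fm.subst : Sub → Fm → Fm
  | s, Fm.eq t u => Fm.eq (t.subst s) (u.subst s)
  | _, Fm.bot => Fm.bot
  | s, Fm.imp φ ψ => Fm.imp (φ.subst s) (ψ.subst s)
  | s, Fm.all τ φ => Fm.all τ (φ.subst (s.lift τ))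

def Fm.wk (τ : Ty) (φ : Fm) : Fm := φ.subst (Sub.wk τ)

/-- Replace `var τ 0` by `t` and remove it from the list of variables. -/
def Fm.inst {τ : Ty} (t : Tm τ) (φ : Fm) : Fm := φ.subst (Sub.cons τ t Sub.id)

/-! ### Defined connectives -/

def Fm.neg (φ : Fm) : Fm := Fm.imp φ Fm.bot
def Fm.or (φ ψ : Fm) : Fm := Fm.imp φ.neg ψ
def Fm.and (φ ψ : Fm) : Fm := (Fm.imp φ ψ.neg).neg
def Fm.iff (φ ψ : Fm) : Fm := (Fm.imp φ ψ).and (Fm.imp ψ φ)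
def Fm.ex (τ : Ty) (φ : Fm) : Fm := (Fm.all τ φ.neg).neg

/-- Quantifier-free formulas. -/
def Fm.QF : Fm → Prop
  | Fm.eq _ _ => True
  | Fm.bot => True
  | Fm.imp φ ψ => φ.QF ∧ ψ.QF
  | Fm.all _ _ => False

/-! ### Derivability -/

/-- Natural deduction for classical many-sorted predicate logic with equality of type `0`:
`Prf T Γ φ` says that `φ` is derivable from the axioms `T` (read universally closed) and the
assumptions `Γ`. -/
inductive Prf (T : Set Fm) : List Fm → Fm → Prop
  | ax {Γ : List Fm} {φ : Fm} : φ ∈ T → Prf T Γ φ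
  | hyp {Γ : List Fm} {φ : Fm} : φ ∈ Γ → Prf T Γ φ
  | impI {Γ : List Fm} {φ ψ : Fm} : Prf T (φ :: Γ) ψ → Prf T Γ (Fm.imp φ ψ)
  | impE {Γ : List Fm} {φ ψ : Fm} : Prf T Γ (Fm.imp φ ψ) → Prf T Γ φ → Prf T Γ ψ
  | raa {Γ : List Fm} {φ : Fm} : Prf T (φ.neg :: Γ) Fm.bot → Prf T Γ φ
  | allI {Γ : List Fm} {τ : Ty} {φ : Fm} : Prf T (Γ.map (Fm.wk τ)) φ → Prf T Γ (Fm.all τ φ)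
  | allE {Γ : List Fm} {τ : Ty} {φ : Fm} (t : Tm τ) : Prf T Γ (Fm.all τ φ) → Prf T Γ (φ.inst t)
  | eqRefl {Γ : List Fm} (t : Tm Ty.nat) : Prf T Γ (Fm.eq t t)
  | eqSubst {Γ : List Fm} {s t : Tm Ty.nat} (φ : Fm) :
      Prf T Γ (Fm.eq s t) → Prf T Γ (φ.inst s) → Prf T Γ (φ.inst t)

/-- The theory `T` proves `φ`. -/
def Proves (T : Set Fm) (φ : Fm) : Prop := Prf T [] φ

/-! ### Terms and formulas of arithmetic -/

/-- The number variable `var 0 n`. -/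
abbrev nv (n : ℕ) : Tm Ty.nat := Tm.var Ty.nat n
/-- The type `1` variable `var 1 n`. -/
abbrev fv (n : ℕ) : Tm Ty.one := Tm.var Ty.one n

def zero : Tm Ty.nat := Tm.con Con.zero
def succ (t : Tm Ty.nat) : Tm Ty.nat := Tm.app (Tm.con Con.succ) t
def one : Tm Ty.nat := succ zero
def two : Tm Ty.nat := succ one
def add (s t : Tm Ty.nat) : Tm Ty.nat := Tm.app (Tm.app (Tm.con Con.add) s) t
def mul (s t : Tm Ty.nat) : Tm Ty.nat := Tm.app (Tm.app (Tm.con Con.mul) s) t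

def recur (f : Tm (Ty.arr Ty.nat (Ty.arr Ty.nat Ty.nat))) (m n : Tm Ty.nat) : Tm Ty.nat :=
  Tm.app (Tm.app (Tm.app (Tm.con Con.recursor) f) m) n

/-- `Π t`, the constant function with value `t`. -/
def const (σ : Ty) {ρ : Ty} (t : Tm ρ) : Tm (Ty.arr σ ρ) := Tm.app (Tm.con (Con.pi ρ σ)) t

/-- `2 ^ t`, by recursion with the step `fun _ x => 2 * x`. -/
def pow2 (t : Tm Ty.nat) : Tm Ty.nat :=
  recur (const Ty.nat (Tm.app (Tm.con Con.mul) two)) one t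

/-- `s ≤ t`, that is, `∃ z, s + z = t`. -/
def le (s t : Tm Ty.nat) : Fm :=
  Fm.ex Ty.nat (Fm.eq (add (s.wk Ty.nat) (nv 0)) (t.wk Ty.nat))

/-- Extensional equality at all finite types. -/
def eqAt : (τ : Ty) → Tm τ → Tm τ → Fm
  | Ty.nat, s, t => Fm.eq s t
  | Ty.arr σ τ, s, t =>
      Fm.all σ (eqAt τ (Tm.app (s.wk σ) (Tm.var σ 0)) (Tm.app (t.wk σ) (Tm.var σ 0)))

/-! ### The theories -/

/-- The axiom of extensionality: `∀ z x y, x = y → z x = z y`. -/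
def extensionality (ρ τ : Ty) : Fm :=
  Fm.all (Ty.arr ρ τ) (Fm.all ρ (Fm.all ρ (Fm.imp
    (eqAt ρ (Tm.var ρ 1) (Tm.var ρ 0))
    (eqAt τ (Tm.app (Tm.var (Ty.arr ρ τ) 0) (Tm.var ρ 1))
      (Tm.app (Tm.var (Ty.arr ρ τ) 0) (Tm.var ρ 0))))))

/-- Induction for `φ(n)` with `n` the variable `var 0 0`:
`φ(0) → (∀ n, φ(n) → φ(n + 1)) → ∀ n, φ(n)`. -/
def induction (φ : Fm) : Fm :=
  Fm.imp (φ.inst zero) (Fm.imp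
    (Fm.all Ty.nat (Fm.imp φ (φ.subst (Sub.cons Ty.nat (succ (nv 0)) (Sub.wk Ty.nat)))))
    (Fm.all Ty.nat φ))

/-- The axiom of choice for `φ(f, n)` with `f` the variable `var 1 0` and `n` the variable
`var 0 0`: `(∀ f¹, ∃ n⁰, φ(f, n)) → ∃ F², ∀ f¹, φ(f, F f)`. -/
def choice (φ : Fm) : Fm :=
  Fm.imp (Fm.all Ty.one (Fm.ex Ty.nat φ))
    (Fm.ex Ty.two (Fm.all Ty.one
      ((φ.wk Ty.two).inst (Tm.app (Tm.var Ty.two 0) (fv 0)))))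

/-- The axioms of `RCA₀^ω`; parameters of all types are allowed in the schemes. -/
inductive RCA0ω : Set Fm
  | succ_ne_zero (t : Tm Ty.nat) : RCA0ω (Fm.eq (succ t) zero).neg
  | succ_inj (s t : Tm Ty.nat) : RCA0ω (Fm.imp (Fm.eq (succ s) (succ t)) (Fm.eq s t))
  | add_zero (s : Tm Ty.nat) : RCA0ω (Fm.eq (add s zero) s)
  | add_succ (s t : Tm Ty.nat) : RCA0ω (Fm.eq (add s (succ t)) (succ (add s t)))
  | mul_zero (s : Tm Ty.nat) : RCA0ω (Fm.eq (mul s zero) zero)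
  | mul_succ (s t : Tm Ty.nat) : RCA0ω (Fm.eq (mul s (succ t)) (add (mul s t) s))
  | pi {ρ σ : Ty} (s : Tm ρ) (t : Tm σ) :
      RCA0ω (eqAt ρ (Tm.app (Tm.app (Tm.con (Con.pi ρ σ)) s) t) s)
  | sigma {ρ σ τ : Ty} (s : Tm (Ty.arr ρ (Ty.arr σ τ))) (t : Tm (Ty.arr ρ σ)) (u : Tm ρ) :
      RCA0ω (eqAt τ (Tm.app (Tm.app (Tm.app (Tm.con (Con.sigma ρ σ τ)) s) t) u)
        (Tm.app (Tm.app s u) (Tm.app t u)))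
  | recur_zero (f : Tm (Ty.arr Ty.nat (Ty.arr Ty.nat Ty.nat))) (m : Tm Ty.nat) :
      RCA0ω (Fm.eq (recur f m zero) m)
  | recur_succ (f : Tm (Ty.arr Ty.nat (Ty.arr Ty.nat Ty.nat))) (m n : Tm Ty.nat) :
      RCA0ω (Fm.eq (recur f m (succ n)) (Tm.app (Tm.app f n) (recur f m n)))
  | extensionality (ρ τ : Ty) : RCA0ω (extensionality ρ τ)
  | induction (φ : Fm) : φ.QF → RCA0ω (induction φ)
  | choice (φ : Fm) : φ.QF → RCA0ω (choice φ)

/-- The axiom `(∃²)`: there is `E²` with values at most `1` such that, for all `f¹`,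
`(∃ n, f n = 0) ↔ E f = 0`. -/
def existsTwo : Fm :=
  Fm.ex Ty.two (Fm.all Ty.one (Fm.and
    (le (Tm.app (Tm.var Ty.two 0) (fv 0)) one)
    (Fm.iff (Fm.ex Ty.nat (Fm.eq (Tm.app (fv 0) (nv 0)) zero))
      (Fm.eq (Tm.app (Tm.var Ty.two 0) (fv 0)) zero))))

/-- `ACA₀^ω` is `RCA₀^ω` with `(∃²)`. -/
def ACA0ω : Set Fm := RCA0ω ∪ {existsTwo}

/-! ### Real numbers -/

/-- `q` is the Cantor code of the pair `(a, b)`: `2 q = (a + b) (a + b + 1) + 2 b`. -/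
def isPair (q a b : Tm Ty.nat) : Fm :=
  Fm.eq (mul two q) (add (mul (add a b) (succ (add a b))) (mul two b))

/-- `q` is the code of the rational number `(a - b) / (c + 1)`, namely the code of `((a, b), c)`.
Every number codes exactly one triple `(a, b, c)`; the number `0` codes `0`, and `1` codes `1`. -/
def isRat (q a b c : Tm Ty.nat) : Fm :=
  Fm.ex Ty.nat (Fm.and
    (isPair (nv 0) (a.wk Ty.nat) (b.wk Ty.nat))
    (isPair (q.wk Ty.nat) (nv 0) (c.wk Ty.nat)))

/-- `t` inside the scope of six more number quantifiers. -/
def wk6 (t : Tm Ty.nat) : Tm Ty.nat :=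
  (((((t.wk Ty.nat).wk Ty.nat).wk Ty.nat).wk Ty.nat).wk Ty.nat).wk Ty.nat

/-- `q ≤ q' + r / 2 ^ k` for the rational numbers coded by `q` and `q'` and the natural numbers
`r` and `k`. If `q` codes `(a - b) / (c + 1)` and `q'` codes `(a' - b') / (c' + 1)`, this is
`(a (c' + 1) + b' (c + 1)) 2 ^ k ≤ (a' (c + 1) + b (c' + 1)) 2 ^ k + r (c + 1) (c' + 1)`.
The bound variables `a, b, c, a', b', c'` are `nv 5, nv 4, nv 3, nv 2, nv 1, nv 0`. -/
def leRat (q q' r k : Tm Ty.nat) : Fm :=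
  Fm.ex Ty.nat (Fm.ex Ty.nat (Fm.ex Ty.nat (Fm.ex Ty.nat (Fm.ex Ty.nat (Fm.ex Ty.nat
    (Fm.and (isRat (wk6 q) (nv 5) (nv 4) (nv 3))
    (Fm.and (isRat (wk6 q') (nv 2) (nv 1) (nv 0))
      (le
        (mul (add (mul (nv 5) (succ (nv 0))) (mul (nv 1) (succ (nv 3)))) (pow2 (wk6 k)))
        (add
          (mul (add (mul (nv 2) (succ (nv 3))) (mul (nv 4) (succ (nv 0)))) (pow2 (wk6 k)))
          (mul (wk6 r) (mul (succ (nv 3)) (succ (nv 0)))))))))))))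

/-- `|q - q'| ≤ r / 2 ^ k`. -/
def closeRat (q q' r k : Tm Ty.nat) : Fm := Fm.and (leRat q q' r k) (leRat q' q r k)

/-- `x` represents a real number: `∀ k i, |x k - x (k + i)| ≤ 2 ^ (-k)`. -/
def isReal (x : Tm Ty.one) : Fm :=
  Fm.all Ty.nat (Fm.all Ty.nat (closeRat
    (Tm.app ((x.wk Ty.nat).wk Ty.nat) (nv 1))
    (Tm.app ((x.wk Ty.nat).wk Ty.nat) (add (nv 1) (nv 0))) one (nv 1)))

/-- Equality of real numbers: `∀ k, |x k - y k| ≤ 2 ^ (-k + 1)`. -/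
def eqReal (x y : Tm Ty.one) : Fm :=
  Fm.all Ty.nat (closeRat
    (Tm.app (x.wk Ty.nat) (nv 0)) (Tm.app (y.wk Ty.nat) (nv 0)) two (nv 0))

/-- Order of real numbers: `∀ k, x k ≤ y k + 2 ^ (-k + 1)`. -/
def leReal (x y : Tm Ty.one) : Fm :=
  Fm.all Ty.nat (leRat
    (Tm.app (x.wk Ty.nat) (nv 0)) (Tm.app (y.wk Ty.nat) (nv 0)) two (nv 0))

/-! ### Countable sets and their enumerations -/

/-- A space whose points are represented by type `1` objects: which of them represent a point, and
when two of them represent the same point. -/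
structure Space : Type where
  pt : Tm Ty.one → Fm
  same : Tm Ty.one → Tm Ty.one → Fm

/-- The real line. -/
def realLine : Space := ⟨isReal, eqReal⟩

/-- The unit interval `[0,1]`; the constant sequences with value the code of `0` and of `1`
represent the real numbers `0` and `1`. -/
def unitInterval : Space :=
  ⟨fun x => Fm.and (isReal x)
    (Fm.and (leReal (const Ty.nat zero) x) (leReal x (const Ty.nat one))), eqReal⟩

/-- Cantor space `2^ℕ`. -/
def cantorSpace : Space :=
  ⟨fun f => Fm.all Ty.nat (Fm.or
    (Fm.eq (Tm.app (f.wk Ty.nat) (nv 0)) zero) (Fm.eq (Tm.app (f.wk Ty.nat) (nv 0)) one)),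
    eqAt Ty.one⟩

namespace Space

variable (X : Space)

/-- `Y : X → ℕ`, i.e. `Y` takes the same value on representations of the same point. -/
def isFun (Y : Tm Ty.two) : Fm :=
  Fm.all Ty.one (Fm.all Ty.one (Fm.imp (X.pt (fv 1)) (Fm.imp (X.pt (fv 0))
    (Fm.imp (X.same (fv 1) (fv 0))
      (Fm.eq (Tm.app ((Y.wk Ty.one).wk Ty.one) (fv 1))
        (Tm.app ((Y.wk Ty.one).wk Ty.one) (fv 0)))))))

/-- `x ∈ A`, i.e. `A(x) = 1`. -/
def mem (x : Tm Ty.one) (A : Tm Ty.two) : Fm := Fm.eq (Tm.app A x) one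

/-- `A` is a subset of `X`, i.e. `A : X → {0, 1}`. -/
def isSet (A : Tm Ty.two) : Fm :=
  Fm.and (X.isFun A) (Fm.all Ty.one (Fm.imp (X.pt (fv 0))
    (Fm.or (Fm.eq (Tm.app (A.wk Ty.one) (fv 0)) zero)
      (Fm.eq (Tm.app (A.wk Ty.one) (fv 0)) one))))

/-- `A` has an element. -/
def nonempty (A : Tm Ty.two) : Fm :=
  Fm.ex Ty.one (Fm.and (X.pt (fv 0)) (mem (fv 0) (A.wk Ty.one)))

/-- `Y` is injective on `A`. -/
def injOn (Y A : Tm Ty.two) : Fm :=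
  Fm.all Ty.one (Fm.all Ty.one (Fm.imp (X.pt (fv 1)) (Fm.imp (X.pt (fv 0))
    (Fm.imp (mem (fv 1) ((A.wk Ty.one).wk Ty.one)) (Fm.imp (mem (fv 0) ((A.wk Ty.one).wk Ty.one))
      (Fm.imp
        (Fm.eq (Tm.app ((Y.wk Ty.one).wk Ty.one) (fv 1))
          (Tm.app ((Y.wk Ty.one).wk Ty.one) (fv 0)))
        (X.same (fv 1) (fv 0))))))))

/-- Every `n` is the value of `Y` at an element of `A`. -/
def surjOn (Y A : Tm Ty.two) : Fm :=
  Fm.all Ty.nat (Fm.ex Ty.one (Fm.and (X.pt (fv 0))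
    (Fm.and (mem (fv 0) ((A.wk Ty.nat).wk Ty.one))
      (Fm.eq (Tm.app ((Y.wk Ty.nat).wk Ty.one) (fv 0)) (nv 0)))))

/-- `A` is countable: there is `Y : X → ℕ` injective on `A`. -/
def countable (A : Tm Ty.two) : Fm :=
  Fm.ex Ty.two (Fm.and (X.isFun (Tm.var Ty.two 0)) (X.injOn (Tm.var Ty.two 0) (A.wk Ty.two)))

/-- `A` is strongly countable: there is `Y : X → ℕ` bijective on `A`. -/
def stronglyCountable (A : Tm Ty.two) : Fm :=
  Fm.ex Ty.two (Fm.and (X.isFun (Tm.var Ty.two 0))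
    (Fm.and (X.injOn (Tm.var Ty.two 0) (A.wk Ty.two))
      (X.surjOn (Tm.var Ty.two 0) (A.wk Ty.two))))

/-- `A` is enumerable: there is a sequence `(xₙ)` of points of `X` such that, for all `x` in `X`,
`x ∈ A ↔ ∃ n, x = xₙ`. -/
def enumerable (A : Tm Ty.two) : Fm :=
  Fm.ex Ty.seq (Fm.and
    (Fm.all Ty.nat (X.pt (Tm.app (Tm.var Ty.seq 0) (nv 0))))
    (Fm.all Ty.one (Fm.imp (X.pt (fv 0))
      (Fm.iff (mem (fv 0) ((A.wk Ty.seq).wk Ty.one))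
        (Fm.ex Ty.nat (X.same (fv 0) (Tm.app (Tm.var Ty.seq 0) (nv 0))))))))

/-- `cocode₀^X`: every non-empty countable subset of `X` is enumerable. -/
def cocode₀ : Fm :=
  Fm.all Ty.two (Fm.imp (X.isSet (Tm.var Ty.two 0)) (Fm.imp (X.nonempty (Tm.var Ty.two 0))
    (Fm.imp (X.countable (Tm.var Ty.two 0)) (X.enumerable (Tm.var Ty.two 0)))))

/-- `cocode₁^X`: every strongly countable subset of `X` is enumerable. -/
def cocode₁ : Fm :=
  Fm.all Ty.two (Fm.imp (X.isSet (Tm.var Ty.two 0))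
    (Fm.imp (X.stronglyCountable (Tm.var Ty.two 0)) (X.enumerable (Tm.var Ty.two 0))))

end Space

end HOA

namespace HOA

/-! ### Substitution -/

/-! The claim is about derivability, but the argument is semantic. Terms modulo provable extensional
equality, taken over a Henkin set, form an extensional structure, so a formula that holds in every
extensional model of the axioms is provable (`proves_of_models`). It remains to verify the
equivalences in an arbitrary model `M`. Its type `0` domain may be nonstandard and its higher types
need not contain all functions, so every function used must be given by an element of `M`.

Definability in `M` is handled by `Df`. The combinators give closure under abstraction and
application, and the recursor gives primitive recursion. By `(∃²)` every predicate with number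
quantifiers has a characteristic function in `M`. This yields arithmetical comprehension, induction
for such predicates and, with the choice axiom, a search operator `eps`. Rational codes are
evaluated in the ordered field of fractions of the type `0` domain, where estimates are ordinary
field inequalities.

The mathematical core is a transfer principle (`Sp.Emb.cocode₀`, `Sp.Emb.cocode₁`). Let `E : X → Z`
be a definable embedding with a definable left inverse `D` and a definable image. A set `A` in `X`
becomes the set of `z` in the image with `D z ∈ A`, a map `Y` becomes `Y ∘ D`, and an enumeration of
the new set is carried back by `D`. Injectivity on `A`, and surjectivity from `A`, are preserved.
Hence the principle for `Z` implies the principle for `X`.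

Three embeddings close a cycle. The unit interval lies in the line by the identity. A real goes to
the characteristic function of its lower cut in the rationals, from which approximations can be
searched; this embeds the line in Cantor space. A binary sequence goes to the real whose base four
digits it lists, which embeds Cantor space in `[0,1]`: with digits `0` and `1` only, no carrying can
identify two expansions, and the digits are recovered from the lower cut. -/

theorem Sub.cons_self_zero (τ : Ty) (t : Tm τ) (s : Sub) : Sub.cons τ t s τ 0 = t := by
  simp [Sub.cons]

theorem Sub.cons_self_succ (τ : Ty) (t : Tm τ) (s : Sub) (n : ℕ) :
    Sub.cons τ t s τ (n + 1) = s τ n := by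
  simp [Sub.cons]

theorem Sub.cons_ne {τ ρ : Ty} (t : Tm τ) (s : Sub) (n : ℕ) (h : ρ ≠ τ) :
    Sub.cons τ t s ρ n = s ρ n := by
  simp [Sub.cons, h]

/-- Two substitutions agree if they agree on `var τ 0`, on `var τ (n + 1)`, and on the variables
of the other types. -/
theorem Sub.ext_at (τ : Ty) {s s' : Sub} (h0 : s τ 0 = s' τ 0)
    (h1 : ∀ n, s τ (n + 1) = s' τ (n + 1)) (h2 : ∀ ρ n, ρ ≠ τ → s ρ n = s' ρ n) : s = s' := by
  funext ρ n
  by_cases h : ρ = τ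
  · subst h
    cases n with
    | zero => exact h0
    | succ n => exact h1 n
  · exact h2 ρ n h

/-- First `s`, then `s'`. -/
def Sub.comp (s s' : Sub) : Sub := fun τ n => (s τ n).subst s'

theorem Tm.subst_id {τ : Ty} (t : Tm τ) : t.subst Sub.id = t := by
  induction t with
  | var τ n => rfl
  | con c => rfl
  | app t u iht ihu => simp only [Tm.subst, iht, ihu]

theorem Tm.subst_subst {τ : Ty} (t : Tm τ) (s s' : Sub) :
    (t.subst s).subst s' = t.subst (s.comp s') := by
  induction t with
  | var τ n => rfl
  | con c => rfl
  | app t u iht ihu => simp only [Tm.subst, iht, ihu]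

theorem Sub.wk_comp_cons (τ : Ty) (t : Tm τ) (s : Sub) : (Sub.wk τ).comp (Sub.cons τ t s) = s := by
  funext ρ n
  by_cases h : ρ = τ
  · subst h
    simp [Sub.comp, Sub.wk, Tm.subst, Sub.cons_self_succ]
  · simp [Sub.comp, Sub.wk, Tm.subst, h, Sub.cons_ne]

theorem Tm.wk_subst_cons {τ ρ : Ty} (u : Tm ρ) (t : Tm τ) (s : Sub) :
    (u.wk τ).subst (Sub.cons τ t s) = u.subst s := by
  rw [Tm.wk, Tm.subst_subst, Sub.wk_comp_cons]

theorem Sub.wk_comp_lift (τ : Ty) (s : Sub) : (Sub.wk τ).comp (s.lift τ) = s.comp (Sub.wk τ) :=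
  Sub.wk_comp_cons _ _ _

theorem Tm.wk_subst_lift {τ ρ : Ty} (u : Tm ρ) (s : Sub) :
    (u.wk τ).subst (s.lift τ) = (u.subst s).wk τ := by
  rw [Tm.wk, Tm.wk, Tm.subst_subst, Tm.subst_subst, Sub.wk_comp_lift]

theorem Sub.lift_self_zero (τ : Ty) (s : Sub) : s.lift τ τ 0 = Tm.var τ 0 :=
  Sub.cons_self_zero _ _ _

theorem Sub.lift_self_succ (τ : Ty) (s : Sub) (n : ℕ) : s.lift τ τ (n + 1) = (s τ n).wk τ :=
  Sub.cons_self_succ _ _ _ _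

theorem Sub.lift_ne {τ ρ : Ty} (s : Sub) (n : ℕ) (h : ρ ≠ τ) : s.lift τ ρ n = (s ρ n).wk τ :=
  Sub.cons_ne _ _ _ h

theorem Sub.lift_comp_lift (τ : Ty) (s s' : Sub) :
    (s.lift τ).comp (s'.lift τ) = (s.comp s').lift τ := by
  apply Sub.ext_at τ
  · simp [Sub.comp, Sub.lift_self_zero, Tm.subst]
  · intro n
    simp [Sub.comp, Sub.lift_self_succ, Tm.wk_subst_lift]
  · intro ρ n h
    simp [Sub.comp, Sub.lift_ne, h, Tm.wk_subst_lift]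

theorem Sub.lift_comp_cons (τ : Ty) (s s' : Sub) (t : Tm τ) :
    (s.lift τ).comp (Sub.cons τ t s') = Sub.cons τ t (s.comp s') := by
  apply Sub.ext_at τ
  · simp [Sub.comp, Sub.lift_self_zero, Tm.subst, Sub.cons_self_zero]
  · intro n
    simp [Sub.comp, Sub.lift_self_succ, Tm.wk_subst_cons, Sub.cons_self_succ]
  · intro ρ n h
    simp [Sub.comp, Sub.lift_ne, Sub.cons_ne, h, Tm.wk_subst_cons]

theorem Sub.cons_comp (τ : Ty) (s s' : Sub) (t : Tm τ) :
    (Sub.cons τ t s).comp s' = Sub.cons τ (t.subst s') (s.comp s') := by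
  apply Sub.ext_at τ
  · simp [Sub.comp, Sub.cons_self_zero]
  · intro n
    simp [Sub.comp, Sub.cons_self_succ]
  · intro ρ n h
    simp [Sub.comp, Sub.cons_ne, h]

theorem Sub.comp_id (s : Sub) : s.comp Sub.id = s := by
  funext τ n
  exact Tm.subst_id _

theorem Sub.id_comp (s : Sub) : Sub.id.comp s = s := rfl

theorem Sub.lift_id (τ : Ty) : Sub.id.lift τ = Sub.id := by
  apply Sub.ext_at τ
  · rw [Sub.lift_self_zero]; rfl
  · intro n
    rw [Sub.lift_self_succ]; simp [Sub.id, Tm.wk, Tm.subst, Sub.wk]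
  · intro ρ n h
    rw [Sub.lift_ne _ _ h]; simp [Sub.id, Tm.wk, Tm.subst, Sub.wk, h]

theorem Fm.subst_id (φ : Fm) : φ.subst Sub.id = φ := by
  induction φ with
  | eq t u => simp [Fm.subst, Tm.subst_id]
  | bot => rfl
  | imp φ ψ ihφ ihψ => simp [Fm.subst, ihφ, ihψ]
  | all τ φ ih => simp [Fm.subst, Sub.lift_id, ih]

theorem Fm.subst_subst (φ : Fm) (s s' : Sub) : (φ.subst s).subst s' = φ.subst (s.comp s') := by
  induction φ generalizing s s' with
  | eq t u => simp [Fm.subst, Tm.subst_subst]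
  | bot => rfl
  | imp φ ψ ihφ ihψ => simp [Fm.subst, ihφ, ihψ]
  | all τ φ ih => simp [Fm.subst, ih, Sub.lift_comp_lift]

theorem Fm.subst_lift_inst {τ : Ty} (φ : Fm) (s : Sub) (t : Tm τ) :
    (φ.subst (s.lift τ)).inst t = φ.subst (Sub.cons τ t s) := by
  rw [Fm.inst, Fm.subst_subst, Sub.lift_comp_cons, Sub.comp_id]

theorem Fm.inst_subst {τ : Ty} (φ : Fm) (s : Sub) (t : Tm τ) :
    (φ.inst t).subst s = (φ.subst (s.lift τ)).inst (t.subst s) := by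
  rw [Fm.subst_lift_inst, Fm.inst, Fm.subst_subst, Sub.cons_comp, Sub.id_comp]

theorem Fm.wk_subst_lift (τ : Ty) (φ : Fm) (s : Sub) :
    (φ.wk τ).subst (s.lift τ) = (φ.subst s).wk τ := by
  rw [Fm.wk, Fm.wk, Fm.subst_subst, Fm.subst_subst, Sub.wk_comp_lift]

theorem eqAt_subst (τ : Ty) (t u : Tm τ) (s : Sub) :
    (eqAt τ t u).subst s = eqAt τ (t.subst s) (u.subst s) := by
  induction τ generalizing s with
  | nat => rfl
  | arr σ τ _ ih =>
    simp only [eqAt, Fm.subst, ih, Tm.subst, Tm.wk_subst_lift, Sub.lift_self_zero]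

theorem Fm.QF.subst {φ : Fm} (h : φ.QF) (s : Sub) : (φ.subst s).QF := by
  induction φ generalizing s with
  | eq t u => trivial
  | bot => trivial
  | imp φ ψ ihφ ihψ => exact ⟨ihφ h.1 s, ihψ h.2 s⟩
  | all τ φ ih => exact h.elim

/-- In `extensionality ρ τ` the bound variables have types `ρ` and `ρ → τ`. These types differ, so
the two index counts do not interfere. -/
theorem Ty.ne_arr_left (σ τ : Ty) : σ ≠ Ty.arr σ τ := by
  intro h
  have := congrArg sizeOf h
  simp at this
  omega

theorem extensionality_subst (ρ τ : Ty) (s : Sub) :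
    (extensionality ρ τ).subst s = extensionality ρ τ := by
  have h := Ty.ne_arr_left ρ τ
  have h1 : (((s.lift (Ty.arr ρ τ)).lift ρ).lift ρ) ρ 0 = Tm.var ρ 0 := Sub.lift_self_zero _ _
  have h2 : (((s.lift (Ty.arr ρ τ)).lift ρ).lift ρ) ρ 1 = Tm.var ρ 1 := by
    rw [Sub.lift_self_succ, Sub.lift_self_zero]; simp [Tm.wk, Tm.subst, Sub.wk]
  have h3 : (((s.lift (Ty.arr ρ τ)).lift ρ).lift ρ) (Ty.arr ρ τ) 0 = Tm.var (Ty.arr ρ τ) 0 := by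
    rw [Sub.lift_ne _ _ h.symm, Sub.lift_ne _ _ h.symm, Sub.lift_self_zero]
    simp [Tm.wk, Tm.subst, Sub.wk, h.symm]
  simp only [extensionality, Fm.subst, eqAt_subst, Tm.subst, h1, h2, h3]

theorem induction_subst (φ : Fm) (s : Sub) :
    (induction φ).subst s = induction (φ.subst (s.lift Ty.nat)) := by
  have h : (Sub.cons Ty.nat (succ (nv 0)) (Sub.wk Ty.nat)).comp (s.lift Ty.nat) =
      (s.lift Ty.nat).comp (Sub.cons Ty.nat (succ (nv 0)) (Sub.wk Ty.nat)) := by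
    rw [Sub.cons_comp, Sub.wk_comp_lift, Sub.lift_comp_cons]
    simp [succ, Tm.subst, Sub.lift_self_zero]
  simp only [induction, Fm.subst, Fm.inst_subst, Fm.subst_subst, h]
  rfl

theorem Tm.wk_wk_comm {ρ : Ty} (t : Tm ρ) (σ τ : Ty) : (t.wk σ).wk τ = (t.wk τ).wk σ := by
  simp only [Tm.wk, Tm.subst_subst]
  congr 1
  funext ρ n
  simp only [Sub.comp, Sub.wk, Tm.subst]
  split_ifs <;> rfl

theorem Sub.lift_lift_comm {σ τ : Ty} (h : σ ≠ τ) (s : Sub) :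
    (s.lift σ).lift τ = (s.lift τ).lift σ := by
  apply Sub.ext_at τ
  · rw [Sub.lift_self_zero, Sub.lift_ne _ _ h.symm, Sub.lift_self_zero]
    simp [Tm.wk, Tm.subst, Sub.wk, h.symm]
  · intro n
    rw [Sub.lift_self_succ, Sub.lift_ne _ _ h.symm, Sub.lift_ne _ _ h.symm, Sub.lift_self_succ,
      Tm.wk_wk_comm]
  · intro ρ n hρ
    rw [Sub.lift_ne _ _ hρ]
    by_cases h' : ρ = σ
    · subst h'
      cases n with
      | zero =>
        rw [Sub.lift_self_zero, Sub.lift_self_zero]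
        simp [Tm.wk, Tm.subst, Sub.wk, h]
      | succ n => rw [Sub.lift_self_succ, Sub.lift_self_succ, Sub.lift_ne _ _ hρ, Tm.wk_wk_comm]
    · rw [Sub.lift_ne _ _ h', Sub.lift_ne _ _ h', Sub.lift_ne _ _ hρ, Tm.wk_wk_comm]

theorem choice_subst (φ : Fm) (s : Sub) :
    (choice φ).subst s = choice (φ.subst ((s.lift Ty.one).lift Ty.nat)) := by
  -- The functional quantifier in the conclusion of the scheme has a type different from those of
  -- the argument and the number, so its lift commutes past theirs.
  have h : ((s.lift Ty.two).lift Ty.one).lift Ty.nat =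
      ((s.lift Ty.one).lift Ty.nat).lift Ty.two := by
    rw [Sub.lift_lift_comm (σ := Ty.two) (τ := Ty.one) (by simp),
      Sub.lift_lift_comm (σ := Ty.two) (τ := Ty.nat) (by simp)]
  have h' : ((Tm.var Ty.two 0).app (fv 0)).subst ((s.lift Ty.two).lift Ty.one) =
      (Tm.var Ty.two 0).app (fv 0) := by
    simp [Tm.subst, Sub.lift_self_zero, Sub.lift_ne, Tm.wk, Sub.wk]
  simp only [choice, Fm.subst, Fm.ex, Fm.neg, Fm.inst_subst, h, h', Fm.wk_subst_lift]

/-- A set of axioms that is closed under substitution. -/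
def SubstClosed (T : Set Fm) : Prop := ∀ φ ∈ T, ∀ s : Sub, φ.subst s ∈ T

theorem substClosed_ACA0ω : SubstClosed ACA0ω := by
  rintro φ (h | h) s
  · left
    cases h with
    | succ_ne_zero t => exact RCA0ω.succ_ne_zero (t.subst s)
    | succ_inj t u => exact RCA0ω.succ_inj (t.subst s) (u.subst s)
    | add_zero t => exact RCA0ω.add_zero (t.subst s)
    | add_succ t u => exact RCA0ω.add_succ (t.subst s) (u.subst s)
    | mul_zero t => exact RCA0ω.mul_zero (t.subst s)
    | mul_succ t u => exact RCA0ω.mul_succ (t.subst s) (u.subst s)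
    | pi t u => rw [eqAt_subst]; exact RCA0ω.pi (t.subst s) (u.subst s)
    | sigma t u v => rw [eqAt_subst]; exact RCA0ω.sigma (t.subst s) (u.subst s) (v.subst s)
    | recur_zero f m => exact RCA0ω.recur_zero (f.subst s) (m.subst s)
    | recur_succ f m n => exact RCA0ω.recur_succ (f.subst s) (m.subst s) (n.subst s)
    | extensionality ρ τ => rw [extensionality_subst]; exact RCA0ω.extensionality ρ τ
    | induction φ h => rw [induction_subst]; exact RCA0ω.induction _ (h.subst _)
    | choice φ h => rw [choice_subst]; exact RCA0ω.choice _ (h.subst _)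
  · right
    rw [Set.mem_singleton_iff] at h ⊢
    subst h
    simp [existsTwo, Fm.subst, Fm.ex, Fm.and, Fm.iff, Fm.neg, le, Tm.subst, Sub.lift, Sub.cons,
      Tm.wk, Sub.wk, add, one, succ, zero]

/-! ### Derivations -/

theorem Prf.weaken {T : Set Fm} {Γ Δ : List Fm} {φ : Fm} (h : Prf T Γ φ) (hs : Γ ⊆ Δ) :
    Prf T Δ φ := by
  induction h generalizing Δ with
  | ax h => exact Prf.ax h
  | hyp h => exact Prf.hyp (hs h)
  | impI _ ih => exact Prf.impI (ih (List.cons_subset_cons _ hs))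
  | impE _ _ ih1 ih2 => exact Prf.impE (ih1 hs) (ih2 hs)
  | raa _ ih => exact Prf.raa (ih (List.cons_subset_cons _ hs))
  | allI _ ih => exact Prf.allI (ih (List.map_subset _ hs))
  | allE t _ ih => exact Prf.allE t (ih hs)
  | eqRefl t => exact Prf.eqRefl t
  | eqSubst φ _ _ ih1 ih2 => exact Prf.eqSubst φ (ih1 hs) (ih2 hs)

theorem Prf.subst {T : Set Fm} (hT : SubstClosed T) {Γ : List Fm} {φ : Fm} (h : Prf T Γ φ)
    (s : Sub) : Prf T (Γ.map (Fm.subst s)) (φ.subst s) := by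
  induction h generalizing s with
  | ax h => exact Prf.ax (hT _ h s)
  | hyp h => exact Prf.hyp (List.mem_map_of_mem h)
  | impI _ ih => exact Prf.impI (ih s)
  | impE _ _ ih1 ih2 => exact Prf.impE (ih1 s) (ih2 s)
  | raa _ ih => exact Prf.raa (ih s)
  | @allI Γ τ φ _ ih =>
    refine Prf.allI ?_
    have := ih (s.lift τ)
    rw [List.map_map] at this ⊢
    convert this using 2
    funext ψ
    exact (Fm.wk_subst_lift τ ψ s).symm
  | allE t _ ih =>
    rw [Fm.inst_subst]
    exact Prf.allE _ (ih s)
  | eqRefl t => exact Prf.eqRefl _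
  | eqSubst φ _ _ ih1 ih2 =>
    rw [Fm.inst_subst]
    exact Prf.eqSubst _ (ih1 s) (by simpa only [Fm.inst_subst] using ih2 s)

end HOA

namespace HOA

/-! ### Countability of the language -/

/-- Countability is needed for one purpose: an enumeration of all formulas in the Henkin
construction. -/
def Ty.code : Ty → ℕ
  | Ty.nat => 0
  | Ty.arr σ τ => Nat.pair σ.code τ.code + 1

theorem Ty.code_injective : Function.Injective Ty.code := by
  intro σ τ h
  induction σ generalizing τ with
  | nat => cases τ with
    | nat => rfl
    | arr _ _ => simp [Ty.code] at h
  | arr a b iha ihb => cases τ with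
    | nat => simp [Ty.code] at h
    | arr c d =>
      simp only [Ty.code, Nat.add_right_cancel_iff, Nat.pair_eq_pair] at h
      rw [iha h.1, ihb h.2]

instance : Countable Ty := Ty.code_injective.countable

def Con.sum : {τ : Ty} → Con τ → (Fin 5) ⊕ (Ty × Ty) ⊕ (Ty × Ty × Ty)
  | _, Con.zero => Sum.inl 0
  | _, Con.succ => Sum.inl 1
  | _, Con.add => Sum.inl 2
  | _, Con.mul => Sum.inl 3
  | _, Con.recursor => Sum.inl 4
  | _, Con.pi ρ σ => Sum.inr (Sum.inl (ρ, σ))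
  | _, Con.sigma ρ σ τ => Sum.inr (Sum.inr (ρ, σ, τ))

theorem Con.sum_injective :
    Function.Injective (fun c : Σ τ, Con τ => c.2.sum) := by
  rintro ⟨σ, c⟩ ⟨τ, d⟩ h
  cases c <;> cases d <;> simp [Con.sum] at h ⊢ <;> obtain ⟨rfl, h⟩ := h <;>
    first | (subst h; simp) | (obtain ⟨rfl, rfl⟩ := h; simp)

instance : Countable (Σ τ, Con τ) := Con.sum_injective.countable

instance : Countable (Σ τ, Tm τ) := by
  obtain ⟨f, hf⟩ := exists_injective_nat (Ty × ℕ)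
  obtain ⟨g, hg⟩ := exists_injective_nat (Σ τ, Con τ)
  let code : ∀ τ, Tm τ → ℕ ⊕ ℕ ⊕ ℕ := fun τ t => Tm.rec (motive := fun _ _ => ℕ ⊕ ℕ ⊕ ℕ)
    (fun τ n => Sum.inl (f (τ, n))) (fun {τ} c => Sum.inr (Sum.inl (g ⟨τ, c⟩)))
    (fun _ _ a b => Sum.inr (Sum.inr (Nat.pair (Encodable.encode a) (Encodable.encode b)))) t
  have h : ∀ τ (t : Tm τ) σ (u : Tm σ), code τ t = code σ u →
      (⟨τ, t⟩ : Σ τ, Tm τ) = ⟨σ, u⟩ := by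
    intro τ t
    induction t with
    | var τ n =>
      intro σ u h
      cases u with
      | var τ' n' =>
        have := hf (Sum.inl.inj h)
        simp only [Prod.mk.injEq] at this
        obtain ⟨rfl, rfl⟩ := this
        rfl
      | con c => exact absurd h (by simp [code])
      | app s t => exact absurd h (by simp [code])
    | con c =>
      intro σ u h
      cases u with
      | var τ' n' => exact absurd h (by simp [code])
      | con c' =>
        have := hg (Sum.inl.inj (Sum.inr.inj h))
        cases this
        rfl
      | app s t => exact absurd h (by simp [code])
    | app s t ihs iht =>
      intro σ u h
      cases u with
      | var τ' n' => exact absurd h (by simp [code])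
      | con c' => exact absurd h (by simp [code])
      | app s' t' =>
        have := Nat.pair_eq_pair.1 (Sum.inr.inj (Sum.inr.inj h))
        -- The code of an application does not record the argument type; the induction hypothesis
        -- gives equality of pairs of a type and a term, which determines it.
        cases ihs _ _ (Encodable.encode_injective this.1)
        cases iht _ _ (Encodable.encode_injective this.2)
        rfl
  exact Function.Injective.countable (f := fun t : Σ τ, Tm τ => code t.1 t.2)
    (fun a b hab => h _ _ _ _ hab)

instance : Countable (Tm Ty.nat) :=
  Function.Injective.countable (f := fun t => (⟨Ty.nat, t⟩ : Σ τ, Tm τ)) (by intro a b; simp)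

instance : Countable Fm := by
  obtain ⟨f, hf⟩ := exists_injective_nat (Tm Ty.nat)
  let code : Fm → Option (ℕ ⊕ ℕ ⊕ ℕ) := fun φ => Fm.rec (motive := fun _ => Option (ℕ ⊕ ℕ ⊕ ℕ))
    (fun t u => some (Sum.inl (Nat.pair (f t) (f u)))) none
    (fun _ _ a b => some (Sum.inr (Sum.inl
      (Nat.pair (Encodable.encode a) (Encodable.encode b)))))
    (fun τ _ a => some (Sum.inr (Sum.inr (Nat.pair τ.code (Encodable.encode a))))) φ
  have h : Function.Injective code := by
    intro φ ψ h
    induction φ generalizing ψ with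
    | eq t u => cases ψ with
      | eq t' u' =>
        have := Nat.pair_eq_pair.1 (Sum.inl.inj (Option.some.inj h))
        rw [hf this.1, hf this.2]
      | _ => exact absurd h (by simp [code])
    | bot => cases ψ with
      | bot => rfl
      | _ => exact absurd h (by simp [code])
    | imp a b iha ihb => cases ψ with
      | imp a' b' =>
        have := Nat.pair_eq_pair.1 (Sum.inl.inj (Sum.inr.inj (Option.some.inj h)))
        rw [iha (Encodable.encode_injective this.1), ihb (Encodable.encode_injective this.2)]
      | _ => exact absurd h (by simp [code])
    | all τ a ih => cases ψ with
      | all τ' a' =>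
        have := Nat.pair_eq_pair.1 (Sum.inr.inj (Sum.inr.inj (Option.some.inj h)))
        rw [Ty.code_injective this.1, ih (Encodable.encode_injective this.2)]
      | _ => exact absurd h (by simp [code])
  exact h.countable

/-! ### Fresh variables -/

/-- A strict upper bound for the indices of the variables that occur in `t`. -/
def Tm.bound : {τ : Ty} → Tm τ → ℕ
  | _, Tm.var _ n => n + 1
  | _, Tm.con _ => 0
  | _, Tm.app t u => max t.bound u.bound

/-- A strict upper bound for the indices of the variables that occur in `φ`. -/
def Fm.bound : Fm → ℕ
  | Fm.eq t u => max t.bound u.bound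
  | Fm.bot => 0
  | Fm.imp φ ψ => max φ.bound ψ.bound
  -- Quantifying lowers the index of a free variable by one or leaves it alone, so the bound for the
  -- body still works, though it need not be sharp.
  | Fm.all _ φ => φ.bound

theorem Tm.subst_congr {τ : Ty} (t : Tm τ) {s s' : Sub}
    (h : ∀ ρ n, n < t.bound → s ρ n = s' ρ n) : t.subst s = t.subst s' := by
  induction t with
  | var τ n => exact h τ n (Nat.lt_succ_self n)
  | con c => rfl
  | app t u iht ihu =>
    simp only [Tm.bound, lt_max_iff] at h
    simp only [Tm.subst, iht fun ρ n hn => h ρ n (Or.inl hn), ihu fun ρ n hn => h ρ n (Or.inr hn)]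

theorem Fm.subst_congr (φ : Fm) {s s' : Sub}
    (h : ∀ ρ n, n < φ.bound → s ρ n = s' ρ n) : φ.subst s = φ.subst s' := by
  induction φ generalizing s s' with
  | eq t u =>
    simp only [Fm.bound, lt_max_iff] at h
    simp only [Fm.subst, t.subst_congr fun ρ n hn => h ρ n (Or.inl hn),
      u.subst_congr fun ρ n hn => h ρ n (Or.inr hn)]
  | bot => rfl
  | imp φ ψ ihφ ihψ =>
    simp only [Fm.bound, lt_max_iff] at h
    simp only [Fm.subst, ihφ fun ρ n hn => h ρ n (Or.inl hn),
      ihψ fun ρ n hn => h ρ n (Or.inr hn)]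
  | all τ φ ih =>
    simp only [Fm.subst]
    rw [ih]
    intro ρ n hn
    by_cases hρ : ρ = τ
    · subst hρ
      cases n with
      | zero => rw [Sub.lift_self_zero, Sub.lift_self_zero]
      | succ n =>
        rw [Sub.lift_self_succ, Sub.lift_self_succ, h ρ n (lt_of_le_of_lt (Nat.le_succ n) hn)]
    · rw [Sub.lift_ne _ _ hρ, Sub.lift_ne _ _ hρ, h ρ n hn]

/-- Renames `var τ k` to `var τ 0` and makes room for it. -/
def Sub.capture (τ : Ty) (k : ℕ) : Sub := fun ρ n =>
  if ρ = τ ∧ n = k then Tm.var ρ 0 else Sub.wk τ ρ n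

theorem Fm.subst_capture {φ : Fm} {τ : Ty} {k : ℕ} (h : φ.bound ≤ k) :
    φ.subst (Sub.capture τ k) = φ.wk τ := by
  refine φ.subst_congr fun ρ n hn => ?_
  simp [Sub.capture, (lt_of_lt_of_le hn h).ne]

theorem Fm.inst_capture {φ : Fm} {τ : Ty} {k : ℕ} (h : φ.bound ≤ k) :
    (φ.inst (Tm.var τ k)).subst (Sub.capture τ k) = φ := by
  rw [Fm.inst, Fm.subst_subst]
  conv_rhs => rw [← φ.subst_id]
  refine φ.subst_congr fun ρ n hn => ?_
  by_cases hρ : ρ = τ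
  · subst hρ
    cases n with
    | zero => simp [Sub.comp, Sub.cons_self_zero, Tm.subst, Sub.capture, Sub.id]
    | succ n =>
      have : n ≠ k := by omega
      simp [Sub.comp, Sub.cons_self_succ, Tm.subst, Sub.capture, Sub.id, Sub.wk, this]
  · simp [Sub.comp, Sub.cons_ne, hρ, Tm.subst, Sub.capture, Sub.id, Sub.wk]

/-- A variable beyond all bounds acts as a fresh constant: `Sub.capture` turns it into the variable
to be bound and is mere weakening on everything else in the derivation's end sequent. -/
theorem Prf.allI_fresh {T : Set Fm} (hT : SubstClosed T) {Γ : List Fm} {τ : Ty} {φ : Fm} {k : ℕ}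
    (hΓ : ∀ ψ ∈ Γ, ψ.bound ≤ k) (hφ : φ.bound ≤ k) (h : Prf T Γ (φ.inst (Tm.var τ k))) :
    Prf T Γ (Fm.all τ φ) := by
  have := h.subst hT (Sub.capture τ k)
  rw [Fm.inst_capture hφ, List.map_congr_left fun ψ hψ => Fm.subst_capture (hΓ ψ hψ)] at this
  exact Prf.allI this

/-! ### Henkin sets -/

theorem Prf.exfalso {T : Set Fm} {Γ : List Fm} {φ : Fm} (h : Prf T Γ Fm.bot) : Prf T Γ φ :=
  Prf.raa (h.weaken (List.subset_cons_self _ _))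

theorem Prf.neg_of_incons {T : Set Fm} {Γ : List Fm} {φ : Fm} (h : Prf T (φ :: Γ) Fm.bot) :
    Prf T Γ φ.neg := Prf.impI h

/-- If `ψ` is consistent with `Γ`, it is added, and a negated universal formula is added together
with its negated instance at a fresh variable. Were the latter inconsistent, the instance would be
derivable, hence by generalization the universal formula itself. -/
theorem exists_henkin_step {T : Set Fm} (hT : SubstClosed T) (Γ : List Fm)
    (hΓ : ¬ Prf T Γ Fm.bot) (ψ : Fm) :
    ∃ Δ : List Fm, Γ ⊆ Δ ∧ ¬ Prf T Δ Fm.bot ∧ (ψ ∈ Δ ∨ Prf T Γ ψ.neg) ∧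
      ∀ τ χ, ψ = (Fm.all τ χ).neg → ψ ∈ Δ → ∃ t : Tm τ, (χ.inst t).neg ∈ Δ := by
  by_cases h : Prf T (ψ :: Γ) Fm.bot
  · refine ⟨Γ, fun _ h => h, hΓ, Or.inr h.neg_of_incons, fun τ χ _ hψ => absurd ?_ hΓ⟩
    exact Prf.impE h.neg_of_incons (Prf.hyp hψ)
  · by_cases hψ : ∃ τ χ, ψ = (Fm.all τ χ).neg
    · obtain ⟨τ, χ, rfl⟩ := hψ
      obtain ⟨k, hk⟩ : ∃ k, ∀ θ ∈ (Fm.all τ χ).neg :: Γ, θ.bound ≤ k := by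
        -- The sum of the bounds serves as a convenient upper bound for each of them.
        refine ⟨(((Fm.all τ χ).neg :: Γ).map Fm.bound).sum, fun θ hθ => ?_⟩
        exact List.single_le_sum (by simp) _ (List.mem_map_of_mem hθ)
      refine ⟨(χ.inst (Tm.var τ k)).neg :: (Fm.all τ χ).neg :: Γ,
        fun θ hθ => List.mem_cons_of_mem _ (List.mem_cons_of_mem _ hθ), fun hb => h ?_,
        Or.inl (by simp), ?_⟩
      · refine Prf.impE (Prf.hyp (List.mem_cons_self ..)) (Prf.allI_fresh hT hk ?_ (Prf.raa hb))
        have := hk _ (List.mem_cons_self ..)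
        simpa [Fm.neg, Fm.bound] using this
      · rintro τ' χ' h' -
        simp only [Fm.neg, Fm.imp.injEq, Fm.all.injEq, and_true] at h'
        obtain ⟨rfl, rfl⟩ := h'
        exact ⟨_, List.mem_cons_self ..⟩
    · refine ⟨ψ :: Γ, List.subset_cons_self _ _, h, Or.inl (List.mem_cons_self ..), ?_⟩
      intro τ χ h' _
      exact absurd ⟨τ, χ, h'⟩ hψ

/-- A consistent, deductively closed, complete set of formulas with witnesses. -/
structure IsHenkin (T : Set Fm) (H : Set Fm) : Prop where
  closed : ∀ (Γ : List Fm) (φ : Fm), (∀ ψ ∈ Γ, ψ ∈ H) → Prf T Γ φ → φ ∈ H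
  bot_notMem : Fm.bot ∉ H
  complete : ∀ φ, φ ∈ H ∨ φ.neg ∈ H
  witness : ∀ (τ : Ty) (φ : Fm), (Fm.all τ φ).neg ∈ H → ∃ t : Tm τ, (φ.inst t).neg ∈ H

/-- Lindenbaum's construction: stage `n` decides the formula `e n`, and `H` is the union of the
stages. Only finitely many assumptions enter a derivation, so consistency survives the union. -/
theorem exists_isHenkin {T : Set Fm} (hT : SubstClosed T) (Γ : List Fm)
    (hΓ : ¬ Prf T Γ Fm.bot) : ∃ H, IsHenkin T H ∧ ∀ φ ∈ Γ, φ ∈ H := by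
  have : Nonempty Fm := ⟨Fm.bot⟩
  obtain ⟨e, he⟩ := exists_surjective_nat Fm
  choose! next h1 h2 h3 h4 using exists_henkin_step hT
  let D : ℕ → List Fm := fun n => Nat.rec Γ (fun n Δ => next Δ (e n)) n
  have hcons : ∀ n, ¬ Prf T (D n) Fm.bot := by
    intro n
    induction n with
    | zero => exact hΓ
    | succ n ih => exact h2 (D n) ih (e n)
  have hmono : ∀ {m n}, m ≤ n → D m ⊆ D n := by
    intro m n hmn
    induction hmn with
    | refl => exact fun _ h => h
    | step _ ih => exact fun _ h => h1 (D _) (hcons _) (e _) (ih h)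
  let H : Set Fm := {φ | ∃ n, φ ∈ D n}
  have hfin : ∀ L : List Fm, (∀ ψ ∈ L, ψ ∈ H) → ∃ n, L ⊆ D n := by
    intro L hL
    induction L with
    | nil => exact ⟨0, by simp⟩
    | cons a L ih =>
      obtain ⟨n, hn⟩ := ih fun ψ hψ => hL ψ (List.mem_cons_of_mem _ hψ)
      obtain ⟨m, hm⟩ := hL a (List.mem_cons_self ..)
      refine ⟨max m n, ?_⟩
      intro x hx
      rcases List.mem_cons.1 hx with rfl | hx
      · exact hmono (le_max_left _ _) hm
      · exact hmono (le_max_right _ _) (hn hx)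
  have hclosed : ∀ (L : List Fm) (φ : Fm), (∀ ψ ∈ L, ψ ∈ H) → Prf T L φ → φ ∈ H := by
    intro L φ hL hφ
    obtain ⟨n, hn⟩ := hfin L hL
    -- The derived formula was decided at stage `m`. If it had been refuted there, the later of the
    -- stages `m` and `n` would be inconsistent.
    obtain ⟨m, rfl⟩ := he φ
    rcases h3 (D m) (hcons m) (e m) with h | h
    · exact ⟨m + 1, h⟩
    · exact absurd (Prf.impE (h.weaken (hmono (le_max_left m n)))
        (hφ.weaken fun _ h => hmono (le_max_right m n) (hn h))) (hcons _)
  refine ⟨H, ⟨hclosed, fun ⟨n, hn⟩ => hcons n (Prf.hyp hn), fun φ => ?_, fun τ φ hφ => ?_⟩,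
    fun φ hφ => ⟨0, hφ⟩⟩
  · obtain ⟨m, rfl⟩ := he φ
    rcases h3 (D m) (hcons m) (e m) with h | h
    · exact Or.inl ⟨m + 1, h⟩
    · exact Or.inr (hclosed (D m) _ (fun ψ hψ => ⟨m, hψ⟩) h)
  · obtain ⟨m, hm⟩ := he (Fm.all τ φ).neg
    rcases h3 (D m) (hcons m) (e m) with h | h
    · obtain ⟨t, ht⟩ := h4 (D m) (hcons m) (e m) τ φ hm h
      exact ⟨t, m + 1, ht⟩
    · obtain ⟨n, hn⟩ := hφ
      rw [hm] at h
      exact absurd (Prf.impE (h.weaken (hmono (le_max_left m n)))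
        (Prf.hyp (hmono (le_max_right m n) hn))) (hcons _)

end HOA

namespace HOA

/-! ### Structures and satisfaction -/

/-- An extensional structure for the language: a domain for each type, application, and values of
the constants. -/
structure Str where
  El : Ty → Type
  app {σ τ : Ty} : El (Ty.arr σ τ) → El σ → El τ
  con {τ : Ty} : Con τ → El τ
  ext {σ τ : Ty} {f g : El (Ty.arr σ τ)} : (∀ x, app f x = app g x) → f = g

namespace Str

instance (M : Str) (σ τ : Ty) : CoeFun (M.El (Ty.arr σ τ)) (fun _ => M.El σ → M.El τ) := ⟨M.app⟩

/-- An assignment of values to all variables. -/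
abbrev Asg (M : Str) : Type := (τ : Ty) → ℕ → M.El τ

variable {M : Str}

/-- `var τ 0 ↦ x`, `var τ (n + 1) ↦ e τ n`, and `e` on the variables of other types. -/
def Asg.cons {τ : Ty} (x : M.El τ) (e : M.Asg) : M.Asg := fun ρ n =>
  if h : ρ = τ then
    match n with
    | 0 => h ▸ x
    | k + 1 => e ρ k
  else e ρ n

theorem Asg.cons_self_zero {τ : Ty} (x : M.El τ) (e : M.Asg) : Asg.cons x e τ 0 = x := by
  simp [Asg.cons]

theorem Asg.cons_self_succ {τ : Ty} (x : M.El τ) (e : M.Asg) (n : ℕ) :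
    Asg.cons x e τ (n + 1) = e τ n := by
  simp [Asg.cons]

theorem Asg.cons_ne {τ ρ : Ty} (x : M.El τ) (e : M.Asg) (n : ℕ) (h : ρ ≠ τ) :
    Asg.cons x e ρ n = e ρ n := by
  simp [Asg.cons, h]

def eval (e : M.Asg) : {τ : Ty} → Tm τ → M.El τ
  | _, Tm.var τ n => e τ n
  | _, Tm.con c => M.con c
  | _, Tm.app t u => M.app (eval e t) (eval e u)

def Sat : M.Asg → Fm → Prop
  | e, Fm.eq t u => eval e t = eval e u
  | _, Fm.bot => False
  | e, Fm.imp φ ψ => Sat e φ → Sat e ψ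
  | e, Fm.all τ φ => ∀ x : M.El τ, Sat (Asg.cons x e) φ

theorem eval_subst (e : M.Asg) (s : Sub) {τ : Ty} (t : Tm τ) :
    eval e (t.subst s) = eval (fun ρ n => eval e (s ρ n)) t := by
  induction t with
  | var τ n => rfl
  | con c => rfl
  | app t u iht ihu => simp only [Tm.subst, eval, iht, ihu]

theorem eval_wk (e : M.Asg) {σ τ : Ty} (x : M.El σ) (t : Tm τ) :
    eval (Asg.cons x e) (t.wk σ) = eval e t := by
  rw [Tm.wk, eval_subst]
  congr 1
  funext ρ n
  by_cases h : ρ = σ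
  · subst h
    simp [Sub.wk, eval, Asg.cons_self_succ]
  · simp [Sub.wk, eval, Asg.cons_ne, h]

theorem sat_eq (e : M.Asg) (t u : Tm Ty.nat) : Sat e (Fm.eq t u) ↔ eval e t = eval e u := Iff.rfl
theorem sat_imp (e : M.Asg) (φ ψ : Fm) : Sat e (Fm.imp φ ψ) ↔ (Sat e φ → Sat e ψ) := Iff.rfl
theorem sat_all (e : M.Asg) (τ : Ty) (φ : Fm) :
    Sat e (Fm.all τ φ) ↔ ∀ x : M.El τ, Sat (Asg.cons x e) φ := Iff.rfl
theorem sat_neg (e : M.Asg) (φ : Fm) : Sat e φ.neg ↔ ¬ Sat e φ := Iff.rfl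
theorem sat_or (e : M.Asg) (φ ψ : Fm) : Sat e (φ.or ψ) ↔ (Sat e φ ∨ Sat e ψ) := by
  simp only [Fm.or, sat_imp, sat_neg]; tauto
theorem sat_and (e : M.Asg) (φ ψ : Fm) : Sat e (φ.and ψ) ↔ (Sat e φ ∧ Sat e ψ) := by
  simp only [Fm.and, sat_imp, sat_neg]; tauto
theorem sat_iff (e : M.Asg) (φ ψ : Fm) : Sat e (φ.iff ψ) ↔ (Sat e φ ↔ Sat e ψ) := by
  simp only [Fm.iff, sat_and, sat_imp]; tauto
theorem sat_ex (e : M.Asg) (τ : Ty) (φ : Fm) :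
    Sat e (Fm.ex τ φ) ↔ ∃ x : M.El τ, Sat (Asg.cons x e) φ := by
  simp only [Fm.ex, sat_all, sat_neg, not_forall, not_not]

/-- The defined equality at higher types is true equality because structures are extensional by
definition. -/
theorem sat_eqAt (e : M.Asg) (τ : Ty) (t u : Tm τ) : Sat e (eqAt τ t u) ↔ eval e t = eval e u := by
  induction τ generalizing e with
  | nat => rfl
  | arr σ τ _ ih =>
    simp only [eqAt, sat_all, ih, eval, eval_wk, Asg.cons_self_zero]
    exact ⟨M.ext, fun h x => by rw [h]⟩

end Str

/-! ### The term model of a Henkin set -/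

section TermModel

variable {T H : Set Fm}

theorem IsHenkin.mem_imp (hH : IsHenkin T H) (φ ψ : Fm) :
    Fm.imp φ ψ ∈ H ↔ (φ ∈ H → ψ ∈ H) := by
  constructor
  · intro h hφ
    refine hH.closed [Fm.imp φ ψ, φ] ψ (by simp [h, hφ]) ?_
    exact Prf.impE (Prf.hyp (φ := Fm.imp φ ψ) (by simp)) (Prf.hyp (by simp))
  · intro h
    rcases hH.complete φ with hφ | hφ
    · exact hH.closed [ψ] _ (by simp [h hφ]) (Prf.impI (Prf.hyp (by simp)))
    · refine hH.closed [φ.neg] _ (by simp [hφ]) (Prf.impI (Prf.exfalso ?_))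
      exact Prf.impE (Prf.hyp (φ := φ.neg) (by simp)) (Prf.hyp (by simp))

theorem IsHenkin.mem_neg (hH : IsHenkin T H) (φ : Fm) : φ.neg ∈ H ↔ φ ∉ H := by
  rw [Fm.neg, hH.mem_imp]
  exact ⟨fun h hφ => hH.bot_notMem (h hφ), fun h hφ => absurd hφ h⟩

theorem IsHenkin.mem_all (hH : IsHenkin T H) (τ : Ty) (φ : Fm) :
    Fm.all τ φ ∈ H ↔ ∀ t : Tm τ, φ.inst t ∈ H := by
  constructor
  · intro h t
    exact hH.closed [Fm.all τ φ] _ (by simp [h]) (Prf.allE t (Prf.hyp (by simp)))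
  · intro h
    by_contra h'
    obtain ⟨t, ht⟩ := hH.witness τ φ ((hH.mem_neg _).2 h')
    exact (hH.mem_neg _).1 ht (h t)

theorem IsHenkin.mem_ax (hH : IsHenkin T H) {φ : Fm} (h : φ ∈ T) : φ ∈ H :=
  hH.closed [] φ (by simp) (Prf.ax h)

theorem IsHenkin.eqAt_arr (hH : IsHenkin T H) {σ τ : Ty} (t u : Tm (Ty.arr σ τ)) :
    eqAt (Ty.arr σ τ) t u ∈ H ↔ ∀ v : Tm σ, eqAt τ (t.app v) (u.app v) ∈ H := by
  simp only [eqAt, hH.mem_all, Fm.inst, eqAt_subst, Tm.subst, Tm.wk_subst_cons, Tm.subst_id,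
    Sub.cons_self_zero]

/-- One application of `eqSubst` to the formula `x = v`. This shape yields both symmetry (with `v =
t`) and transitivity. -/
theorem IsHenkin.eq_trans_symm (hH : IsHenkin T H) {t u v : Tm Ty.nat}
    (h : Fm.eq t u ∈ H) (h' : Fm.eq t v ∈ H) : Fm.eq u v ∈ H := by
  refine hH.closed [Fm.eq t u, Fm.eq t v] _ (by simp [h, h']) ?_
  have := Prf.eqSubst (T := T) (Γ := [Fm.eq t u, Fm.eq t v]) (s := t) (t := u)
    (Fm.eq (nv 0) (v.wk Ty.nat)) (Prf.hyp (by simp))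
  simp only [Fm.inst, Fm.subst, Tm.subst, Tm.wk_subst_cons, Tm.subst_id,
    Sub.cons_self_zero] at this
  exact this (Prf.hyp (by simp))

theorem IsHenkin.eqAt_refl (hH : IsHenkin T H) {τ : Ty} (t : Tm τ) : eqAt τ t t ∈ H := by
  induction τ with
  | nat => exact hH.closed [] _ (by simp) (Prf.eqRefl t)
  | arr σ τ _ ih => exact (hH.eqAt_arr _ _).2 fun v => ih _

theorem IsHenkin.eqAt_trans_symm (hH : IsHenkin T H) {τ : Ty} {t u v : Tm τ}
    (h : eqAt τ t u ∈ H) (h' : eqAt τ t v ∈ H) : eqAt τ u v ∈ H := by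
  induction τ with
  | nat => exact hH.eq_trans_symm h h'
  | arr σ τ _ ih =>
    rw [hH.eqAt_arr] at h h' ⊢
    exact fun w => ih (h w) (h' w)

theorem IsHenkin.eqAt_symm (hH : IsHenkin T H) {τ : Ty} {t u : Tm τ}
    (h : eqAt τ t u ∈ H) : eqAt τ u t ∈ H :=
  hH.eqAt_trans_symm h (hH.eqAt_refl t)

theorem IsHenkin.eqAt_trans (hH : IsHenkin T H) {τ : Ty} {t u v : Tm τ}
    (h : eqAt τ t u ∈ H) (h' : eqAt τ u v ∈ H) : eqAt τ t v ∈ H :=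
  hH.eqAt_trans_symm (hH.eqAt_symm h) h'

/-- The function is replaced by the definition of `eqAt`, the argument by the axiom of
extensionality. This makes application well defined on the quotient. -/
theorem IsHenkin.eqAt_app (hH : IsHenkin T H) (hT : ∀ ρ τ, extensionality ρ τ ∈ T) {σ τ : Ty}
    {t u : Tm (Ty.arr σ τ)} {v w : Tm σ} (h : eqAt (Ty.arr σ τ) t u ∈ H) (h' : eqAt σ v w ∈ H) :
    eqAt τ (t.app v) (u.app w) ∈ H := by
  refine hH.eqAt_trans ((hH.eqAt_arr _ _).1 h v) ?_
  have hne := (Ty.ne_arr_left σ τ).symm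
  have hx := hH.mem_ax (hT σ τ)
  simp only [extensionality, hH.mem_all, Fm.inst, Fm.subst, eqAt_subst, Tm.subst,
    hH.mem_imp] at hx
  have := hx u v w
  simp only [Sub.lift_self_zero, Sub.lift_self_succ, Sub.lift_ne _ _ hne, Sub.cons_self_zero,
    Tm.wk_subst_lift, Tm.wk_subst_cons, Tm.subst, Tm.subst_id] at this
  exact this h'

/-- Terms up to provable extensional equality. -/
def IsHenkin.setoid (hH : IsHenkin T H) (τ : Ty) : Setoid (Tm τ) where
  r t u := eqAt τ t u ∈ H
  iseqv := ⟨hH.eqAt_refl, hH.eqAt_symm, hH.eqAt_trans⟩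

/-- The term model. -/
def IsHenkin.model (hH : IsHenkin T H) (hT : ∀ ρ τ, extensionality ρ τ ∈ T) : Str where
  El τ := Quotient (hH.setoid τ)
  app {σ τ} := Quotient.map₂ Tm.app fun _ _ h _ _ h' => hH.eqAt_app hT h h'
  con c := Quotient.mk _ (Tm.con c)
  ext {σ τ f g} h := by
    induction f using Quotient.inductionOn with | _ t
    induction g using Quotient.inductionOn with | _ u
    exact Quotient.sound ((hH.eqAt_arr t u).2 fun v => Quotient.exact (h (Quotient.mk _ v)))

/-- The element of the term model which is denoted by a term. -/
def IsHenkin.val (hH : IsHenkin T H) (hT : ∀ ρ τ, extensionality ρ τ ∈ T) {τ : Ty} (t : Tm τ) :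
    (hH.model hT).El τ := Quotient.mk (hH.setoid τ) t

theorem IsHenkin.val_eq_val (hH : IsHenkin T H) (hT : ∀ ρ τ, extensionality ρ τ ∈ T) {τ : Ty}
    {t u : Tm τ} : hH.val hT t = hH.val hT u ↔ eqAt τ t u ∈ H :=
  ⟨fun h => Quotient.exact h, fun h => Quotient.sound h⟩

theorem IsHenkin.exists_val (hH : IsHenkin T H) (hT : ∀ ρ τ, extensionality ρ τ ∈ T) {τ : Ty}
    (x : (hH.model hT).El τ) : ∃ t, x = hH.val hT t :=
  ⟨Quotient.out x, (Quotient.out_eq x).symm⟩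

/-- The assignment in the term model given by a substitution. -/
def IsHenkin.asg (hH : IsHenkin T H) (hT : ∀ ρ τ, extensionality ρ τ ∈ T) (s : Sub) :
    (hH.model hT).Asg := fun τ n => hH.val hT (s τ n)

theorem IsHenkin.eval_asg (hH : IsHenkin T H) (hT : ∀ ρ τ, extensionality ρ τ ∈ T) (s : Sub)
    {τ : Ty} (t : Tm τ) :
    Str.eval (hH.asg hT s) t = hH.val hT (t.subst s) := by
  induction t with
  | var τ n => rfl
  | con c => rfl
  | app t u iht ihu => simp only [Str.eval, iht, ihu]; rfl

theorem IsHenkin.cons_asg (hH : IsHenkin T H) (hT : ∀ ρ τ, extensionality ρ τ ∈ T) (s : Sub)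
    {τ : Ty} (t : Tm τ) :
    Str.Asg.cons (hH.val hT t) (hH.asg hT s) = hH.asg hT (Sub.cons τ t s) := by
  funext ρ n
  by_cases h : ρ = τ
  · subst h
    cases n with
    | zero => rw [Str.Asg.cons_self_zero, IsHenkin.asg, Sub.cons_self_zero]
    | succ n => rw [Str.Asg.cons_self_succ, IsHenkin.asg, IsHenkin.asg, Sub.cons_self_succ]
  · rw [Str.Asg.cons_ne _ _ _ h, IsHenkin.asg, IsHenkin.asg, Sub.cons_ne _ _ _ h]

/-- The truth lemma. In the quantifier case every element of the model is the value of a term, so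
quantifying over elements amounts to quantifying over instances. -/
theorem IsHenkin.sat_asg (hH : IsHenkin T H) (hT : ∀ ρ τ, extensionality ρ τ ∈ T) (s : Sub)
    (φ : Fm) : Str.Sat (hH.asg hT s) φ ↔ φ.subst s ∈ H := by
  induction φ generalizing s with
  | eq t u =>
    rw [Str.sat_eq, hH.eval_asg, hH.eval_asg, hH.val_eq_val]
    rfl
  | bot => exact ⟨False.elim, hH.bot_notMem⟩
  | imp φ ψ ihφ ihψ => rw [Str.sat_imp, ihφ, ihψ, Fm.subst, hH.mem_imp]
  | all τ φ ih =>
    rw [Str.sat_all, Fm.subst, hH.mem_all]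
    constructor
    · intro h t
      have := h (hH.val hT t)
      rwa [hH.cons_asg, ih, ← Fm.subst_lift_inst] at this
    · intro h x
      obtain ⟨t, rfl⟩ := hH.exists_val hT x
      rw [hH.cons_asg, ih, ← Fm.subst_lift_inst]
      exact h t

end TermModel

/-- `M` satisfies the universal closure of each axiom. -/
def Str.Models (M : Str) (T : Set Fm) : Prop := ∀ φ ∈ T, ∀ e : M.Asg, Str.Sat e φ

/-- Completeness, for sets of axioms which are closed under substitution and contain the axioms of
extensionality. -/
theorem proves_of_models {T : Set Fm} (hT : SubstClosed T) (hE : ∀ ρ τ, extensionality ρ τ ∈ T)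
    {φ : Fm} (h : ∀ M : Str, M.Models T → ∀ e : M.Asg, Str.Sat e φ) : Proves T φ := by
  by_contra hφ
  obtain ⟨H, hH, hmem⟩ := exists_isHenkin hT [φ.neg] fun hb => hφ (Prf.raa hb)
  have hneg : φ ∉ H := (hH.mem_neg φ).1 (hmem _ (by simp))
  refine hneg ?_
  have := h (hH.model hE) (fun ψ hψ e => ?_) (hH.asg hE Sub.id)
  · rwa [hH.sat_asg, Fm.subst_id] at this
  -- Every assignment in the term model comes from a substitution, so closure of the axioms under
  -- substitution makes them true under all assignments.
  · obtain ⟨s, rfl⟩ : ∃ s, e = hH.asg hE s :=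
      ⟨fun τ n => (hH.exists_val hE (e τ n)).choose,
        by funext τ n; exact (hH.exists_val hE (e τ n)).choose_spec⟩
    rw [hH.sat_asg]
    exact hH.mem_ax (hT ψ hψ s)

end HOA

namespace HOA
namespace Str

/-! ### Models of `ACA₀^ω` -/

section

variable {M : Str}

instance : Zero (M.El Ty.nat) := ⟨M.con Con.zero⟩
instance : One (M.El Ty.nat) := ⟨M.con Con.succ (M.con Con.zero)⟩
instance : Add (M.El Ty.nat) := ⟨fun a b => M.app (M.con Con.add a) b⟩
instance : Mul (M.El Ty.nat) := ⟨fun a b => M.app (M.con Con.mul a) b⟩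

/-- The successor function. -/
def suc (n : M.El Ty.nat) : M.El Ty.nat := M.con Con.succ n

theorem eval_zero (e : M.Asg) : eval e zero = 0 := rfl
theorem eval_one (e : M.Asg) : eval e one = 1 := rfl
theorem eval_two (e : M.Asg) : eval e two = suc 1 := rfl
theorem eval_succ (e : M.Asg) (t : Tm Ty.nat) : eval e (succ t) = suc (eval e t) := rfl
theorem eval_add (e : M.Asg) (t u : Tm Ty.nat) : eval e (add t u) = eval e t + eval e u := rfl
theorem eval_mul (e : M.Asg) (t u : Tm Ty.nat) : eval e (mul t u) = eval e t * eval e u := rfl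
theorem eval_app (e : M.Asg) {σ τ : Ty} (t : Tm (Ty.arr σ τ)) (u : Tm σ) :
    eval e (t.app u) = M.app (eval e t) (eval e u) := rfl
theorem eval_var (e : M.Asg) (τ : Ty) (n : ℕ) : eval e (Tm.var τ n) = e τ n := rfl
theorem eval_const (e : M.Asg) (σ : Ty) {ρ : Ty} (t : Tm ρ) :
    eval e (const σ t) = M.con (Con.pi ρ σ) (eval e t) := rfl

instance (τ : Ty) : Nonempty (M.El τ) := by
  induction τ with
  | nat => exact ⟨0⟩
  | arr σ τ _ ih => exact ih.map fun x => M.con (Con.pi τ σ) x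

instance : Nonempty M.Asg := ⟨fun _ _ => Classical.arbitrary _⟩

end

/-- The consequences of the axioms of `ACA₀^ω` from which everything else is derived. -/
class ACA (M : Str) : Prop where
  suc_ne_zero (n : M.El Ty.nat) : suc n ≠ 0
  suc_inj (m n : M.El Ty.nat) : suc m = suc n → m = n
  add_zero (m : M.El Ty.nat) : m + 0 = m
  add_suc (m n : M.El Ty.nat) : m + suc n = suc (m + n)
  mul_zero (m : M.El Ty.nat) : m * 0 = 0
  mul_suc (m n : M.El Ty.nat) : m * suc n = m * n + m
  pi {ρ σ : Ty} (x : M.El ρ) (y : M.El σ) : M.con (Con.pi ρ σ) x y = x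
  sigma {ρ σ τ : Ty} (x : M.El (Ty.arr ρ (Ty.arr σ τ))) (y : M.El (Ty.arr ρ σ)) (z : M.El ρ) :
    M.con (Con.sigma ρ σ τ) x y z = x z (y z)
  recursor_zero (f : M.El (Ty.arr Ty.nat (Ty.arr Ty.nat Ty.nat))) (m : M.El Ty.nat) :
    M.con Con.recursor f m (0 : M.El Ty.nat) = m
  recursor_suc (f : M.El (Ty.arr Ty.nat (Ty.arr Ty.nat Ty.nat))) (m n : M.El Ty.nat) :
    M.con Con.recursor f m (suc n) = f n (M.con Con.recursor f m n)
  induction (f : M.El Ty.one) : f (0 : M.El Ty.nat) = 0 → (∀ n, f n = 0 → f (suc n) = 0) →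
    ∀ n, f n = 0
  choice (f : M.El (Ty.arr Ty.one Ty.one)) : (∀ x, ∃ n, f x n = 0) →
    ∃ g : M.El Ty.two, ∀ x, f x (g x) = 0
  -- Decides equality of two numbers, passed as the first two values of a single type `1` argument.
  -- It comes from the choice axiom for a quantifier-free definition by cases.
  eq_functional : ∃ g : M.El Ty.two, ∀ x : M.El Ty.one,
    (x (0 : M.El Ty.nat) = x (1 : M.El Ty.nat) → g x = 0) ∧
      (¬ x (0 : M.El Ty.nat) = x (1 : M.El Ty.nat) → g x = 1)
  exists_functional : ∃ g : M.El Ty.two, ∀ x, g x = 0 ↔ ∃ n, x n = 0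

theorem Models.aca {M : Str} (hM : M.Models ACA0ω) : M.ACA := by
  have h : ∀ {φ : Fm}, RCA0ω φ → ∀ e : M.Asg, Sat e φ := fun hφ e => hM _ (Or.inl hφ) e
  obtain ⟨e⟩ : Nonempty M.Asg := inferInstance
  refine ⟨fun n => ?_, fun m n => ?_, fun m => ?_, fun m n => ?_, fun m => ?_, fun m n => ?_,
    fun {ρ σ} x y => ?_, fun {ρ σ τ} x y z => ?_, fun f m => ?_, fun f m n => ?_, fun f => ?_,
    fun f => ?_, ?_, ?_⟩
  · exact h (RCA0ω.succ_ne_zero (nv 0)) fun τ _ => if hτ : τ = Ty.nat then hτ ▸ n else e τ 0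
  · exact h (RCA0ω.succ_inj (nv 0) (nv 1)) (Asg.cons m (Asg.cons n e))
  · exact h (RCA0ω.add_zero (nv 0)) (Asg.cons m e)
  · exact h (RCA0ω.add_succ (nv 0) (nv 1)) (Asg.cons m (Asg.cons n e))
  · exact h (RCA0ω.mul_zero (nv 0)) (Asg.cons m e)
  · exact h (RCA0ω.mul_succ (nv 0) (nv 1)) (Asg.cons m (Asg.cons n e))
  -- The first variable is weakened past the second so that the instance is also right when `ρ = σ`.
  · have := h (RCA0ω.pi ((Tm.var ρ 0).wk σ) (Tm.var σ 0)) (Asg.cons y (Asg.cons x e))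
    simpa only [sat_eqAt, eval, eval_wk, Asg.cons_self_zero] using this
  · have := h (RCA0ω.sigma (((Tm.var (Ty.arr ρ (Ty.arr σ τ)) 0).wk (Ty.arr ρ σ)).wk ρ)
      ((Tm.var (Ty.arr ρ σ) 0).wk ρ) (Tm.var ρ 0)) (Asg.cons z (Asg.cons y (Asg.cons x e)))
    simpa only [sat_eqAt, eval, eval_wk, Asg.cons_self_zero] using this
  · exact h (RCA0ω.recur_zero (Tm.var _ 0) (nv 0)) (Asg.cons f (Asg.cons m e))
  · exact h (RCA0ω.recur_succ (Tm.var _ 0) (nv 0) (nv 1))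
      (Asg.cons f (Asg.cons m (Asg.cons n e)))
  · exact h (RCA0ω.induction (Fm.eq ((fv 0).app (nv 0)) zero) trivial) (Asg.cons f e)
  · have := h (RCA0ω.choice (Fm.eq (((Tm.var (Ty.arr Ty.one Ty.one) 0).app (fv 0)).app (nv 0)) zero)
      trivial) (Asg.cons f e)
    simp only [choice, sat_imp, sat_all, sat_ex] at this
    exact this
  · have := h (RCA0ω.choice (Fm.and
      (Fm.imp (Fm.eq ((fv 0).app zero) ((fv 0).app one)) (Fm.eq (nv 0) zero))
      (Fm.imp (Fm.eq ((fv 0).app zero) ((fv 0).app one)).neg (Fm.eq (nv 0) one)))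
      (by simp [Fm.and, Fm.neg, Fm.QF])) e
    simp only [choice, sat_imp, sat_all, sat_ex] at this
    obtain ⟨g, hg⟩ := this (fun x => by
      simp only [sat_and, sat_imp, sat_neg, sat_eq]
      by_cases hx : x (0 : M.El Ty.nat) = x (1 : M.El Ty.nat)
      · exact ⟨0, fun _ => rfl, fun h => absurd hx h⟩
      · exact ⟨1, fun h => absurd h hx, fun _ => rfl⟩)
    refine ⟨g, fun x => ?_⟩
    have hx := hg x
    change Sat _ (Fm.and _ _) at hx
    rw [sat_and] at hx
    exact hx
  · have := hM existsTwo (Or.inr rfl) e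
    simp only [existsTwo, sat_all, sat_ex, sat_and, sat_iff] at this
    obtain ⟨g, hg⟩ := this
    exact ⟨g, fun x => (hg x).2.symm⟩

/-! ### Definable functions -/

section Definable

variable (M : Str)

/-- The values of a list of variables of the given types. -/
def Dom : List Ty → Type
  | [] => Unit
  | σ :: Γ => M.El σ × Dom Γ

/-- A function of several variables is definable if it is given by an element of the structure. -/
def Def : (Γ : List Ty) → {τ : Ty} → (M.Dom Γ → M.El τ) → Prop
  | [], _, _ => True
  | σ :: Γ, τ, f => ∃ g : M.Dom Γ → M.El (Ty.arr σ τ), Def Γ g ∧ ∀ x e, g e x = f (x, e)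

variable {M}

theorem Def.const [M.ACA] (Γ : List Ty) {τ : Ty} (c : M.El τ) : M.Def Γ fun _ => c := by
  induction Γ generalizing τ with
  | nil => trivial
  | cons σ Γ ih => exact ⟨_, ih (M.con (Con.pi τ σ) c), fun x e => ACA.pi c x⟩

/-- Bracket abstraction: `Σ` distributes an argument over an application. Together with `Π` for
constants and `Σ Π Π` for the variable this is combinatory completeness. -/
theorem Def.app [M.ACA] {Γ : List Ty} {σ τ : Ty} {f : M.Dom Γ → M.El (Ty.arr σ τ)}
    {g : M.Dom Γ → M.El σ} (hf : M.Def Γ f) (hg : M.Def Γ g) :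
    M.Def Γ fun e => f e (g e) := by
  induction Γ generalizing σ τ with
  | nil => trivial
  | cons ρ Γ ih =>
    obtain ⟨f', hf', hf⟩ := hf
    obtain ⟨g', hg', hg⟩ := hg
    refine ⟨_, ih (ih (Def.const Γ (M.con (Con.sigma ρ σ τ))) hf') hg', fun x e => ?_⟩
    rw [ACA.sigma, hf, hg]

theorem Def.wk [M.ACA] {Γ : List Ty} {σ τ : Ty} {f : M.Dom Γ → M.El τ} (hf : M.Def Γ f) :
    M.Def (σ :: Γ) fun e => f e.2 :=
  ⟨_, Def.app (Def.const Γ (M.con (Con.pi τ σ))) hf, fun x e => ACA.pi (f e) x⟩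

theorem Def.fst [M.ACA] {Γ : List Ty} {σ : Ty} : M.Def (σ :: Γ) fun e => e.1 := by
  refine ⟨_, Def.const Γ (M.con (Con.sigma σ (Ty.arr σ σ) σ) (M.con (Con.pi σ (Ty.arr σ σ)))
    (M.con (Con.pi σ σ))), fun x e => ?_⟩
  rw [ACA.sigma, ACA.pi]

/-- A type together with a choice of the functions of several variables into it which are
regarded as definable. -/
class Plots (M : Str) (A : Type) where
  plot : (Γ : List Ty) → (M.Dom Γ → A) → Prop
  const : ∀ (Γ : List Ty) (a : A), plot Γ fun _ => a
  wk : ∀ {Γ : List Ty} {p : M.Dom Γ → A} (σ : Ty), plot Γ p → plot (σ :: Γ) fun e => p e.2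

instance [M.ACA] (τ : Ty) : Plots M (M.El τ) where
  plot Γ p := M.Def Γ p
  const Γ c := Def.const Γ c
  wk _ := Def.wk

instance {A B : Type} [Plots M A] [Plots M B] : Plots M (A × B) where
  plot Γ p := Plots.plot Γ (fun e => (p e).1) ∧ Plots.plot Γ fun e => (p e).2
  const Γ c := ⟨Plots.const Γ c.1, Plots.const Γ c.2⟩
  wk σ h := ⟨Plots.wk σ h.1, Plots.wk σ h.2⟩

/-- With `Prop` as a possible target, comprehension becomes definability of a map and is proved by
the same composition rules as definability of functions. -/
instance [M.ACA] : Plots M Prop where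
  plot Γ p := ∃ c : M.Dom Γ → M.El Ty.nat, M.Def Γ c ∧ ∀ e, p e ↔ c e = 0
  const Γ a := by
    by_cases h : a
    · exact ⟨_, Def.const Γ 0, by simp [h]⟩
    · exact ⟨_, Def.const Γ (suc 0), by simp [h, ACA.suc_ne_zero]⟩
  wk σ := fun ⟨c, hc, h⟩ => ⟨_, Def.wk hc, fun e => h e.2⟩

/-- Definable maps, i.e. maps that preserve definable families. -/
@[fun_prop]
def Df (M : Str) {A B : Type} [Plots M A] [Plots M B] (f : A → B) : Prop :=
  ∀ (Γ : List Ty) (p : M.Dom Γ → A), Plots.plot Γ p → Plots.plot Γ fun e => f (p e)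

section

variable {A B C : Type} [Plots M A] [Plots M B] [Plots M C]

@[fun_prop]
theorem Df.id : Df M fun a : A => a := fun _ _ h => h

@[fun_prop]
theorem Df.const (b : B) : Df M fun _ : A => b := fun Γ _ _ => Plots.const Γ b

@[fun_prop]
theorem Df.comp {f : B → C} {g : A → B} (hf : Df M f) (hg : Df M g) : Df M fun a => f (g a) :=
  fun Γ _ h => hf Γ _ (hg Γ _ h)

@[fun_prop]
theorem Df.prodMk {f : A → B} {g : A → C} (hf : Df M f) (hg : Df M g) : Df M fun a => (f a, g a) :=
  fun Γ _ h => ⟨hf Γ _ h, hg Γ _ h⟩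

@[fun_prop]
theorem Df.fst {f : A → B × C} (hf : Df M f) : Df M fun a => (f a).1 := fun Γ _ h => (hf Γ _ h).1

@[fun_prop]
theorem Df.snd {f : A → B × C} (hf : Df M f) : Df M fun a => (f a).2 := fun Γ _ h => (hf Γ _ h).2

end

/-! ### Abstraction and primitive recursion -/

variable [M.ACA] {A : Type} [Plots M A]

@[fun_prop]
theorem Df.app {σ τ : Ty} {f : A → M.El (Ty.arr σ τ)} {g : A → M.El σ} (hf : Df M f)
    (hg : Df M g) : Df M fun a => M.app (f a) (g a) :=
  fun Γ _ h => Def.app (hf Γ _ h) (hg Γ _ h)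

theorem Df.exists_rep {σ τ : Ty} {f : M.El σ → M.El τ} (hf : Df M f) :
    ∃ g : M.El (Ty.arr σ τ), ∀ x, g x = f x := by
  obtain ⟨g, -, hg⟩ := hf [σ] (fun e => e.1) Def.fst
  exact ⟨g (), fun x => hg x ()⟩

open Classical in
/-- The element of the structure that represents `f`, if there is one. -/
noncomputable def lam {σ τ : Ty} (f : M.El σ → M.El τ) : M.El (Ty.arr σ τ) :=
  if h : ∃ g : M.El (Ty.arr σ τ), ∀ x, g x = f x then h.choose else Classical.arbitrary _

omit [M.ACA] in
theorem lam_eq {σ τ : Ty} {f : M.El σ → M.El τ} {g : M.El (Ty.arr σ τ)} (h : ∀ x, g x = f x) :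
    lam f = g := by
  have h' : ∃ g : M.El (Ty.arr σ τ), ∀ x, g x = f x := ⟨g, h⟩
  rw [lam, dif_pos h']
  exact M.ext fun x => by rw [h'.choose_spec, h]

theorem lam_app {σ τ : Ty} {f : M.El σ → M.El τ} (hf : Df M f) (x : M.El σ) : lam f x = f x := by
  obtain ⟨g, hg⟩ := hf.exists_rep
  rw [lam_eq hg, hg]

-- A plot over the context enlarged by `σ` is by definition represented by a plot of elements of
-- type `σ → τ`. By extensionality these are the representatives chosen by `lam`.
@[fun_prop]
theorem Df.lam {σ τ : Ty} {f : A → M.El σ → M.El τ} (hf : Df M fun p : A × M.El σ => f p.1 p.2) :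
    Df M fun a => lam (f a) := by
  intro Γ p hp
  obtain ⟨g, hg, h⟩ := hf (σ :: Γ) (fun e => (p e.2, e.1)) ⟨Plots.wk σ hp, Def.fst⟩
  have : (fun e => Str.lam (f (p e))) = g := by
    funext e
    exact lam_eq fun x => h x e
  rw [this]
  exact hg

@[fun_prop]
theorem Df.suc {f : A → M.El Ty.nat} (hf : Df M f) : Df M fun a => suc (f a) :=
  (Df.const (M.con Con.succ)).app hf

@[fun_prop]
theorem Df.add {f g : A → M.El Ty.nat} (hf : Df M f) (hg : Df M g) : Df M fun a => f a + g a :=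
  ((Df.const (M.con Con.add)).app hf).app hg

@[fun_prop]
theorem Df.mul {f g : A → M.El Ty.nat} (hf : Df M f) (hg : Df M g) : Df M fun a => f a * g a :=
  ((Df.const (M.con Con.mul)).app hf).app hg

/-- Primitive recursion. -/
noncomputable def recn (f : M.El Ty.nat → M.El Ty.nat → M.El Ty.nat) (m n : M.El Ty.nat) :
    M.El Ty.nat := M.con Con.recursor (Str.lam fun i => Str.lam fun x => f i x) m n

@[fun_prop]
theorem Df.recn {f : A → M.El Ty.nat → M.El Ty.nat → M.El Ty.nat} {m n : A → M.El Ty.nat}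
    (hf : Df M fun p : (A × M.El Ty.nat) × M.El Ty.nat => f p.1.1 p.1.2 p.2)
    (hm : Df M m) (hn : Df M n) : Df M fun a => recn (f a) (m a) (n a) := by
  exact (((Df.const _).app (Df.lam (Df.lam hf))).app hm).app hn

theorem recn_zero (f : M.El Ty.nat → M.El Ty.nat → M.El Ty.nat) (m : M.El Ty.nat) :
    recn f m 0 = m := ACA.recursor_zero _ _

theorem recn_suc {f : M.El Ty.nat → M.El Ty.nat → M.El Ty.nat}
    (hf : Df M fun p : M.El Ty.nat × M.El Ty.nat => f p.1 p.2) (m n : M.El Ty.nat) :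
    recn f m (suc n) = f n (recn f m n) := by
  have h1 : Df M fun i => Str.lam fun x => f i x := by fun_prop
  have h2 : ∀ i, Df M fun x => f i x := fun i =>
    Df.comp (f := fun p : M.El Ty.nat × M.El Ty.nat => f p.1 p.2) (g := fun x => (i, x)) hf
      (by fun_prop)
  rw [recn, ACA.recursor_suc, lam_app h1, lam_app (h2 n)]
  rfl

/-! ### Characteristic functions, number quantifiers and search -/

open Classical in
/-- The characteristic function with value `0` for true propositions and `1` for false ones. -/
noncomputable def chi (P : Prop) : M.El Ty.nat := if P then 0 else 1

theorem one_ne_zero_aux : (1 : M.El Ty.nat) ≠ 0 := ACA.suc_ne_zero 0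

theorem chi_eq_zero {P : Prop} : (chi P : M.El Ty.nat) = 0 ↔ P := by
  unfold chi; split_ifs with h <;> simp [h, one_ne_zero_aux]

theorem chi_eq_one {P : Prop} : (chi P : M.El Ty.nat) = 1 ↔ ¬ P := by
  unfold chi; split_ifs with h <;> simp [h, one_ne_zero_aux.symm]

theorem Df.of_char {P : A → Prop} {c : A → M.El Ty.nat} (hc : Df M c)
    (h : ∀ a, P a ↔ c a = 0) : Df M P :=
  fun Γ p hp => ⟨_, hc Γ p hp, fun _ => h _⟩

/-- The functional that compares two numbers expects a type `1` argument. Recursion from `f a` with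
constant step `g a` supplies one whose values at `0` and `1` are `f a` and `g a`. -/
theorem Df.chi_eq {f g : A → M.El Ty.nat} (hf : Df M f) (hg : Df M g) :
    Df M fun a => (chi (f a = g a) : M.El Ty.nat) := by
  obtain ⟨k, hk⟩ := ACA.eq_functional (M := M)
  have h : (fun a => (Str.chi (f a = g a) : M.El Ty.nat)) =
      fun a => M.app k (Str.lam fun n => Str.recn (fun _ _ => g a) (f a) n) := by
    funext a
    have h0 : Str.lam (fun n => Str.recn (fun _ _ => g a) (f a) n) (0 : M.El Ty.nat) = f a := by
      rw [lam_app (by fun_prop), recn_zero]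
    have h1 : Str.lam (fun n => Str.recn (fun _ _ => g a) (f a) n) (1 : M.El Ty.nat) = g a := by
      rw [lam_app (by fun_prop)]
      exact recn_suc (by fun_prop) _ _
    have := hk (Str.lam fun n => Str.recn (fun _ _ => g a) (f a) n)
    rw [h0, h1] at this
    unfold Str.chi
    split_ifs with h
    · exact (this.1 h).symm
    · exact (this.2 h).symm
  rw [h]
  have hg' : Df M fun p : ((A × M.El Ty.nat) × M.El Ty.nat) × M.El Ty.nat => g p.1.1.1 :=
    hg.comp (by fun_prop)
  fun_prop

@[fun_prop]
theorem Df.eq {f g : A → M.El Ty.nat} (hf : Df M f) (hg : Df M g) : Df M fun a => f a = g a :=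
  Df.of_char (Df.chi_eq hf hg) fun _ => chi_eq_zero.symm

-- A definable predicate comes with some function vanishing exactly where it holds; comparing that
-- function with `0` normalizes its values to `0` and `1`.
@[fun_prop]
theorem Df.chi {P : A → Prop} (hP : Df M P) : Df M fun a => (chi (P a) : M.El Ty.nat) := by
  intro Γ p hp
  obtain ⟨c, hc, h⟩ := hP Γ p hp
  have : (fun e => (Str.chi (P (p e)) : M.El Ty.nat)) = fun e => Str.chi (c e = 0) := by
    funext e
    rw [← propext (h e)]
  rw [this]
  have h2 : Df M fun n : M.El Ty.nat => (Str.chi (n = 0) : M.El Ty.nat) :=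
    Df.chi_eq Df.id (Df.const 0)
  exact h2 Γ c hc

@[fun_prop]
theorem Df.not {P : A → Prop} (hP : Df M P) : Df M fun a => ¬ P a := by
  have : (fun a => ¬ P a) = fun a => (Str.chi (P a) : M.El Ty.nat) = 1 := by
    funext a
    rw [chi_eq_one]
  rw [this]
  fun_prop

@[fun_prop]
theorem Df.and {P Q : A → Prop} (hP : Df M P) (hQ : Df M Q) : Df M fun a => P a ∧ Q a := by
  refine Df.of_char (c := fun a => Str.chi (P a) + Str.chi (Q a)) (by fun_prop) fun a => ?_
  have h : ∀ n : M.El Ty.nat, n + 1 ≠ 0 := fun n h => ACA.suc_ne_zero _ ((ACA.add_suc n 0).symm.trans h)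
  by_cases hP : P a <;> by_cases hQ : Q a <;> simp [Str.chi, hP, hQ, ACA.add_zero, h, one_ne_zero_aux]

@[fun_prop]
theorem Df.or {P Q : A → Prop} (hP : Df M P) (hQ : Df M Q) : Df M fun a => P a ∨ Q a := by
  simp only [or_iff_not_and_not]
  fun_prop

theorem Df.imp {P Q : A → Prop} (hP : Df M P) (hQ : Df M Q) : Df M fun a => P a → Q a := by
  simp only [imp_iff_not_or]
  fun_prop

-- The place where `(∃²)` enters: number quantifiers preserve definability, which gives arithmetical
-- comprehension.
@[fun_prop]
theorem Df.exists {P : A → M.El Ty.nat → Prop} (hP : Df M fun p : A × M.El Ty.nat => P p.1 p.2) :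
    Df M fun a => ∃ n, P a n := by
  obtain ⟨k, hk⟩ := ACA.exists_functional (M := M)
  have hc : Df M fun p : A × M.El Ty.nat => (Str.chi (P p.1 p.2) : M.El Ty.nat) := hP.chi
  have hP' : ∀ a, Df M fun n => (Str.chi (P a n) : M.El Ty.nat) := fun a =>
    hc.comp (g := fun n => (a, n)) (by fun_prop)
  refine Df.of_char (c := fun a => M.app k (Str.lam fun n => Str.chi (P a n)))
    ((Df.const k).app (Df.lam hc)) fun a => ?_
  rw [hk]
  simp only [lam_app (hP' a), chi_eq_zero]

theorem Df.forall {P : A → M.El Ty.nat → Prop} (hP : Df M fun p : A × M.El Ty.nat => P p.1 p.2) :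
    Df M fun a => ∀ n, P a n := by
  have : (fun a => ∀ n, P a n) = fun a => ¬ ∃ n, ¬ P a n := by
    funext a
    simp
  rw [this]
  exact (Df.exists hP.not).not

/-- Induction for definable predicates. -/
theorem induction_df {P : M.El Ty.nat → Prop} (hP : Df M P) (h0 : P 0)
    (hs : ∀ n, P n → P (suc n)) (n : M.El Ty.nat) : P n := by
  have h : ∀ n, Str.lam (fun n => chi (P n)) n = (0 : M.El Ty.nat) ↔ P n := fun n => by
    rw [lam_app (by fun_prop), chi_eq_zero]
  rw [← h]
  refine ACA.induction _ ((h 0).2 h0) (fun n hn => ?_) n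
  exact (h _).2 (hs n ((h n).1 hn))

theorem eq_zero_or_eq_suc (n : M.El Ty.nat) : n = 0 ∨ ∃ m, n = suc m :=
  induction_df (P := fun n => n = 0 ∨ ∃ m, n = suc m) (by fun_prop) (Or.inl rfl)
    (fun n _ => Or.inr ⟨n, rfl⟩) n

/-- The search operator `μ`. -/
theorem exists_search : ∃ g : M.El Ty.two, ∀ x : M.El Ty.one, (∃ n, x n = 0) → x (g x) = 0 := by
  -- The condition "if `x` has a zero then `n` is one" is decidable by `(∃²)` and always satisfied
  -- by some `n`, so the choice axiom applies to its characteristic function.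
  have h1 : Df M fun p : M.El Ty.one × M.El Ty.nat =>
      (chi (¬ (∃ m, M.app p.1 m = 0) ∨ M.app p.1 p.2 = 0) : M.El Ty.nat) := by fun_prop
  have h2 : ∀ x n, Str.lam (fun x => Str.lam fun n =>
      chi (¬ (∃ m, M.app x m = 0) ∨ M.app x n = 0)) x n = (0 : M.El Ty.nat) ↔
      ((∃ m, M.app x m = 0) → M.app x n = 0) := fun x n => by
    rw [lam_app (Df.lam h1), lam_app (h1.comp (g := fun n => (x, n)) (by fun_prop)), chi_eq_zero,
      imp_iff_not_or]
  obtain ⟨g, hg⟩ := ACA.choice (Str.lam fun x : M.El Ty.one => Str.lam fun n : M.El Ty.nat =>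
    (chi (¬ (∃ m, M.app x m = 0) ∨ M.app x n = 0) : M.El Ty.nat)) (fun x => by
      simp only [h2]
      by_cases h : ∃ m, M.app x m = 0
      · obtain ⟨m, hm⟩ := h
        exact ⟨m, fun _ => hm⟩
      · exact ⟨0, fun h' => absurd h' h⟩)
  exact ⟨g, fun x => (h2 _ _).1 (hg x)⟩

/-- A definable choice of a number that satisfies `P`. -/
noncomputable def eps (P : M.El Ty.nat → Prop) : M.El Ty.nat :=
  (exists_search (M := M)).choose (Str.lam fun n => chi (P n))

@[fun_prop]
theorem Df.eps {P : A → M.El Ty.nat → Prop} (hP : Df M fun p : A × M.El Ty.nat => P p.1 p.2) :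
    Df M fun a => eps (P a) :=
  (Df.const _).app (Df.lam hP.chi)

theorem eps_spec {P : M.El Ty.nat → Prop} (hP : Df M P) (h : ∃ n, P n) : P (eps P) := by
  have h1 : ∀ n, Str.lam (fun n => chi (P n)) n = (0 : M.El Ty.nat) ↔ P n := fun n => by
    rw [lam_app (by fun_prop), chi_eq_zero]
  have := (exists_search (M := M)).choose_spec (Str.lam fun n => chi (P n))
  simp only [h1] at this
  exact this h

end Definable

/-! ### Arithmetic -/

section Arithmetic

variable {M : Str} [M.ACA]

theorem ACA.zero_add (m : M.El Ty.nat) : 0 + m = m :=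
  induction_df (P := fun m => 0 + m = m) (by fun_prop) (ACA.add_zero _)
    (fun n h => by rw [ACA.add_suc, h]) m

theorem ACA.suc_add (m n : M.El Ty.nat) : suc m + n = suc (m + n) :=
  induction_df (P := fun n => suc m + n = suc (m + n)) (by fun_prop)
    (by rw [ACA.add_zero, ACA.add_zero]) (fun n h => by rw [ACA.add_suc, h, ACA.add_suc]) n

theorem ACA.add_comm (m n : M.El Ty.nat) : m + n = n + m :=
  induction_df (P := fun n => m + n = n + m) (by fun_prop)
    (by rw [ACA.add_zero, ACA.zero_add]) (fun n h => by rw [ACA.add_suc, h, ACA.suc_add]) n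

theorem ACA.add_assoc (k m n : M.El Ty.nat) : k + m + n = k + (m + n) :=
  induction_df (P := fun n => k + m + n = k + (m + n)) (by fun_prop)
    (by rw [ACA.add_zero, ACA.add_zero]) (fun n h => by simp only [ACA.add_suc, h]) n

instance : AddCommMonoid (M.El Ty.nat) where
  add_assoc := ACA.add_assoc
  zero_add := ACA.zero_add
  add_zero := ACA.add_zero
  add_comm := ACA.add_comm
  nsmul := nsmulRec

theorem suc_eq_add_one (n : M.El Ty.nat) : suc n = n + 1 := by
  have := ACA.add_suc n 0
  rw [ACA.add_zero] at this
  exact this.symm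

theorem ACA.zero_mul (m : M.El Ty.nat) : 0 * m = 0 :=
  induction_df (P := fun m => 0 * m = 0) (by fun_prop) (ACA.mul_zero _)
    (fun n h => by rw [ACA.mul_suc, h, ACA.add_zero]) m

theorem ACA.suc_mul (m n : M.El Ty.nat) : suc m * n = m * n + n :=
  induction_df (P := fun n => suc m * n = m * n + n) (by fun_prop)
    (by simp only [ACA.mul_zero, ACA.add_zero])
    (fun n h => by
      rw [ACA.mul_suc, h, ACA.mul_suc, ACA.add_suc, ACA.add_suc]
      congr 1
      ac_rfl) n

theorem ACA.mul_comm (m n : M.El Ty.nat) : m * n = n * m :=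
  induction_df (P := fun n => m * n = n * m) (by fun_prop)
    (by rw [ACA.mul_zero, ACA.zero_mul]) (fun n h => by rw [ACA.mul_suc, h, ACA.suc_mul]) n

theorem ACA.mul_add (k m n : M.El Ty.nat) : k * (m + n) = k * m + k * n :=
  induction_df (P := fun n => k * (m + n) = k * m + k * n) (by fun_prop)
    (by simp only [ACA.mul_zero, ACA.add_zero])
    (fun n h => by simp only [ACA.add_suc, ACA.mul_suc, h, ACA.add_assoc]) n

theorem ACA.mul_assoc (k m n : M.El Ty.nat) : k * m * n = k * (m * n) :=
  induction_df (P := fun n => k * m * n = k * (m * n)) (by fun_prop)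
    (by simp only [ACA.mul_zero]) (fun n h => by simp only [ACA.mul_suc, h, ACA.mul_add]) n

theorem ACA.mul_one (m : M.El Ty.nat) : m * 1 = m :=
  (ACA.mul_suc m 0).trans (by rw [ACA.mul_zero, ACA.zero_add])

instance : CommSemiring (M.El Ty.nat) where
  mul_assoc := ACA.mul_assoc
  one_mul m := by rw [ACA.mul_comm, ACA.mul_one]
  mul_one := ACA.mul_one
  mul_comm := ACA.mul_comm
  zero_mul := ACA.zero_mul
  mul_zero := ACA.mul_zero
  left_distrib := ACA.mul_add
  right_distrib k m n := by rw [ACA.mul_comm, ACA.mul_add, ACA.mul_comm n k, ACA.mul_comm n m]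
  nsmul := nsmulRec

theorem add_one_ne_zero (n : M.El Ty.nat) : n + 1 ≠ 0 := by
  rw [← suc_eq_add_one]
  exact ACA.suc_ne_zero n

instance : IsCancelAdd (M.El Ty.nat) :=
  have h : ∀ k m n : M.El Ty.nat, m + k = n + k → m = n := fun k m n =>
    induction_df (P := fun k => ¬ m + k = n + k ∨ m = n) (by fun_prop)
      (by simp [imp_iff_not_or.symm])
      (fun k hk => by
        rw [← imp_iff_not_or, ACA.add_suc, ACA.add_suc] at *
        exact fun h => hk (ACA.suc_inj _ _ h)) k |> imp_iff_not_or.2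
  { add_left_cancel := fun k m n hk => h k m n (by simpa only [add_comm] using hk)
    add_right_cancel := fun k m n hk => h k m n hk }

/-- Induction for definable predicates. -/
theorem induction_add_one {P : M.El Ty.nat → Prop} (hP : Df M P) (h0 : P 0)
    (hs : ∀ n, P n → P (n + 1)) (n : M.El Ty.nat) : P n :=
  induction_df hP h0 (fun n hn => by rw [suc_eq_add_one]; exact hs n hn) n

theorem eq_zero_or_eq_add_one (n : M.El Ty.nat) : n = 0 ∨ ∃ m, n = m + 1 := by
  simpa only [suc_eq_add_one] using eq_zero_or_eq_suc n

theorem eq_zero_of_add_eq_zero {m n : M.El Ty.nat} (h : m + n = 0) : m = 0 := by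
  rcases eq_zero_or_eq_add_one m with hm | ⟨m, rfl⟩
  · exact hm
  · rw [add_right_comm] at h
    exact absurd h (add_one_ne_zero _)

theorem exists_add_eq (m n : M.El Ty.nat) : (∃ k, m + k = n) ∨ ∃ k, n + k = m := by
  refine induction_add_one (P := fun n => (∃ k, m + k = n) ∨ ∃ k, n + k = m) (by fun_prop)
    (Or.inr ⟨m, zero_add m⟩) (fun n h => ?_) n
  rcases h with ⟨k, rfl⟩ | ⟨k, rfl⟩
  · exact Or.inl ⟨k + 1, (add_assoc _ _ _).symm⟩
  · rcases eq_zero_or_eq_add_one k with rfl | ⟨k, rfl⟩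
    · exact Or.inl ⟨1, by rw [add_zero]⟩
    · exact Or.inr ⟨k, by ring⟩

instance : LE (M.El Ty.nat) := ⟨fun m n => ∃ k, m + k = n⟩

omit [M.ACA] in
theorem le_def {m n : M.El Ty.nat} : m ≤ n ↔ ∃ k, m + k = n := Iff.rfl

open Classical in
noncomputable instance : LinearOrder (M.El Ty.nat) where
  le_refl n := ⟨0, add_zero n⟩
  le_trans := by
    rintro k _ _ ⟨a, rfl⟩ ⟨b, rfl⟩
    exact ⟨a + b, (add_assoc _ _ _).symm⟩
  le_antisymm := by
    rintro m _ ⟨a, rfl⟩ ⟨b, hb⟩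
    rw [add_assoc, add_eq_left] at hb
    rw [eq_zero_of_add_eq_zero hb, add_zero]
  le_total := exists_add_eq
  toDecidableLE := inferInstance

instance : IsOrderedCancelAddMonoid (M.El Ty.nat) where
  add_le_add_left := by
    rintro m _ ⟨a, rfl⟩ k
    exact ⟨a, by ring⟩
  le_of_add_le_add_left := by
    rintro k m n ⟨a, ha⟩
    exact ⟨a, add_left_cancel (a := k) (by rw [← ha]; ring)⟩

theorem zero_le' (n : M.El Ty.nat) : 0 ≤ n := ⟨n, zero_add n⟩

theorem lt_iff_exists_add_one {m n : M.El Ty.nat} : m < n ↔ ∃ k, m + k + 1 = n := by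
  constructor
  · intro h
    obtain ⟨k, rfl⟩ := h.le
    rcases eq_zero_or_eq_add_one k with rfl | ⟨k, rfl⟩
    · simp at h
    · exact ⟨k, by ring⟩
  · rintro ⟨k, rfl⟩
    refine lt_of_le_of_ne ⟨k + 1, by ring⟩ fun h => add_one_ne_zero k ?_
    rw [add_assoc, left_eq_add] at h
    exact h

theorem lt_iff_add_one_le {m n : M.El Ty.nat} : m < n ↔ m + 1 ≤ n := by
  rw [lt_iff_exists_add_one, le_def]
  simp only [add_right_comm]

theorem mul_lt_mul_left_aux {k m n : M.El Ty.nat} (hk : 0 < k) (h : m < n) : k * m < k * n := by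
  obtain ⟨j, rfl⟩ := lt_iff_exists_add_one.1 h
  obtain ⟨i, rfl⟩ := lt_iff_exists_add_one.1 hk
  -- Here `k = i + 1` and `n = m + j + 1`, and `(i + 1)(j + 1) = (i j + i + j) + 1`.
  exact lt_iff_exists_add_one.2 ⟨i * j + i + j, by ring⟩

instance : IsStrictOrderedRing (M.El Ty.nat) where
  zero_le_one := zero_le' 1
  exists_pair_ne := ⟨0, 1, one_ne_zero_aux.symm⟩
  mul_lt_mul_of_pos_left _ hk _ _ h := mul_lt_mul_left_aux hk h
  mul_lt_mul_of_pos_right k hk _ _ h := by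
    simpa only [mul_comm _ k] using mul_lt_mul_left_aux hk h

instance : CanonicallyOrderedAdd (M.El Ty.nat) where
  exists_add_of_le := fun ⟨k, hk⟩ => ⟨k, hk.symm⟩
  le_add_self _ n := ⟨n, add_comm _ n⟩
  le_self_add _ n := ⟨n, rfl⟩

@[fun_prop]
theorem Df.le {A : Type} [Plots M A] {f g : A → M.El Ty.nat} (hf : Df M f) (hg : Df M g) :
    Df M fun a => f a ≤ g a := by
  simp only [le_def]
  fun_prop

end Arithmetic

end Str
end HOA

/-! ### The ordered field of fractions of an ordered semiring -/

namespace HOA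

section Fractions

variable (N : Type) [CommSemiring N] [LinearOrder N] [IsStrictOrderedRing N]

/-- Pairs `(a, b)` up to `a - b = c - d`. -/
def diffSetoid : Setoid (N × N) where
  r p q := p.1 + q.2 = q.1 + p.2
  iseqv := ⟨fun _ => rfl, fun h => h.symm, fun {p q r} h h' => by grind⟩

/-- The ring of differences. -/
def Diff : Type := Quotient (diffSetoid N)

variable {N}

def Diff.mk (a b : N) : Diff N := Quotient.mk (diffSetoid N) (a, b)

theorem Diff.mk_eq {a b c d : N} : Diff.mk a b = Diff.mk c d ↔ a + d = c + b :=
  ⟨fun h => Quotient.exact h, fun h => Quotient.sound h⟩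

theorem Diff.ind {P : Diff N → Prop} (h : ∀ a b, P (Diff.mk a b)) (z : Diff N) : P z :=
  Quotient.ind (fun p => h p.1 p.2) z

instance : Zero (Diff N) := ⟨Diff.mk 0 0⟩
instance : One (Diff N) := ⟨Diff.mk 1 0⟩
instance : Neg (Diff N) := ⟨Quotient.map (fun p => (p.2, p.1)) fun p q (h : _ = _) => by
  change _ = _; grind⟩
instance : Add (Diff N) := ⟨Quotient.map₂ (fun p q => (p.1 + q.1, p.2 + q.2))
  fun p q (h : _ = _) p' q' (h' : _ = _) => by change _ = _; grind⟩
instance : Mul (Diff N) := ⟨Quotient.map₂ (fun p q => (p.1 * q.1 + p.2 * q.2, p.1 * q.2 + p.2 * q.1))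
  fun p q (h : _ = _) p' q' (h' : _ = _) => by change _ = _; grind⟩

theorem Diff.zero_def : (0 : Diff N) = Diff.mk 0 0 := rfl
theorem Diff.one_def : (1 : Diff N) = Diff.mk 1 0 := rfl
theorem Diff.neg_mk (a b : N) : -Diff.mk a b = Diff.mk b a := rfl
theorem Diff.add_mk (a b c d : N) : Diff.mk a b + Diff.mk c d = Diff.mk (a + c) (b + d) := rfl
theorem Diff.mul_mk (a b c d : N) :
    Diff.mk a b * Diff.mk c d = Diff.mk (a * c + b * d) (a * d + b * c) := rfl

instance : CommRing (Diff N) where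
  add_assoc x y z := by
    induction x using Diff.ind; induction y using Diff.ind; induction z using Diff.ind
    simp only [Diff.add_mk, Diff.mk_eq]; ring
  zero_add x := by
    induction x using Diff.ind
    simp only [Diff.zero_def, Diff.add_mk, Diff.mk_eq]; ring
  add_zero x := by
    induction x using Diff.ind
    simp only [Diff.zero_def, Diff.add_mk, Diff.mk_eq]; ring
  add_comm x y := by
    induction x using Diff.ind; induction y using Diff.ind
    simp only [Diff.add_mk, Diff.mk_eq]; ring
  neg_add_cancel x := by
    induction x using Diff.ind
    simp only [Diff.zero_def, Diff.neg_mk, Diff.add_mk, Diff.mk_eq]; ring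
  mul_assoc x y z := by
    induction x using Diff.ind; induction y using Diff.ind; induction z using Diff.ind
    simp only [Diff.mul_mk, Diff.mk_eq]; ring
  mul_comm x y := by
    induction x using Diff.ind; induction y using Diff.ind
    simp only [Diff.mul_mk, Diff.mk_eq]; ring
  one_mul x := by
    induction x using Diff.ind
    simp only [Diff.one_def, Diff.mul_mk, Diff.mk_eq]; ring
  mul_one x := by
    induction x using Diff.ind
    simp only [Diff.one_def, Diff.mul_mk, Diff.mk_eq]; ring
  zero_mul x := by
    induction x using Diff.ind
    simp only [Diff.zero_def, Diff.mul_mk, Diff.mk_eq]; ring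
  mul_zero x := by
    induction x using Diff.ind
    simp only [Diff.zero_def, Diff.mul_mk, Diff.mk_eq]; ring
  left_distrib x y z := by
    induction x using Diff.ind; induction y using Diff.ind; induction z using Diff.ind
    simp only [Diff.mul_mk, Diff.add_mk, Diff.mk_eq]; ring
  right_distrib x y z := by
    induction x using Diff.ind; induction y using Diff.ind; induction z using Diff.ind
    simp only [Diff.mul_mk, Diff.add_mk, Diff.mk_eq]; ring
  nsmul := nsmulRec
  zsmul := zsmulRec

/-- The embedding of the semiring. -/
def Diff.of : N →+* Diff N where
  toFun a := Diff.mk a 0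
  map_zero' := rfl
  map_one' := rfl
  map_add' a b := by simp only [Diff.add_mk, Diff.mk_eq]; ring
  map_mul' a b := by simp only [Diff.mul_mk, Diff.mk_eq]; ring

theorem Diff.of_injective : Function.Injective (Diff.of (N := N)) := fun a b h => by
  have := Diff.mk_eq.1 h
  simpa using this

variable [CanonicallyOrderedAdd N]

/-- Of two elements of `N` one is the other plus something, so a difference is an element of `N` up
to sign. Absence of zero divisors is thereby inherited from `N`. -/
theorem Diff.eq_of_or (z : Diff N) : ∃ n : N, z = Diff.of n ∨ z = -Diff.of n := by
  induction z using Diff.ind with | _ a b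
  rcases le_total a b with h | h <;> obtain ⟨c, rfl⟩ := exists_add_of_le h
  · exact ⟨c, Or.inr (Diff.mk_eq.2 (by ring))⟩
  · exact ⟨c, Or.inl (Diff.mk_eq.2 (by ring))⟩

instance : IsDomain (Diff N) :=
  have : Nontrivial (Diff N) := Diff.of_injective.nontrivial
  have : NoZeroDivisors (Diff N) := ⟨fun {z w} h => by
    obtain ⟨m, hm⟩ := z.eq_of_or
    obtain ⟨n, hn⟩ := w.eq_of_or
    have h' : Diff.of (m * n) = 0 := by
      rw [map_mul]
      rcases hm with rfl | rfl <;> rcases hn with rfl | rfl <;> simpa using h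
    have h'' : m * n = 0 := Diff.of_injective (h'.trans (map_zero _).symm)
    rcases mul_eq_zero.1 h'' with rfl | rfl
    · left; rcases hm with rfl | rfl <;> simp
    · right; rcases hn with rfl | rfl <;> simp⟩
  NoZeroDivisors.to_isDomain _

variable (N) in
/-- The field of fractions. -/
abbrev Frac : Type := FractionRing (Diff N)

/-- The embedding of the semiring into its field of fractions. -/
noncomputable def Frac.of : N →+* Frac N := (algebraMap (Diff N) (Frac N)).comp Diff.of

omit [CanonicallyOrderedAdd N] in
theorem Frac.of_injective : Function.Injective (Frac.of (N := N)) :=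
  (IsFractionRing.injective (Diff N) (Frac N)).comp Diff.of_injective

omit [CanonicallyOrderedAdd N] in
theorem Frac.of_eq_zero {a : N} : Frac.of a = 0 ↔ a = 0 :=
  map_eq_zero_iff _ Frac.of_injective

theorem Frac.eq_or (x : Frac N) : ∃ a b : N, b ≠ 0 ∧
    (x = Frac.of a / Frac.of b ∨ x = -(Frac.of a / Frac.of b)) := by
  obtain ⟨z, w, hw, rfl⟩ := IsFractionRing.div_surjective (A := Diff N) x
  obtain ⟨a, ha⟩ := z.eq_of_or
  obtain ⟨b, hb⟩ := w.eq_of_or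
  refine ⟨a, b, ?_, ?_⟩
  · rintro rfl
    have : w = 0 := by rcases hb with rfl | rfl <;> simp
    exact nonZeroDivisors.ne_zero hw this
  · rcases ha with rfl | rfl <;> rcases hb with rfl | rfl <;>
      simp [Frac.of, neg_div, div_neg]

variable (N) in
/-- The cone of nonnegative fractions. -/
noncomputable def Frac.cone : RingCone (Frac N) where
  carrier := {x | ∃ a b : N, b ≠ 0 ∧ x = Frac.of a / Frac.of b}
  zero_mem' := ⟨0, 1, one_ne_zero, by simp⟩
  one_mem' := ⟨1, 1, one_ne_zero, by simp⟩
  add_mem' := by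
    rintro _ _ ⟨a, b, hb, rfl⟩ ⟨c, d, hd, rfl⟩
    have hb' := mt Frac.of_eq_zero.1 hb
    have hd' := mt Frac.of_eq_zero.1 hd
    refine ⟨a * d + b * c, b * d, mul_ne_zero hb hd, ?_⟩
    simp only [map_add, map_mul]
    field_simp
  mul_mem' := by
    rintro _ _ ⟨a, b, hb, rfl⟩ ⟨c, d, hd, rfl⟩
    refine ⟨a * c, b * d, mul_ne_zero hb hd, ?_⟩
    simp only [map_mul, div_mul_div_comm]
  eq_zero_of_mem_of_neg_mem' := by
    rintro _ ⟨a, b, hb, rfl⟩ ⟨c, d, hd, h⟩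
    have hb' := mt Frac.of_eq_zero.1 hb
    have hd' := mt Frac.of_eq_zero.1 hd
    -- From `x = a / b` and `-x = c / d` it follows that `a d + b c = 0`. A sum in `N` vanishes only
    -- if both terms do, and `d ≠ 0` leaves `a = 0`.
    have h' : Frac.of (a * d + b * c) = 0 := by
      simp only [map_add, map_mul]
      field_simp at h
      linear_combination -h
    rw [Frac.of_eq_zero] at h'
    have : a * d = 0 := (add_eq_zero.1 h').1
    rcases mul_eq_zero.1 this with rfl | rfl
    · simp
    · exact absurd rfl hd

open Classical in
noncomputable instance : LinearOrder (Frac N) :=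
  have : HasMemOrNegMem (Frac.cone N) := ⟨fun x => by
    obtain ⟨a, b, hb, rfl | rfl⟩ := Frac.eq_or x
    · exact Or.inl ⟨a, b, hb, rfl⟩
    · exact Or.inr ⟨a, b, hb, by simp⟩⟩
  LinearOrder.mkOfAddGroupCone (Frac.cone N)

instance : IsOrderedRing (Frac N) := IsOrderedRing.mkOfCone (Frac.cone N)

instance : IsStrictOrderedRing (Frac N) := IsOrderedRing.toIsStrictOrderedRing _

theorem Frac.of_nonneg (a : N) : 0 ≤ Frac.of a := by
  change Frac.of a - 0 ∈ Frac.cone N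
  exact ⟨a, 1, one_ne_zero, by simp⟩

theorem Frac.of_strictMono : StrictMono (Frac.of (N := N)) := by
  refine Monotone.strictMono_of_injective (fun a b h => ?_) Frac.of_injective
  obtain ⟨c, rfl⟩ := exists_add_of_le h
  rw [map_add]
  exact le_add_of_nonneg_right (Frac.of_nonneg c)

theorem Frac.of_le {a b : N} : Frac.of a ≤ Frac.of b ↔ a ≤ b := Frac.of_strictMono.le_iff_le

theorem Frac.of_lt {a b : N} : Frac.of a < Frac.of b ↔ a < b := Frac.of_strictMono.lt_iff_lt

theorem Frac.of_pos {a : N} : 0 < Frac.of a ↔ 0 < a := by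
  simpa only [map_zero] using Frac.of_lt (a := 0) (b := a)

end Fractions

end HOA

namespace HOA
namespace Str

/-! ### Powers of two and codes of rational numbers -/

section Codes

variable {M : Str}

/-- `2 ^ n`. -/
def p2 (n : M.El Ty.nat) : M.El Ty.nat :=
  M.con Con.recursor (M.con (Con.pi _ Ty.nat) (M.con Con.mul (suc (1 : M.El Ty.nat))))
    (1 : M.El Ty.nat) n

theorem eval_pow2 (e : M.Asg) (t : Tm Ty.nat) : eval e (pow2 t) = p2 (eval e t) := rfl

def IsPair (q a b : M.El Ty.nat) : Prop := suc 1 * q = (a + b) * suc (a + b) + suc 1 * b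

theorem sat_isPair (e : M.Asg) (q a b : Tm Ty.nat) :
    Sat e (isPair q a b) ↔ IsPair (eval e q) (eval e a) (eval e b) := Iff.rfl

def IsRat (q a b c : M.El Ty.nat) : Prop := ∃ p, IsPair p a b ∧ IsPair q p c

theorem sat_isRat (e : M.Asg) (q a b c : Tm Ty.nat) :
    Sat e (isRat q a b c) ↔ IsRat (eval e q) (eval e a) (eval e b) (eval e c) := by
  simp only [isRat, sat_ex, sat_and, sat_isPair, eval_wk, eval_var, Asg.cons_self_zero, IsRat]

theorem sat_le (e : M.Asg) (t u : Tm Ty.nat) :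
    Sat e (le t u) ↔ ∃ z, eval e t + z = eval e u := by
  simp only [HOA.le, sat_ex, sat_eq, eval_add, eval_wk, eval_var, Asg.cons_self_zero]

def LeRat (q q' r k : M.El Ty.nat) : Prop :=
  ∃ a b c a' b' c', IsRat q a b c ∧ IsRat q' a' b' c' ∧
    ∃ z, (a * suc c' + b' * suc c) * p2 k + z =
      (a' * suc c + b * suc c') * p2 k + r * (suc c * suc c')

theorem sat_leRat (e : M.Asg) (q q' r k : Tm Ty.nat) :
    Sat e (leRat q q' r k) ↔ LeRat (eval e q) (eval e q') (eval e r) (eval e k) := by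
  simp only [leRat, sat_ex, sat_and, sat_isRat, sat_le, wk6, eval_wk, eval_var, Asg.cons_self_zero,
    Asg.cons_self_succ, LeRat, eval_add, eval_mul, eval_succ, eval_pow2]

variable [M.ACA]

theorem suc_one_eq : suc (1 : M.El Ty.nat) = 2 := by
  rw [suc_eq_add_one, one_add_one_eq_two]

@[fun_prop]
theorem Df.p2 {A : Type} [Plots M A] {f : A → M.El Ty.nat} (hf : Df M f) :
    Df M fun a => p2 (f a) := by
  unfold Str.p2
  fun_prop

@[fun_prop]
theorem Df.isPair {A : Type} [Plots M A] {q a b : A → M.El Ty.nat} (hq : Df M q) (ha : Df M a)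
    (hb : Df M b) : Df M fun x => IsPair (q x) (a x) (b x) := by
  unfold Str.IsPair
  fun_prop

@[fun_prop]
theorem Df.isRat {A : Type} [Plots M A] {q a b c : A → M.El Ty.nat} (hq : Df M q) (ha : Df M a)
    (hb : Df M b) (hc : Df M c) : Df M fun x => IsRat (q x) (a x) (b x) (c x) := by
  have : Df M fun p : M.El Ty.nat × M.El Ty.nat × M.El Ty.nat × M.El Ty.nat =>
      IsRat p.1 p.2.1 p.2.2.1 p.2.2.2 := by
    unfold Str.IsRat
    fun_prop
  exact this.comp (hq.prodMk (ha.prodMk (hb.prodMk hc)))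

@[fun_prop]
theorem Df.leRat {A : Type} [Plots M A] {q q' r k : A → M.El Ty.nat} (hq : Df M q) (hq' : Df M q')
    (hr : Df M r) (hk : Df M k) : Df M fun x => LeRat (q x) (q' x) (r x) (k x) := by
  have : Df M fun p : M.El Ty.nat × M.El Ty.nat × M.El Ty.nat × M.El Ty.nat =>
      LeRat p.1 p.2.1 p.2.2.1 p.2.2.2 := by
    unfold Str.LeRat
    fun_prop
  exact this.comp (hq.prodMk (hq'.prodMk (hr.prodMk hk)))

theorem p2_zero : p2 (0 : M.El Ty.nat) = 1 := ACA.recursor_zero _ _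

theorem p2_add_one (n : M.El Ty.nat) : p2 (n + 1) = 2 * p2 n := by
  rw [← suc_eq_add_one, ← suc_one_eq, p2, ACA.recursor_suc, ACA.pi]
  rfl

theorem p2_add (m n : M.El Ty.nat) : p2 (m + n) = p2 m * p2 n :=
  induction_add_one (P := fun n => p2 (m + n) = p2 m * p2 n) (by fun_prop)
    (by rw [add_zero, p2_zero, mul_one])
    (fun n h => by rw [← add_assoc, p2_add_one, h, p2_add_one]; ring) n

theorem lt_p2 (n : M.El Ty.nat) : n < p2 n := by
  rw [lt_iff_add_one_le]
  refine induction_add_one (P := fun n => n + 1 ≤ p2 n) (by fun_prop) ?_ (fun n h => ?_) n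
  · rw [p2_zero, zero_add]
  · rw [p2_add_one, two_mul]
    exact add_le_add h (le_trans (le_add_self) h)

theorem p2_pos (n : M.El Ty.nat) : 0 < p2 n := lt_of_le_of_lt (zero_le' n) (lt_p2 n)

theorem isPair_iff {q a b : M.El Ty.nat} :
    IsPair q a b ↔ 2 * q = (a + b) * (a + b + 1) + 2 * b := by
  rw [IsPair, suc_one_eq, suc_eq_add_one]

/-- Induction along the diagonals: the pair after `(a + 1, b)` is `(a, b + 1)`, and the pair after
`(0, b)` is `(b + 1, 0)`. -/
theorem exists_isPair (q : M.El Ty.nat) : ∃ a b, IsPair q a b := by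
  refine induction_add_one (P := fun q => ∃ a b, IsPair q a b) (by fun_prop)
    ⟨0, 0, by rw [isPair_iff]; ring⟩ (fun q h => ?_) q
  obtain ⟨a, b, h⟩ := h
  rw [isPair_iff] at h
  rcases eq_zero_or_eq_add_one a with rfl | ⟨a, rfl⟩
  · refine ⟨b + 1, 0, isPair_iff.2 ?_⟩
    rw [mul_add, h]
    ring
  · refine ⟨a, b + 1, isPair_iff.2 ?_⟩
    rw [mul_add, h]
    ring

theorem exists_pair_code (a b : M.El Ty.nat) : ∃ q, IsPair q a b := by
  -- The code is obtained by halving, which requires `s (s + 1)` to be even.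
  have h : ∀ s : M.El Ty.nat, ∃ t, s * (s + 1) = 2 * t := fun s =>
    induction_add_one (P := fun s => ∃ t, s * (s + 1) = 2 * t) (by fun_prop) ⟨0, by ring⟩
      (fun s ⟨t, h⟩ => ⟨t + s + 1, by
        have : (s + 1) * (s + 1 + 1) = s * (s + 1) + 2 * (s + 1) := by ring
        rw [this, h]; ring⟩) s
  obtain ⟨t, ht⟩ := h (a + b)
  exact ⟨t + b, isPair_iff.2 (by rw [ht]; ring)⟩

/-- With `s = a + b` one has `s (s + 1) ≤ 2 q < (s + 1) (s + 2)`, so `q` determines the diagonal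
`s`, then `b`, then `a`. -/
theorem IsPair.unique {q a b a' b' : M.El Ty.nat} (h : IsPair q a b) (h' : IsPair q a' b') :
    a = a' ∧ b = b' := by
  rw [isPair_iff] at h h'
  have key : ∀ {a b a' b' : M.El Ty.nat}, 2 * q = (a + b) * (a + b + 1) + 2 * b →
      2 * q = (a' + b') * (a' + b' + 1) + 2 * b' → ¬ a + b < a' + b' := by
    intro a b a' b' h h' hlt
    obtain ⟨k, hk⟩ := lt_iff_exists_add_one.1 hlt
    rw [← hk, h] at h'
    have : (a + b) * (a + b + 1) + 2 * b < (a + b + k + 1) * (a + b + k + 1 + 1) + 2 * b' := by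
      refine lt_iff_exists_add_one.2 ⟨2 * a + 1 + (2 * (a + b) + 3) * k + k * k + 2 * b', by ring⟩
    exact this.ne h'
  have hs : a + b = a' + b' := le_antisymm (not_lt.1 (key h' h)) (not_lt.1 (key h h'))
  rw [← hs, h] at h'
  have hb : b = b' := mul_left_cancel₀ two_ne_zero (add_left_cancel h')
  subst hb
  exact ⟨add_right_cancel hs, rfl⟩

theorem exists_isRat (q : M.El Ty.nat) : ∃ a b c, IsRat q a b c := by
  obtain ⟨p, c, h⟩ := exists_isPair q
  obtain ⟨a, b, h'⟩ := exists_isPair p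
  exact ⟨a, b, c, p, h', h⟩

theorem exists_rat_code (a b c : M.El Ty.nat) : ∃ q, IsRat q a b c := by
  obtain ⟨p, h⟩ := exists_pair_code a b
  obtain ⟨q, h'⟩ := exists_pair_code p c
  exact ⟨q, p, h, h'⟩

theorem IsRat.unique {q a b c a' b' c' : M.El Ty.nat} (h : IsRat q a b c)
    (h' : IsRat q a' b' c') : a = a' ∧ b = b' ∧ c = c' := by
  obtain ⟨p, h1, h2⟩ := h
  obtain ⟨p', h1', h2'⟩ := h'
  obtain ⟨rfl, rfl⟩ := h2.unique h2'
  obtain ⟨rfl, rfl⟩ := h1.unique h1'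
  exact ⟨rfl, rfl, rfl⟩

/-- The numbers of the structure as elements of the field of fractions. -/
noncomputable def num (n : M.El Ty.nat) : Frac (M.El Ty.nat) := Frac.of n

theorem num_zero : num (0 : M.El Ty.nat) = 0 := map_zero _
theorem num_one : num (1 : M.El Ty.nat) = 1 := map_one _
theorem num_two : num (2 : M.El Ty.nat) = 2 := map_ofNat Frac.of 2
theorem num_four : num (4 : M.El Ty.nat) = 4 := map_ofNat Frac.of 4
theorem num_add (m n : M.El Ty.nat) : num (m + n) = num m + num n := map_add _ _ _
theorem num_mul (m n : M.El Ty.nat) : num (m * n) = num m * num n := map_mul _ _ _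
theorem num_suc (n : M.El Ty.nat) : num (suc n) = num n + 1 := by
  rw [suc_eq_add_one, num_add, num_one]
theorem num_nonneg (n : M.El Ty.nat) : 0 ≤ num n := Frac.of_nonneg n
theorem num_le {m n : M.El Ty.nat} : num m ≤ num n ↔ m ≤ n := Frac.of_le
theorem num_lt {m n : M.El Ty.nat} : num m < num n ↔ m < n := Frac.of_lt
theorem num_succ_pos (n : M.El Ty.nat) : 0 < num n + 1 := by
  have := num_nonneg n
  linarith

theorem exists_val (q : M.El Ty.nat) : ∃ x : Frac (M.El Ty.nat), ∀ a b c, IsRat q a b c →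
    x = (num a - num b) / (num c + 1) := by
  obtain ⟨a, b, c, h⟩ := exists_isRat q
  refine ⟨(num a - num b) / (num c + 1), fun a' b' c' h' => ?_⟩
  obtain ⟨rfl, rfl, rfl⟩ := h.unique h'
  rfl

/-- The value of the code of a rational number. -/
noncomputable def val (q : M.El Ty.nat) : Frac (M.El Ty.nat) := (exists_val q).choose

theorem IsRat.val_eq {q a b c : M.El Ty.nat} (h : IsRat q a b c) :
    val q = (num a - num b) / (num c + 1) := (exists_val q).choose_spec a b c h

theorem val_zero : val (0 : M.El Ty.nat) = 0 := by
  have : IsRat (0 : M.El Ty.nat) 0 0 0 := ⟨0, isPair_iff.2 (by ring), isPair_iff.2 (by ring)⟩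
  rw [this.val_eq, sub_self, zero_div]

theorem val_one : val (1 : M.El Ty.nat) = 1 := by
  have : IsRat (1 : M.El Ty.nat) 1 0 0 := ⟨1, isPair_iff.2 (by ring), isPair_iff.2 (by ring)⟩
  rw [this.val_eq, num_one, num_zero]
  norm_num

/-- Lets a quantifier over fractions be replaced by one over codes, which is a number quantifier and
so preserves definability. -/
theorem exists_val_eq (x : Frac (M.El Ty.nat)) : ∃ q, val q = x := by
  obtain ⟨a, b, hb, h⟩ := Frac.eq_or x
  obtain ⟨c, rfl⟩ := (eq_zero_or_eq_add_one b).resolve_left hb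
  rcases h with rfl | rfl
  · obtain ⟨q, hq⟩ := exists_rat_code a 0 c
    refine ⟨q, ?_⟩
    rw [hq.val_eq, num_zero, sub_zero, map_add, map_one]
    rfl
  · obtain ⟨q, hq⟩ := exists_rat_code 0 a c
    refine ⟨q, ?_⟩
    rw [hq.val_eq, num_zero, zero_sub, map_add, map_one, neg_div]
    rfl

/-- `2 ^ (-k)`. -/
noncomputable def del (k : M.El Ty.nat) : Frac (M.El Ty.nat) := 1 / num (p2 k)

theorem num_p2_pos (k : M.El Ty.nat) : 0 < num (p2 k) := Frac.of_pos.2 (p2_pos k)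

theorem del_pos (k : M.El Ty.nat) : 0 < del k := one_div_pos.2 (num_p2_pos k)

theorem leRat_iff {q q' r k : M.El Ty.nat} : LeRat q q' r k ↔ val q ≤ val q' + num r * del k := by
  have key : ∀ {a b c a' b' c' : M.El Ty.nat}, IsRat q a b c → IsRat q' a' b' c' →
      ((∃ z, (a * suc c' + b' * suc c) * p2 k + z =
        (a' * suc c + b * suc c') * p2 k + r * (suc c * suc c')) ↔
        val q ≤ val q' + num r * del k) := by
    intro a b c a' b' c' h h'
    have hc := num_succ_pos c
    have hc' := num_succ_pos c'
    have hk := num_p2_pos k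
    rw [← le_def, ← num_le, h.val_eq, h'.val_eq, del, ← sub_nonneg, ← sub_nonneg (a := _ + _)]
    simp only [num_add, num_mul, num_suc]
    have : (num a' - num b') / (num c' + 1) + num r * (1 / num (p2 k)) -
        (num a - num b) / (num c + 1) =
        ((num a' * (num c + 1) + num b * (num c' + 1)) * num (p2 k) +
          num r * ((num c + 1) * (num c' + 1)) -
          (num a * (num c' + 1) + num b' * (num c + 1)) * num (p2 k)) /
          ((num c + 1) * (num c' + 1) * num (p2 k)) := by
      field_simp
      ring
    rw [this, le_div_iff₀ (by positivity), zero_mul]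
  constructor
  · rintro ⟨a, b, c, a', b', c', h, h', hz⟩
    exact (key h h').1 hz
  · intro hle
    obtain ⟨a, b, c, h⟩ := exists_isRat q
    obtain ⟨a', b', c', h'⟩ := exists_isRat q'
    exact ⟨a, b, c, a', b', c', h, h', (key h h').2 hle⟩

theorem del_add_one (k : M.El Ty.nat) : del k = 2 * del (k + 1) := by
  have := num_p2_pos k
  rw [del, del, p2_add_one, num_mul, num_two]
  field_simp

theorem del_anti {m n : M.El Ty.nat} (h : m ≤ n) : del n ≤ del m := by
  obtain ⟨k, rfl⟩ := h
  refine one_div_le_one_div_of_le (num_p2_pos m) (num_le.2 ?_)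
  rw [p2_add]
  exact le_mul_of_one_le_right (zero_le' _)
    (by rw [← zero_add (1 : M.El Ty.nat), ← lt_iff_add_one_le]; exact p2_pos k)

/-- The field need not be Archimedean over the true natural numbers, but it is so over the numbers
of `M`, since the denominator of a fraction is at least `1`. -/
theorem exists_lt_num (x : Frac (M.El Ty.nat)) : ∃ n, x < num n := by
  obtain ⟨a, b, hb, h⟩ := Frac.eq_or x
  obtain ⟨c, rfl⟩ := (eq_zero_or_eq_add_one b).resolve_left hb
  have hc : (1 : Frac (M.El Ty.nat)) ≤ Frac.of (c + 1) := by
    rw [map_add, map_one]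
    exact le_add_of_nonneg_left (Frac.of_nonneg c)
  have h0 : 0 ≤ Frac.of a / Frac.of (c + 1) := div_nonneg (Frac.of_nonneg _) (Frac.of_nonneg _)
  have h1 : Frac.of a / Frac.of (c + 1) ≤ num a := div_le_self (Frac.of_nonneg a) hc
  refine ⟨a + 1, ?_⟩
  rw [num_add, num_one]
  rcases h with rfl | rfl <;> linarith

theorem exists_del_lt {ε : Frac (M.El Ty.nat)} (hε : 0 < ε) : ∃ n, del n < ε := by
  obtain ⟨n, hn⟩ := exists_lt_num (1 / ε)
  refine ⟨n, ?_⟩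
  rw [del, one_div_lt (num_p2_pos n) hε]
  exact hn.trans (num_lt.2 (lt_p2 n))

/-- Passage to the limit. The factor `c` and the threshold `m` allow accumulated errors and
comparison at late indices only. -/
theorem le_of_forall_del {a b c : Frac (M.El Ty.nat)} (hc : 0 < c) (m : M.El Ty.nat)
    (h : ∀ n, m ≤ n → a ≤ b + c * del n) : a ≤ b := by
  by_contra hab
  obtain ⟨n, hn⟩ := exists_del_lt (div_pos (sub_pos.2 (not_le.1 hab)) hc)
  have h1 := h (max m n) (le_max_left _ _)
  have h2 := (del_anti (le_max_right m n)).trans_lt hn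
  rw [lt_div_iff₀ hc] at h2
  linarith

end Codes

end Str
end HOA

namespace HOA
namespace Str

/-! ### Real numbers -/

section Reals

variable {M : Str}

def IsReal (x : M.El Ty.one) : Prop :=
  ∀ k i : M.El Ty.nat, LeRat (x k) (x (k + i)) 1 k ∧ LeRat (x (k + i)) (x k) 1 k

def EqReal (x y : M.El Ty.one) : Prop :=
  ∀ k : M.El Ty.nat, LeRat (x k) (y k) (suc 1) k ∧ LeRat (y k) (x k) (suc 1) k

def LeReal (x y : M.El Ty.one) : Prop :=
  ∀ k : M.El Ty.nat, LeRat (x k) (y k) (suc 1) k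

theorem sat_isReal (e : M.Asg) (t : Tm Ty.one) : Sat e (isReal t) ↔ IsReal (eval e t) := by
  simp only [isReal, closeRat, sat_all, sat_and, sat_leRat, eval_app, eval_add, eval_wk, eval_var,
    eval_one, Asg.cons_self_zero, Asg.cons_self_succ, IsReal]

theorem sat_eqReal (e : M.Asg) (t u : Tm Ty.one) :
    Sat e (eqReal t u) ↔ EqReal (eval e t) (eval e u) := by
  simp only [eqReal, closeRat, sat_all, sat_and, sat_leRat, eval_app, eval_wk, eval_var,
    eval_two, Asg.cons_self_zero, EqReal]

theorem sat_leReal (e : M.Asg) (t u : Tm Ty.one) :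
    Sat e (leReal t u) ↔ LeReal (eval e t) (eval e u) := by
  simp only [leReal, sat_all, sat_leRat, eval_app, eval_wk, eval_var,
    eval_two, Asg.cons_self_zero, LeReal]

variable [M.ACA] {A : Type} [Plots M A]

@[fun_prop]
theorem Df.isReal {x : A → M.El Ty.one} (hx : Df M x) : Df M fun a => IsReal (x a) := by
  unfold Str.IsReal
  refine Df.forall (Df.forall ?_)
  fun_prop

@[fun_prop]
theorem Df.eqReal {x y : A → M.El Ty.one} (hx : Df M x) (hy : Df M y) :
    Df M fun a => EqReal (x a) (y a) := by
  unfold Str.EqReal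
  refine Df.forall ?_
  fun_prop

@[fun_prop]
theorem Df.leReal {x y : A → M.El Ty.one} (hx : Df M x) (hy : Df M y) :
    Df M fun a => LeReal (x a) (y a) := by
  unfold Str.LeReal
  refine Df.forall ?_
  fun_prop

/-- `r ≤ x`. -/
def Below (r : Frac (M.El Ty.nat)) (x : M.El Ty.one) : Prop :=
  ∀ k : M.El Ty.nat, r ≤ val (x k) + del k

/-- `q ≤ x` for a code `q`. -/
def BelowCode (q : M.El Ty.nat) (x : M.El Ty.one) : Prop :=
  ∀ k : M.El Ty.nat, LeRat q (x k) 1 k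

theorem belowCode_iff {q : M.El Ty.nat} {x : M.El Ty.one} : BelowCode q x ↔ Below (val q) x := by
  simp only [BelowCode, leRat_iff, num_one, one_mul, Below]

@[fun_prop]
theorem Df.belowCode {q : A → M.El Ty.nat} {x : A → M.El Ty.one} (hq : Df M q) (hx : Df M x) :
    Df M fun a => BelowCode (q a) (x a) := by
  unfold Str.BelowCode
  refine Df.forall ?_
  fun_prop

theorem isReal_iff {x : M.El Ty.one} : IsReal x ↔ ∀ k i : M.El Ty.nat,
    val (x k) ≤ val (x (k + i)) + del k ∧ val (x (k + i)) ≤ val (x k) + del k := by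
  simp only [IsReal, leRat_iff, num_one, one_mul]

theorem eqReal_iff {x y : M.El Ty.one} : EqReal x y ↔ ∀ k : M.El Ty.nat,
    val (x k) ≤ val (y k) + 2 * del k ∧ val (y k) ≤ val (x k) + 2 * del k := by
  simp only [EqReal, leRat_iff, suc_one_eq, num_two]

theorem leReal_iff {x y : M.El Ty.one} : LeReal x y ↔ ∀ k : M.El Ty.nat,
    val (x k) ≤ val (y k) + 2 * del k := by
  simp only [LeReal, leRat_iff, suc_one_eq, num_two]

theorem Below.mono {r s : Frac (M.El Ty.nat)} {x : M.El Ty.one} (h : Below r x) (hs : s ≤ r) :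
    Below s x := fun k => hs.trans (h k)

theorem IsReal.below_sub {x : M.El Ty.one} (hx : IsReal x) (m : M.El Ty.nat) :
    Below (val (x m) - del m) x := by
  intro k
  rw [isReal_iff] at hx
  rcases le_total m k with h | h <;> obtain ⟨i, rfl⟩ := h
  · have := (hx m i).1
    have := del_pos (m + i)
    linarith
  · have := (hx k i).2
    have := del_pos (k + i)
    linarith

theorem Below.of_eqReal {x y : M.El Ty.one} (hy : IsReal y) (h : EqReal x y)
    {r : Frac (M.El Ty.nat)} (hr : Below r x) : Below r y := by
  intro k
  rw [isReal_iff] at hy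
  rw [eqReal_iff] at h
  -- The comparison takes place at a late index `n`, where `Below` costs one `2 ^ (-n)` and `EqReal`
  -- costs two; returning to index `k` costs the permitted `2 ^ (-k)`.
  refine le_of_forall_del (c := 3) (by norm_num) k fun n hn => ?_
  obtain ⟨i, rfl⟩ := hn
  have h1 := hr (k + i)
  have h2 := (h (k + i)).1
  have h3 := (hy k i).2
  linarith

omit [M.ACA] in
theorem EqReal.symm {x y : M.El Ty.one} (h : EqReal x y) : EqReal y x := fun k => (h k).symm

/-- In the converse direction `x k - 2 ^ (-k)` lies below `x`, hence below `y`, and the two errors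
add up to exactly the tolerance of `EqReal`. Passing to lower cuts makes transitivity immediate. -/
theorem eqReal_iff_below {x y : M.El Ty.one} (hx : IsReal x) (hy : IsReal y) :
    EqReal x y ↔ ∀ r, Below r x ↔ Below r y := by
  constructor
  · exact fun h r => ⟨fun hr => hr.of_eqReal hy h, fun hr => hr.of_eqReal hx h.symm⟩
  · intro h
    rw [eqReal_iff]
    intro k
    have h1 := (h _).1 (hx.below_sub k) k
    have h2 := (h _).2 (hy.below_sub k) k
    constructor <;> linarith

theorem eqReal_iff_belowCode {x y : M.El Ty.one} (hx : IsReal x) (hy : IsReal y) :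
    EqReal x y ↔ ∀ q : M.El Ty.nat, BelowCode q x ↔ BelowCode q y := by
  rw [eqReal_iff_below hx hy]
  simp only [belowCode_iff]
  refine ⟨fun h q => h _, fun h r => ?_⟩
  obtain ⟨q, rfl⟩ := exists_val_eq r
  exact h q

theorem leReal_left_iff {x y : M.El Ty.one} {r : Frac (M.El Ty.nat)} (hy : ∀ k, val (y k) = r)
    (hx : IsReal x) : LeReal y x ↔ Below r x := by
  rw [leReal_iff]
  simp only [hy]
  constructor
  · intro h k
    rw [isReal_iff] at hx
    refine le_of_forall_del (c := 2) (by norm_num) k fun n hn => ?_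
    obtain ⟨i, rfl⟩ := hn
    have h1 := h (k + i)
    have h2 := (hx k i).2
    linarith
  · intro h k
    have := h k
    have := del_pos k
    linarith

theorem leReal_right_iff {x y : M.El Ty.one} {r : Frac (M.El Ty.nat)} (hy : ∀ k, val (y k) = r)
    (hx : IsReal x) : LeReal x y ↔ ∀ s, Below s x → s ≤ r := by
  rw [leReal_iff]
  simp only [hy]
  constructor
  · intro h s hs
    refine le_of_forall_del (c := 3) (by norm_num) 0 fun n _ => ?_
    have h1 := h n
    have h2 := hs n
    linarith
  · intro h k
    have := h _ (hx.below_sub k)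
    have := del_pos k
    linarith

end Reals

/-! ### Spaces and enumeration principles -/

/-- The interpretation of a space in a structure. -/
structure Sp (M : Str) where
  pt : M.El Ty.one → Prop
  same : M.El Ty.one → M.El Ty.one → Prop

namespace Sp

variable {M : Str} (X Z : Sp M)

def IsFun (Y : M.El Ty.two) : Prop := ∀ x y, X.pt x → X.pt y → X.same x y → Y x = Y y

def IsSet (A : M.El Ty.two) : Prop := X.IsFun A ∧ ∀ x, X.pt x → A x = 0 ∨ A x = 1

def InjOn (Y A : M.El Ty.two) : Prop :=
  ∀ x y, X.pt x → X.pt y → A x = 1 → A y = 1 → Y x = Y y → X.same x y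

def SurjOn (Y A : M.El Ty.two) : Prop := ∀ n, ∃ x, X.pt x ∧ A x = 1 ∧ Y x = n

def Enumerable (A : M.El Ty.two) : Prop :=
  ∃ s : M.El Ty.seq, (∀ n, X.pt (s n)) ∧ ∀ x, X.pt x → (A x = 1 ↔ ∃ n, X.same x (s n))

def Cocode₀ : Prop := ∀ A, X.IsSet A → (∃ x, X.pt x ∧ A x = 1) →
  (∃ Y, X.IsFun Y ∧ X.InjOn Y A) → X.Enumerable A

def Cocode₁ : Prop := ∀ A, X.IsSet A →
  (∃ Y, X.IsFun Y ∧ X.InjOn Y A ∧ X.SurjOn Y A) → X.Enumerable A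

/-- `X` is the interpretation of the space `S`. -/
structure Interprets (S : Space) : Prop where
  pt : ∀ (e : M.Asg) (t : Tm Ty.one), Sat e (S.pt t) ↔ X.pt (eval e t)
  same : ∀ (e : M.Asg) (t u : Tm Ty.one), Sat e (S.same t u) ↔ X.same (eval e t) (eval e u)

variable {X}

theorem Interprets.sat_cocode₀ {S : Space} (h : X.Interprets S) (e : M.Asg) :
    Sat e S.cocode₀ ↔ X.Cocode₀ := by
  simp only [Space.cocode₀, Space.isSet, Space.isFun, Space.nonempty, Space.countable, Space.injOn,
    Space.enumerable, Space.mem, sat_all, sat_imp, sat_and, sat_or, sat_ex, sat_iff, sat_eq,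
    h.pt, h.same, eval_app, eval_wk, eval_var, eval_zero, eval_one, Asg.cons_self_zero,
    Asg.cons_self_succ, Cocode₀, IsSet, IsFun, InjOn, Enumerable]
  rfl

theorem Interprets.sat_cocode₁ {S : Space} (h : X.Interprets S) (e : M.Asg) :
    Sat e S.cocode₁ ↔ X.Cocode₁ := by
  simp only [Space.cocode₁, Space.isSet, Space.isFun, Space.stronglyCountable, Space.injOn,
    Space.surjOn, Space.enumerable, Space.mem, sat_all, sat_imp, sat_and, sat_or, sat_ex, sat_iff,
    sat_eq, h.pt, h.same, eval_app, eval_wk, eval_var, eval_zero, eval_one, Asg.cons_self_zero,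
    Asg.cons_self_succ, Cocode₁, IsSet, IsFun, InjOn, SurjOn, Enumerable]
  rfl

/-! ### Transfer of the principles along definable embeddings -/

variable (X) in
/-- Sameness is an equivalence relation on the points. -/
structure IsEquiv : Prop where
  refl : ∀ x, X.pt x → X.same x x
  symm : ∀ x y, X.pt x → X.pt y → X.same x y → X.same y x
  trans : ∀ x y z, X.pt x → X.pt y → X.pt z → X.same x y → X.same y z → X.same x z

/-- A definable embedding `E` of `X` into `Z` with a definable left inverse `D` and with a
definable image. -/
structure Emb (X Z : Sp M) [M.ACA] (E D : M.El (Ty.arr Ty.one Ty.one)) : Prop where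
  pt : ∀ x, X.pt x → Z.pt (E x)
  same : ∀ x y, X.pt x → X.pt y → X.same x y → Z.same (E x) (E y)
  -- `D` is applied to every point of `Z`, on or off the image; this field and the next make the
  -- image and the functionals `Y ∘ D` respect sameness.
  inv_pt : ∀ z z', Z.pt z → Z.pt z' → Z.same z z' → X.pt (D z) → X.pt (D z')
  inv_same : ∀ z z', Z.pt z → Z.pt z' → Z.same z z' → X.pt (D z) → X.same (D z) (D z')
  left_inv_pt : ∀ x, X.pt x → X.pt (D (E x))
  left_inv : ∀ x, X.pt x → X.same (D (E x)) x
  image : Df M fun z => X.pt (D z) ∧ Z.same z (E (D z))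

section

variable [M.ACA] {Z : Sp M} {E D : M.El (Ty.arr Ty.one Ty.one)}

/-- `z` is in the image of the embedding. -/
def Img (X Z : Sp M) (E D : M.El (Ty.arr Ty.one Ty.one)) (z : M.El Ty.one) : Prop :=
  X.pt (D z) ∧ Z.same z (E (D z))

theorem Emb.img_congr (h : Emb X Z E D) (hZ : Z.IsEquiv) {z z' : M.El Ty.one}
    (hz : Z.pt z) (hz' : Z.pt z') (hs : Z.same z z') (hi : Img X Z E D z) : Img X Z E D z' := by
  have h1 := h.inv_pt z z' hz hz' hs hi.1
  have h2 := h.same _ _ hi.1 h1 (h.inv_same z z' hz hz' hs hi.1)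
  exact ⟨h1, hZ.trans _ _ _ hz' hz (h.pt _ h1) (hZ.symm _ _ hz hz' hs)
    (hZ.trans _ _ _ hz (h.pt _ hi.1) (h.pt _ h1) hi.2 h2)⟩

theorem Emb.img_apply (h : Emb X Z E D) (hX : X.IsEquiv) {x : M.El Ty.one} (hx : X.pt x) :
    Img X Z E D (E x) :=
  ⟨h.left_inv_pt x hx, h.same _ _ hx (h.left_inv_pt x hx)
    (hX.symm _ _ (h.left_inv_pt x hx) hx (h.left_inv x hx))⟩

/-- Every functional on `X` can be moved along an embedding, with value `0` off the image. -/
theorem Emb.exists_push (h : Emb X Z E D) (hZ : Z.IsEquiv) {Y : M.El Ty.two} (hY : X.IsFun Y) :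
    ∃ Y' : M.El Ty.two, Z.IsFun Y' ∧ (∀ z, Img X Z E D z → Y' z = Y (D z)) ∧
      ∀ z, ¬ Img X Z E D z → Y' z = 0 := by
  have hi : Df M fun z => Img X Z E D z := h.image
  have hc : Df M fun z => (chi (Img X Z E D z) : M.El Ty.nat) := hi.chi
  -- Definition by cases through the recursor: at `0` (in the image) the value is `Y (D z)`, at `1`
  -- (off the image) it is `0`.
  obtain ⟨Y', hY'⟩ := Df.exists_rep (M := M) (σ := Ty.one) (τ := Ty.nat)
    (f := fun z => recn (fun _ _ => 0) (M.app Y (M.app D z)) (chi (Img X Z E D z))) (by fun_prop)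
  have h1 : ∀ z, Img X Z E D z → Y' z = Y (D z) := fun z hz => by
    rw [hY', chi_eq_zero.2 hz, recn_zero]
  have h2 : ∀ z, ¬ Img X Z E D z → Y' z = 0 := fun z hz => by
    rw [hY', chi_eq_one.2 hz]
    exact recn_suc (by fun_prop) _ _
  refine ⟨Y', fun z z' hz hz' hs => ?_, h1, h2⟩
  by_cases hi : Img X Z E D z
  · have hi' := h.img_congr hZ hz hz' hs hi
    rw [h1 z hi, h1 z' hi']
    exact hY _ _ hi.1 hi'.1 (h.inv_same z z' hz hz' hs hi.1)
  · have hi' : ¬ Img X Z E D z' := fun hi' =>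
      hi (h.img_congr hZ hz' hz (hZ.symm _ _ hz hz' hs) hi')
    rw [h2 z hi, h2 z' hi']

/-- A set in `X` and its image in `Z`. -/
theorem Emb.exists_image (h : Emb X Z E D) (hX : X.IsEquiv) (hZ : Z.IsEquiv) {A : M.El Ty.two}
    (hA : X.IsSet A) : ∃ A' : M.El Ty.two, Z.IsSet A' ∧
      (∀ x, X.pt x → A x = 1 → A' (E x) = 1) ∧
      (∀ z, A' z = 1 → Img X Z E D z ∧ A (D z) = 1) ∧
      (Z.Enumerable A' → X.Enumerable A) := by
  obtain ⟨A', hf, h1, h2⟩ := h.exists_push hZ hA.1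
  have h3 : ∀ x, X.pt x → A x = 1 → A' (E x) = 1 := fun x hx hx1 => by
    rw [h1 _ (h.img_apply hX hx), hA.1 _ _ (h.left_inv_pt x hx) hx (h.left_inv x hx), hx1]
  have h4 : ∀ z, A' z = 1 → Img X Z E D z ∧ A (D z) = 1 := fun z hz => by
    by_cases hi : Img X Z E D z
    · exact ⟨hi, by rw [← h1 z hi, hz]⟩
    · rw [h2 z hi] at hz
      exact absurd hz one_ne_zero_aux.symm
  refine ⟨A', ⟨hf, fun z _ => ?_⟩, h3, h4, ?_⟩
  · by_cases hi : Img X Z E D z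
    · rw [h1 z hi]
      exact hA.2 _ hi.1
    · exact Or.inl (h2 z hi)
  -- Every term of the enumeration lies in `A'`, hence in the image, so applying `D` termwise gives
  -- points of `X` which enumerate `A`.
  · rintro ⟨s, hs, hs'⟩
    obtain ⟨s', hs2⟩ := Df.exists_rep (M := M) (σ := Ty.nat) (τ := Ty.one)
      (f := fun n => M.app D (M.app s n)) (by fun_prop)
    have h5 : ∀ n, A' (s n) = 1 := fun n => (hs' _ (hs n)).2 ⟨n, hZ.refl _ (hs n)⟩
    refine ⟨s', fun n => by rw [hs2]; exact (h4 _ (h5 n)).1.1, fun x hx => ⟨fun hx1 => ?_, ?_⟩⟩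
    · obtain ⟨n, hn⟩ := (hs' _ (h.pt x hx)).1 (h3 x hx hx1)
      refine ⟨n, ?_⟩
      rw [hs2]
      have h6 := h.left_inv_pt x hx
      exact hX.trans _ _ _ hx h6 (h4 _ (h5 n)).1.1 (hX.symm _ _ h6 hx (h.left_inv x hx))
        (h.inv_same _ _ (h.pt x hx) (hs n) hn h6)
    · rintro ⟨n, hn⟩
      rw [hs2] at hn
      rw [hA.1 _ _ hx (h4 _ (h5 n)).1.1 hn]
      exact (h4 _ (h5 n)).2

/-- The chain is `z ∼ E (D z) ∼ E (D z') ∼ z'`, with injectivity of `Y` used in the middle. -/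
theorem Emb.injOn (h : Emb X Z E D) (hZ : Z.IsEquiv) {A Y A' Y' : M.El Ty.two}
    (hA' : ∀ z, A' z = 1 → Img X Z E D z ∧ A (D z) = 1)
    (hY' : ∀ z, Img X Z E D z → Y' z = Y (D z)) (hY : X.InjOn Y A) : Z.InjOn Y' A' := by
  intro z z' hz hz' h1 h2 h3
  obtain ⟨hi, ha⟩ := hA' z h1
  obtain ⟨hi', ha'⟩ := hA' z' h2
  rw [hY' z hi, hY' z' hi'] at h3
  have := h.same _ _ hi.1 hi'.1 (hY _ _ hi.1 hi'.1 ha ha' h3)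
  have p1 := h.pt _ hi.1
  have p2 := h.pt _ hi'.1
  exact hZ.trans _ _ _ hz p1 hz' hi.2 (hZ.trans _ _ _ p1 p2 hz' this (hZ.symm _ _ hz' p2 hi'.2))

theorem Emb.cocode₀ (h : Emb X Z E D) (hX : X.IsEquiv) (hZ : Z.IsEquiv) (hc : Z.Cocode₀) :
    X.Cocode₀ := by
  rintro A hA ⟨x, hx, hx1⟩ ⟨Y, hY, hYA⟩
  obtain ⟨A', hA', h1, h2, h3⟩ := h.exists_image hX hZ hA
  obtain ⟨Y', hY', h4, -⟩ := h.exists_push hZ hY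
  exact h3 (hc A' hA' ⟨E x, h.pt x hx, h1 x hx hx1⟩ ⟨Y', hY', h.injOn hZ h2 h4 hYA⟩)

theorem Emb.cocode₁ (h : Emb X Z E D) (hX : X.IsEquiv) (hZ : Z.IsEquiv) (hc : Z.Cocode₁) :
    X.Cocode₁ := by
  rintro A hA ⟨Y, hY, hYA, hs⟩
  obtain ⟨A', hA', h1, h2, h3⟩ := h.exists_image hX hZ hA
  obtain ⟨Y', hY', h4, -⟩ := h.exists_push hZ hY
  refine h3 (hc A' hA' ⟨Y', hY', h.injOn hZ h2 h4 hYA, fun n => ?_⟩)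
  obtain ⟨x, hx, hx1, hn⟩ := hs n
  refine ⟨E x, h.pt x hx, h1 x hx hx1, ?_⟩
  rw [h4 _ (h.img_apply hX hx), hY _ _ (h.left_inv_pt x hx) hx (h.left_inv x hx), hn]

end

end Sp

end Str
end HOA

namespace HOA
namespace Str

/-! ### The three spaces -/

section Spaces

variable (M : Str)

def lineSp : Sp M := ⟨IsReal, EqReal⟩

def unitSp : Sp M := ⟨fun x => IsReal x ∧
  LeReal (M.con (Con.pi Ty.nat Ty.nat) (0 : M.El Ty.nat)) x ∧
  LeReal x (M.con (Con.pi Ty.nat Ty.nat) (1 : M.El Ty.nat)), EqReal⟩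

def cantorSp : Sp M := ⟨fun f => ∀ n : M.El Ty.nat, f n = 0 ∨ f n = 1, fun f g => f = g⟩

variable {M}

theorem lineSp_interprets : (lineSp M).Interprets realLine :=
  ⟨sat_isReal, sat_eqReal⟩

theorem unitSp_interprets : (unitSp M).Interprets unitInterval := by
  refine ⟨fun e t => ?_, sat_eqReal⟩
  simp only [unitInterval, sat_and, sat_isReal, sat_leReal, eval_const, eval_zero, eval_one, unitSp]

theorem cantorSp_interprets : (cantorSp M).Interprets cantorSpace := by
  refine ⟨fun e t => ?_, fun e t u => sat_eqAt e _ t u⟩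
  simp only [cantorSpace, sat_all, sat_or, sat_eq, eval_app, eval_wk, eval_var, eval_zero, eval_one,
    Asg.cons_self_zero, cantorSp]

variable [M.ACA]

theorem lineSp_isEquiv : (lineSp M).IsEquiv where
  refl _ hx := (eqReal_iff_below hx hx).2 fun _ => Iff.rfl
  symm _ _ _ _ h := h.symm
  trans _ _ _ hx hy hz h h' := (eqReal_iff_below hx hz).2 fun r =>
    ((eqReal_iff_below hx hy).1 h r).trans ((eqReal_iff_below hy hz).1 h' r)

theorem unitSp_isEquiv : (unitSp M).IsEquiv where
  refl x hx := lineSp_isEquiv.refl x hx.1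
  symm x y hx hy := lineSp_isEquiv.symm x y hx.1 hy.1
  trans x y z hx hy hz := lineSp_isEquiv.trans x y z hx.1 hy.1 hz.1

omit [M.ACA] in
theorem cantorSp_isEquiv : (cantorSp M).IsEquiv where
  refl _ _ := rfl
  symm _ _ _ _ := Eq.symm
  trans _ _ _ _ _ _ := Eq.trans

theorem unitSp_pt_iff {x : M.El Ty.one} : (unitSp M).pt x ↔
    IsReal x ∧ Below 0 x ∧ ∀ s, Below s x → s ≤ 1 := by
  refine and_congr_right fun hx => and_congr ?_ ?_
  · exact leReal_left_iff (fun k => by rw [ACA.pi, val_zero]) hx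
  · exact leReal_right_iff (fun k => by rw [ACA.pi, val_one]) hx

-- By extensionality an equation of type `1` is a number quantifier over equations of type `0`.
@[fun_prop]
theorem Df.eq_one {A : Type} [Plots M A] {f g : A → M.El Ty.one} (hf : Df M f) (hg : Df M g) :
    Df M fun a => f a = g a := by
  have : (fun a => f a = g a) = fun a => ∀ n, M.app (f a) n = M.app (g a) n := by
    funext a
    exact propext ⟨fun h n => by rw [h], fun h => M.ext h⟩
  rw [this]
  refine Df.forall ?_
  fun_prop

/-! ### The unit interval as a subset of the line -/

/-- Both maps are the identity. The image is `[0,1]` itself, whose membership is arithmetical and,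
expressed by lower cuts, independent of the representation. -/
theorem exists_emb_unit_line : ∃ E D, Sp.Emb (unitSp M) (lineSp M) E D := by
  obtain ⟨I, hI⟩ := Df.exists_rep (M := M) (σ := Ty.one) (τ := Ty.one) (f := fun x => x)
    (by fun_prop)
  refine ⟨I, I, fun x hx => ?_, fun x y _ _ h => ?_, fun z z' hz hz' hs hp => ?_,
    fun z z' hz hz' hs hp => ?_, fun x hx => ?_, fun x hx => ?_, ?_⟩
  · rw [hI]; exact hx.1
  · rw [hI, hI]; exact h
  · rw [hI] at hp ⊢
    rw [unitSp_pt_iff] at hp ⊢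
    have h := (eqReal_iff_below hz hz').1 hs
    exact ⟨hz', (h 0).1 hp.2.1, fun s hs => hp.2.2 s ((h s).2 hs)⟩
  · rw [hI, hI]; exact hs
  · rw [hI, hI]; exact hx
  · rw [hI, hI]; exact lineSp_isEquiv.refl x hx.1
  · unfold unitSp lineSp
    fun_prop

/-! ### The line as a subset of Cantor space: lower cuts -/

/-- The witness is `x (k + 1) - 2 ^ (-(k + 1))`: it is at most `x`, and `x` exceeds it by at most
twice `2 ^ (-(k + 1))`. The property mentions `x` only through its lower cut, so it can be searched
for knowing the cut alone. -/
theorem IsReal.exists_approx {x : M.El Ty.one} (hx : IsReal x) (k : M.El Ty.nat) :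
    ∃ q : M.El Ty.nat, BelowCode q x ∧ ∀ q', ¬ LeRat q' q 1 k → ¬ BelowCode q' x := by
  obtain ⟨q, hq⟩ := exists_val_eq (val (x (k + 1)) - del (k + 1))
  simp only [belowCode_iff, leRat_iff, num_one, one_mul]
  refine ⟨q, by rw [hq]; exact hx.below_sub _, fun q' h h' => h ?_⟩
  have h1 := h' (k + 1)
  have h2 := del_add_one k
  linarith

/-- A sequence of rational numbers `yₖ ≤ x ≤ yₖ + 2 ^ (-k)` represents `x`. -/
theorem IsReal.of_approx {x y : M.El Ty.one} (hx : IsReal x)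
    (h : ∀ k : M.El Ty.nat, BelowCode (y k) x ∧ ∀ q', ¬ LeRat q' (y k) 1 k → ¬ BelowCode q' x) :
    IsReal y ∧ EqReal y x := by
  have h1 : ∀ k r, Below r x → r ≤ val (y k) + del k := fun k r hr => by
    obtain ⟨q, rfl⟩ := exists_val_eq r
    by_contra hlt
    refine (h k).2 q ?_ (belowCode_iff.2 hr)
    rwa [leRat_iff, num_one, one_mul]
  have h2 : ∀ k, Below (val (y k)) x := fun k => belowCode_iff.1 (h k).1
  refine ⟨isReal_iff.2 fun k i => ⟨?_, h1 k _ (h2 _)⟩, eqReal_iff.2 fun k => ⟨?_, ?_⟩⟩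
  · exact (h1 (k + i) _ (h2 k)).trans (add_le_add_right (del_anti (le_self_add)) _)
  · have := h2 k k
    have := del_pos k
    linarith
  · have := h1 k _ (hx.below_sub k)
    linarith

/-- `E x` is the characteristic function of the lower cut of `x`; since `chi` is `0` on true
statements, the negation produces the value `1` on the cut. `D c` searches, for each `k`, an element
`q` of `c` such that no element exceeds `q + 2 ^ (-k)`. -/
theorem exists_emb_line_cantor : ∃ E D, Sp.Emb (lineSp M) (cantorSp M) E D := by
  obtain ⟨E, hE⟩ := Df.exists_rep (M := M) (σ := Ty.one) (τ := Ty.one)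
    (f := fun x => Str.lam fun q : M.El Ty.nat => (chi (¬ BelowCode q x) : M.El Ty.nat))
    (by fun_prop)
  have hd : Df M fun p : (M.El Ty.one × M.El Ty.nat) × M.El Ty.nat => M.app p.1.1 p.2 = 1 ∧
      ∀ q', ¬ LeRat q' p.2 1 p.1.2 → ¬ M.app p.1.1 q' = 1 := by
    refine Df.and (by fun_prop) (Df.forall (Df.imp ?_ ?_)) <;> fun_prop
  obtain ⟨D, hD⟩ := Df.exists_rep (M := M) (σ := Ty.one) (τ := Ty.one)
    (f := fun c => Str.lam fun k : M.El Ty.nat => eps fun q : M.El Ty.nat => M.app c q = 1 ∧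
      ∀ q', ¬ LeRat q' q 1 k → ¬ M.app c q' = 1) (Df.lam (Df.eps hd))
  have hd' : Df M fun p : M.El Ty.one × M.El Ty.nat => eps fun q : M.El Ty.nat =>
      M.app p.1 q = 1 ∧ ∀ q', ¬ LeRat q' q 1 p.2 → ¬ M.app p.1 q' = 1 := Df.eps hd
  have hE' : ∀ x q, E x q = (chi (¬ BelowCode q x) : M.El Ty.nat) := fun x q => by
    rw [hE, lam_app (by fun_prop)]
  have hE1 : ∀ x q, E x q = (1 : M.El Ty.nat) ↔ BelowCode q x := fun x q => by
    rw [hE', chi_eq_one, not_not]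
  have hD' : ∀ c k, (∃ q, M.app c q = 1 ∧ ∀ q', ¬ LeRat q' q 1 k → ¬ M.app c q' = 1) →
      M.app c (D c k) = 1 ∧ ∀ q', ¬ LeRat q' (D c k) 1 k → ¬ M.app c q' = 1 := fun c k h => by
    have h1 : Df M fun k : M.El Ty.nat => eps fun q : M.El Ty.nat => M.app c q = 1 ∧
        ∀ q', ¬ LeRat q' q 1 k → ¬ M.app c q' = 1 :=
      hd'.comp (show Df M fun k : M.El Ty.nat => (c, k) by fun_prop)
    have h2 : Df M fun q : M.El Ty.nat => M.app c q = 1 ∧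
        ∀ q', ¬ LeRat q' q 1 k → ¬ M.app c q' = 1 :=
      hd.comp (show Df M fun q : M.El Ty.nat => ((c, k), q) by fun_prop)
    rw [hD, lam_app h1]
    exact eps_spec h2 h
  have hDE : ∀ x, IsReal x → IsReal (D (E x)) ∧ EqReal (D (E x)) x := fun x hx => by
    refine hx.of_approx fun k => ?_
    have := hD' (E x) k
    simp only [hE1] at this
    exact this (hx.exists_approx k)
  refine ⟨E, D, fun x _ q => ?_, fun x y hx hy h => M.ext fun q => ?_,
    fun z z' _ _ hs hp => ?_, fun z z' _ _ hs hp => ?_, fun x hx => (hDE x hx).1,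
    fun x hx => (hDE x hx).2, ?_⟩
  · rw [hE', chi_eq_zero, chi_eq_one]
    tauto
  · rw [hE', hE', (eqReal_iff_belowCode hx hy).1 h q]
  · obtain rfl : z = z' := hs
    exact hp
  · obtain rfl : z = z' := hs
    exact lineSp_isEquiv.refl _ hp
  · unfold lineSp cantorSp
    fun_prop

/-! ### Cantor space as a subset of the unit interval: expansions in base four -/

/-- `∑_{i < k} 4 ^ (k - 1 - i) f(i)`. -/
noncomputable def quad (f : M.El Ty.one) (k : M.El Ty.nat) : M.El Ty.nat :=
  recn (fun i p => 4 * p + M.app f i) 0 k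

@[fun_prop]
theorem Df.quad {A : Type} [Plots M A] {f : A → M.El Ty.one} {k : A → M.El Ty.nat} (hf : Df M f)
    (hk : Df M k) : Df M fun a => quad (f a) (k a) := by
  have : Df M fun p : M.El Ty.one × M.El Ty.nat => Str.quad p.1 p.2 := by
    unfold Str.quad
    fun_prop
  exact this.comp (hf.prodMk hk)

theorem quad_zero (f : M.El Ty.one) : quad f 0 = 0 := recn_zero _ _

theorem quad_add_one (f : M.El Ty.one) (k : M.El Ty.nat) :
    quad f (k + 1) = 4 * quad f k + f k := by
  rw [← suc_eq_add_one]
  exact recn_suc (by fun_prop) _ _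

theorem quad_mul_le (f : M.El Ty.one) (k i : M.El Ty.nat) :
    quad f k * (p2 i * p2 i) ≤ quad f (k + i) := by
  refine induction_add_one (P := fun i => quad f k * (p2 i * p2 i) ≤ quad f (k + i)) (by fun_prop)
    ?_ (fun i h => ?_) i
  · rw [p2_zero, add_zero, mul_one, mul_one]
  · rw [← add_assoc, quad_add_one, p2_add_one]
    calc quad f k * (2 * p2 i * (2 * p2 i)) = 4 * (quad f k * (p2 i * p2 i)) := by ring
      _ ≤ 4 * quad f (k + i) := mul_le_mul_right h 4
      _ ≤ _ := le_self_add

/-- The upper bound `(quad f k + 1/2) / 4 ^ k` does not increase with `k`, because a digit `d ≤ 1`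
satisfies `2 d + 1 ≤ 4`. It is doubled to remain in the semiring, and `4 ^ i` is written `p2 i * p2
i`. -/
theorem le_quad_mul {f : M.El Ty.one} (hf : ∀ n : M.El Ty.nat, f n = 0 ∨ f n = 1)
    (k i : M.El Ty.nat) : 2 * quad f (k + i) + 1 ≤ (2 * quad f k + 1) * (p2 i * p2 i) := by
  refine induction_add_one
    (P := fun i => 2 * quad f (k + i) + 1 ≤ (2 * quad f k + 1) * (p2 i * p2 i)) (by fun_prop)
    ?_ (fun i h => ?_) i
  · rw [p2_zero, add_zero, mul_one, mul_one]
  · have h1 : 2 * f (k + i) + 1 ≤ (4 : M.El Ty.nat) := by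
      rcases hf (k + i) with h | h <;> rw [h]
      · exact ⟨3, by ring⟩
      · exact ⟨1, by ring⟩
    rw [← add_assoc, quad_add_one, p2_add_one]
    calc 2 * (4 * quad f (k + i) + f (k + i)) + 1
        = 4 * (2 * quad f (k + i)) + (2 * f (k + i) + 1) := by ring
      _ ≤ 4 * (2 * quad f (k + i)) + 4 := add_le_add_right h1 _
      _ = 4 * (2 * quad f (k + i) + 1) := by ring
      _ ≤ 4 * ((2 * quad f k + 1) * (p2 i * p2 i)) := mul_le_mul_right h 4
      _ = _ := by ring

theorem del_add (k i : M.El Ty.nat) : del k = del (k + i) * num (p2 i) := by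
  have h1 := num_p2_pos k
  have h2 := num_p2_pos i
  rw [del, del, p2_add, num_mul]
  field_simp

/-- The partial sums are below the partial sums increased by a bound for the rest. -/
theorem quad_mul_del_le {f : M.El Ty.one} (hf : ∀ n : M.El Ty.nat, f n = 0 ∨ f n = 1)
    (m n : M.El Ty.nat) :
    num (quad f m) * (del m * del m) ≤ (num (quad f n) + 1 / 2) * (del n * del n) := by
  -- The lower bounds increase and the upper bounds decrease, so any lower bound is at most any
  -- upper bound, whichever index is larger.
  have key : ∀ k i : M.El Ty.nat,
      num (quad f k) * (del k * del k) ≤ num (quad f (k + i)) * (del (k + i) * del (k + i)) ∧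
      (num (quad f (k + i)) + 1 / 2) * (del (k + i) * del (k + i)) ≤
        (num (quad f k) + 1 / 2) * (del k * del k) := by
    intro k i
    have h1 := num_le.2 (quad_mul_le f k i)
    have h2 := num_le.2 (le_quad_mul hf k i)
    simp only [num_add, num_mul, num_two, num_one] at h1 h2
    have h3 := mul_pos (del_pos (k + i)) (del_pos (k + i))
    rw [del_add k i]
    constructor
    · calc _ = num (quad f k) * (num (p2 i) * num (p2 i)) * (del (k + i) * del (k + i)) := by ring
        _ ≤ _ := mul_le_mul_of_nonneg_right h1 h3.le
    · calc (num (quad f (k + i)) + 1 / 2) * (del (k + i) * del (k + i))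
          ≤ ((num (quad f k) + 1 / 2) * (num (p2 i) * num (p2 i))) *
            (del (k + i) * del (k + i)) := mul_le_mul_of_nonneg_right (by linarith) h3.le
        _ = _ := by ring
  have hlt : ∀ k, num (quad f k) * (del k * del k) ≤ (num (quad f k) + 1 / 2) * (del k * del k) :=
    fun k => by
      have := mul_pos (del_pos k) (del_pos k)
      linarith
  rcases le_total m n with ⟨i, rfl⟩ | ⟨i, rfl⟩
  · exact (key m i).1.trans (hlt _)
  · exact (hlt _).trans (key n i).2

theorem del_zero : del (0 : M.El Ty.nat) = 1 := by
  rw [del, p2_zero, num_one, one_div_one]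

theorem del_le_one (k : M.El Ty.nat) : del k ≤ 1 := del_zero (M := M) ▸ del_anti (zero_le' k)

section Expansion

variable {f x : M.El Ty.one} (hf : ∀ n : M.El Ty.nat, f n = 0 ∨ f n = 1)
  (hx : ∀ k : M.El Ty.nat, val (x k) = num (quad f k) * (del k * del k))

include hf hx

/-- The remainder after `k` digits is at most half of `4 ^ (-k)`, which is absorbed by `2 ^ (-k)`.
Thus the partial sums converge fast enough to represent a real. -/
theorem expansion_le (n k : M.El Ty.nat) :
    num (quad f n) * (del n * del n) ≤ val (x k) + del k := by
  have h1 := quad_mul_del_le hf n k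
  have h2 := mul_le_mul_of_nonneg_left (del_le_one k) (del_pos k).le
  have h3 := del_pos k
  rw [hx]
  linarith

theorem expansion_below (n : M.El Ty.nat) : Below (num (quad f n) * (del n * del n)) x :=
  fun k => expansion_le hf hx n k

theorem Below.le_expansion {r : Frac (M.El Ty.nat)} (hr : Below r x) (n : M.El Ty.nat) :
    r ≤ (num (quad f n) + 1 / 2) * (del n * del n) := by
  refine le_of_forall_del one_pos 0 fun k _ => ?_
  have h1 := quad_mul_del_le hf k n
  have h2 := hr k
  rw [hx] at h2
  linarith

theorem expansion_isReal : IsReal x := by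
  rw [isReal_iff]
  intro k i
  have h1 := expansion_le hf hx k (k + i)
  have h2 := expansion_le hf hx (k + i) k
  rw [← hx] at h1 h2
  have h3 := del_anti (le_self_add : k ≤ k + i)
  exact ⟨by linarith, h2⟩

theorem expansion_pt : (unitSp M).pt x := by
  refine unitSp_pt_iff.2 ⟨expansion_isReal hf hx, ?_, fun s hs => ?_⟩
  · have := expansion_below hf hx 0
    rwa [quad_zero, num_zero, zero_mul] at this
  · have := hs.le_expansion hf hx 0
    rw [quad_zero, num_zero, del_zero] at this
    linarith

/-- The digits of an expansion can be read off from its lower cut. -/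
theorem digit_iff (n : M.El Ty.nat) :
    (∃ m : M.El Ty.nat, Below (num (4 * m + 1) * (del (n + 1) * del (n + 1))) x ∧
      ¬ Below (num (4 * m + 2) * (del (n + 1) * del (n + 1))) x) ↔ f n = 1 := by
  have hd := mul_pos (del_pos (n + 1)) (del_pos (n + 1))
  constructor
  -- Write `Q` for `quad f n`. The cut conditions give `4 m + 1 ≤ quad f (n + 1) + 1/2` and `quad f
  -- (n + 1) < 4 m + 2`. If the digit were `0`, then `quad f (n + 1) = 4 Q`; the first inequality
  -- forces `m < Q`, the second `Q ≤ m`.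
  · rintro ⟨m, h1, h2⟩
    have h3 := le_of_mul_le_mul_right (h1.le_expansion hf hx (n + 1)) hd
    have h4 : num (quad f (n + 1)) < num (4 * m + 2) := by
      by_contra h
      exact h2 ((expansion_below hf hx (n + 1)).mono (mul_le_mul_of_nonneg_right (not_lt.1 h) hd.le))
    refine (hf n).resolve_left fun h0 => ?_
    rw [quad_add_one, h0, add_zero] at h3 h4
    have h5 : m < quad f n := by
      by_contra h
      have := num_le.2 (not_lt.1 h)
      simp only [num_add, num_mul, num_four, num_one] at h3
      linarith
    have h6 := num_le.2 (lt_iff_add_one_le.1 h5)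
    simp only [num_add, num_mul, num_four, num_one, num_two] at h4 h6
    linarith
  · intro h1
    -- With this `m` the partial sum has numerator exactly `4 m + 1`, while `4 m + 2` exceeds its
    -- upper bound `4 m + 1 + 1/2`.
    refine ⟨quad f n, ?_, fun h => ?_⟩
    · have := expansion_below hf hx (n + 1)
      rwa [quad_add_one, h1] at this
    · have := le_of_mul_le_mul_right (h.le_expansion hf hx (n + 1)) hd
      rw [quad_add_one, h1] at this
      simp only [num_add, num_mul, num_four, num_one, num_two] at this
      linarith

end Expansion

/-- `q` codes `a / 4 ^ k`. -/
def IsQuadFrac (q a k : M.El Ty.nat) : Prop := ∃ c, c + 1 = p2 k * p2 k ∧ IsRat q a 0 c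

theorem IsQuadFrac.val_eq {q a k : M.El Ty.nat} (h : IsQuadFrac q a k) :
    val q = num a * (del k * del k) := by
  obtain ⟨c, hc, h⟩ := h
  have := num_p2_pos k
  rw [h.val_eq, num_zero, sub_zero, ← num_one, ← num_add, hc, num_mul, del]
  field_simp

theorem exists_isQuadFrac (a k : M.El Ty.nat) : ∃ q, IsQuadFrac q a k := by
  obtain ⟨c, hc⟩ := (eq_zero_or_eq_add_one (p2 k * p2 k)).resolve_left
    (mul_pos (p2_pos k) (p2_pos k)).ne'
  obtain ⟨q, hq⟩ := exists_rat_code a 0 c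
  exact ⟨q, c, hc.symm, hq⟩

@[fun_prop]
theorem Df.isQuadFrac {A : Type} [Plots M A] {q a k : A → M.El Ty.nat} (hq : Df M q) (ha : Df M a)
    (hk : Df M k) : Df M fun x => IsQuadFrac (q x) (a x) (k x) := by
  have : Df M fun p : M.El Ty.nat × M.El Ty.nat × M.El Ty.nat => IsQuadFrac p.1 p.2.1 p.2.2 := by
    unfold Str.IsQuadFrac
    fun_prop
  exact this.comp (hq.prodMk (ha.prodMk hk))

/-- The digit `n` of `x` in base four is `1`. -/
def IsDigit (x : M.El Ty.one) (n : M.El Ty.nat) : Prop :=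
  ∃ m q q' : M.El Ty.nat, IsQuadFrac q (4 * m + 1) (n + 1) ∧ IsQuadFrac q' (4 * m + 2) (n + 1) ∧
    BelowCode q x ∧ ¬ BelowCode q' x

theorem isDigit_iff {x : M.El Ty.one} {n : M.El Ty.nat} : IsDigit x n ↔
    ∃ m : M.El Ty.nat, Below (num (4 * m + 1) * (del (n + 1) * del (n + 1))) x ∧
      ¬ Below (num (4 * m + 2) * (del (n + 1) * del (n + 1))) x := by
  refine exists_congr fun m => ⟨?_, fun h => ?_⟩
  · rintro ⟨q, q', h, h', h1, h2⟩
    rw [belowCode_iff, h.val_eq] at h1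
    rw [belowCode_iff, h'.val_eq] at h2
    exact ⟨h1, h2⟩
  · obtain ⟨q, hq⟩ := exists_isQuadFrac (4 * m + 1) (n + 1)
    obtain ⟨q', hq'⟩ := exists_isQuadFrac (4 * m + 2) (n + 1)
    refine ⟨q, q', hq, hq', ?_, ?_⟩
    · rw [belowCode_iff, hq.val_eq]; exact h.1
    · rw [belowCode_iff, hq'.val_eq]; exact h.2

@[fun_prop]
theorem Df.isDigit {A : Type} [Plots M A] {x : A → M.El Ty.one} {n : A → M.El Ty.nat}
    (hx : Df M x) (hn : Df M n) : Df M fun a => IsDigit (x a) (n a) := by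
  have : Df M fun p : M.El Ty.one × M.El Ty.nat => IsDigit p.1 p.2 := by
    unfold Str.IsDigit
    fun_prop
  exact this.comp (hx.prodMk hn)

/-- `E f` lists codes of the partial sums of `∑ f(i) / 4 ^ (i + 1)`. `D` reads digits from the lower
cut, so it depends only on the real number represented. -/
theorem exists_emb_cantor_unit : ∃ E D, Sp.Emb (cantorSp M) (unitSp M) E D := by
  obtain ⟨E, hE⟩ := Df.exists_rep (M := M) (σ := Ty.one) (τ := Ty.one)
    (f := fun f => Str.lam fun k : M.El Ty.nat => eps fun q => IsQuadFrac q (quad f k) k)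
    (by fun_prop)
  obtain ⟨D, hD⟩ := Df.exists_rep (M := M) (σ := Ty.one) (τ := Ty.one)
    (f := fun x => Str.lam fun n : M.El Ty.nat => (chi (¬ IsDigit x n) : M.El Ty.nat))
    (by fun_prop)
  have hE' : ∀ f (k : M.El Ty.nat), val (E f k) = num (quad f k) * (del k * del k) := fun f k => by
    rw [hE, lam_app (by fun_prop)]
    exact (eps_spec (P := fun q => IsQuadFrac q (quad f k) k) (by fun_prop)
      (exists_isQuadFrac _ _)).val_eq
  have hD' : ∀ x n, D x n = (chi (¬ IsDigit x n) : M.El Ty.nat) := fun x n => by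
    rw [hD, lam_app (by fun_prop)]
  have hDpt : ∀ x, (cantorSp M).pt (D x) := fun x n => by
    rw [hD', chi_eq_zero, chi_eq_one]
    tauto
  have hDs : ∀ z z', (unitSp M).pt z → (unitSp M).pt z' → EqReal z z' → D z = D z' :=
    fun z z' hz hz' hs => M.ext fun n => by
      rw [hD', hD']
      simp only [isDigit_iff, (eqReal_iff_below hz.1 hz'.1).1 hs]
  refine ⟨E, D, fun f hf => expansion_pt hf (hE' f), fun f g hf _ h => ?_,
    fun z z' _ _ _ _ => hDpt z', fun z z' hz hz' hs _ => hDs z z' hz hz' hs, fun f _ => hDpt _,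
    fun f hf => M.ext fun n => ?_, ?_⟩
  · obtain rfl : f = g := h
    exact unitSp_isEquiv.refl _ (expansion_pt hf (hE' f))
  · have h := (isDigit_iff (x := M.app E f)).trans (digit_iff hf (hE' f) n)
    rw [hD']
    rcases hf n with h0 | h1
    · rw [h0, chi_eq_zero, h, h0]
      exact one_ne_zero_aux.symm
    · rw [h1, chi_eq_one, not_not, h, h1]
  -- `D z` is a binary sequence for every `z`, so the image is described by the single condition `z
  -- = E (D z)` in the reals.
  · have : (fun z => (cantorSp M).pt (M.app D z) ∧ (unitSp M).same z (M.app E (M.app D z))) =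
        fun z => EqReal z (M.app E (M.app D z)) := by
      funext z
      exact propext ⟨fun h => h.2, fun h => ⟨hDpt z, h⟩⟩
    rw [this]
    fun_prop

end Spaces

/-! ### The equivalences -/

/-- The embeddings form a cycle from the interval to the line, to Cantor space and back. Each
implication between two principles is a path around it, traversed backwards. -/
theorem cocode₀_unit_iff_line (M : Str) [M.ACA] : (unitSp M).Cocode₀ ↔ (lineSp M).Cocode₀ := by
  obtain ⟨_, _, h1⟩ := exists_emb_unit_line (M := M)
  obtain ⟨_, _, h2⟩ := exists_emb_line_cantor (M := M)
  obtain ⟨_, _, h3⟩ := exists_emb_cantor_unit (M := M)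
  exact ⟨fun h => h2.cocode₀ lineSp_isEquiv cantorSp_isEquiv
    (h3.cocode₀ cantorSp_isEquiv unitSp_isEquiv h), h1.cocode₀ unitSp_isEquiv lineSp_isEquiv⟩

theorem cocode₀_line_iff_cantor (M : Str) [M.ACA] : (lineSp M).Cocode₀ ↔ (cantorSp M).Cocode₀ := by
  obtain ⟨_, _, h2⟩ := exists_emb_line_cantor (M := M)
  obtain ⟨_, _, h3⟩ := exists_emb_cantor_unit (M := M)
  exact ⟨fun h => h3.cocode₀ cantorSp_isEquiv unitSp_isEquiv ((cocode₀_unit_iff_line M).2 h),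
    h2.cocode₀ lineSp_isEquiv cantorSp_isEquiv⟩

theorem cocode₁_unit_iff_line (M : Str) [M.ACA] : (unitSp M).Cocode₁ ↔ (lineSp M).Cocode₁ := by
  obtain ⟨_, _, h1⟩ := exists_emb_unit_line (M := M)
  obtain ⟨_, _, h2⟩ := exists_emb_line_cantor (M := M)
  obtain ⟨_, _, h3⟩ := exists_emb_cantor_unit (M := M)
  exact ⟨fun h => h2.cocode₁ lineSp_isEquiv cantorSp_isEquiv
    (h3.cocode₁ cantorSp_isEquiv unitSp_isEquiv h), h1.cocode₁ unitSp_isEquiv lineSp_isEquiv⟩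

theorem cocode₁_line_iff_cantor (M : Str) [M.ACA] : (lineSp M).Cocode₁ ↔ (cantorSp M).Cocode₁ := by
  obtain ⟨_, _, h2⟩ := exists_emb_line_cantor (M := M)
  obtain ⟨_, _, h3⟩ := exists_emb_cantor_unit (M := M)
  exact ⟨fun h => h3.cocode₁ cantorSp_isEquiv unitSp_isEquiv ((cocode₁_unit_iff_line M).2 h),
    h2.cocode₁ lineSp_isEquiv cantorSp_isEquiv⟩

end Str

/-- What holds in every extensional model of `ACA₀^ω` is provable. -/
theorem proves_ACA0ω {φ : Fm} (h : ∀ M : Str, M.ACA → ∀ e : M.Asg, Str.Sat e φ) :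
    Proves ACA0ω φ :=
  proves_of_models substClosed_ACA0ω (fun ρ τ => Or.inl (RCA0ω.extensionality ρ τ))
    fun M hM e => h M hM.aca e

end HOA

/-! ### Provability of the equivalences -/

theorem mainTheorem7 :
    (HOA.Proves HOA.ACA0ω (HOA.Fm.iff HOA.unitInterval.cocode₀ HOA.realLine.cocode₀) ∧
      HOA.Proves HOA.ACA0ω (HOA.Fm.iff HOA.realLine.cocode₀ HOA.cantorSpace.cocode₀)) ∧
    (HOA.Proves HOA.ACA0ω (HOA.Fm.iff HOA.unitInterval.cocode₁ HOA.realLine.cocode₁) ∧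
      HOA.Proves HOA.ACA0ω (HOA.Fm.iff HOA.realLine.cocode₁ HOA.cantorSpace.cocode₁)) := by
  refine ⟨⟨?_, ?_⟩, ?_, ?_⟩ <;> refine HOA.proves_ACA0ω fun M hM e => ?_ <;>
    rw [HOA.Str.sat_iff]
  · rw [HOA.Str.unitSp_interprets.sat_cocode₀, HOA.Str.lineSp_interprets.sat_cocode₀]
    exact HOA.Str.cocode₀_unit_iff_line M
  · rw [HOA.Str.lineSp_interprets.sat_cocode₀, HOA.Str.cantorSp_interprets.sat_cocode₀]
    exact HOA.Str.cocode₀_line_iff_cantor M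
  · rw [HOA.Str.unitSp_interprets.sat_cocode₁, HOA.Str.lineSp_interprets.sat_cocode₁]
    exact HOA.Str.cocode₁_unit_iff_line M
  · rw [HOA.Str.lineSp_interprets.sat_cocode₁, HOA.Str.cantorSp_interprets.sat_cocode₁]
    exact HOA.Str.cocode₁_line_iff_cantor M
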